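/- Let $n\ge 2$, $J=\mathrm{diag}(1,\dots,1,-1)$, $G=SO(n,1)=\{g\in SL_{n+1}(\mathbf R): Jg^{T}J=g^{-1}\}$ with Lie algebra $\mathfrak g$, let $\Gamma\subset G$ be a lattice, $X=G/\Gamma$, and let $\mu$ be the $G$-invariant probability measure on $X$. Let $d_G$ be a right-invariant metric on $G$ inducing its topology, and let $d_X(x,y)=\inf\{d_G(g,h): g\Gamma=x,\ h\Gamma=y\}$. In block form with block sizes $n-1,1,1$, and with $e=e_{n-1}\in\mathbf R^{n-1}$ the last standard basis vector, put $$U=\begin{pmatrix}0&e&e\\-e^{T}&0&0\\e^{T}&0&0\end{pmatrix},\quad \tilde U=\begin{pmatrix}0&-e&e\\e^{T}&0&0\\e^{T}&0&0\end{pmatrix},\quad Y_n=\begin{pmatrix}0&0&0\\0&0&1\\0&1&0\end{pmatrix},\quad u^{t}=\exp(tU).$$ Let $\iota:SL_2(\mathbf R)\to SO(2,1)\subset G$ be the isogeny onto the connected subgroup with Lie algebra $\mathfrak{sl}_2=\mathrm{span}\{U,Y_n,\tilde U\}$ whose derivative sends $E_{21}\mapsto U$, $E_{12}\mapsto\tilde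 U$, $\mathrm{diag}(\tfrac12,-\tfrac12)\mapsto Y_n$. Let $V^{\perp}$ be the Killing-orthogonal complement of $\mathfrak{sl}_2$ in $\mathfrak g$. Under the adjoint action of $\mathfrak{sl}_2$ it is the direct sum of $n-2$ irreducible representations of highest weight $\varsigma=2$, the $j$-th having a basis $v_0^{j},v_1^{j},v_2^{j}$ with $[U,v_i^{j}]=(i+1)v_{i+1}^{j}$ (where $v_3^{j}=0$) and $[Y_n,v_i^{j}]=(1-i)v_i^{j}$, and of the trivial representation $\mathfrak{so}(n-2)$ ($\varsigma=0$). Let $\eta\in(0,1)$. There are $\rho>0$, $\theta>0$, $C>0$ and $\sigma_\rho>0$ such that for every $\sigma\in(0,\sigma_\rho)$ there is a compact $K\subset X$ with $\mu(K)>1-\sigma$ such that for every $m>1$ there is $\epsilon_0\in(0,1)$ with the following property for every $\epsilon\in(0,\epsilon_0]$. Let $x\in K$, let $y\in X$ with $d_X(x,y)<\epsilon$, let $A\subset[0,\infty)$ and let $t:[0,\infty)\to[0,\infty)$ be increasing, such that (i) for all $s\in A$: $u^{s}x\in K$ and $d_X(u^{t(s)}y,u^{s}x)<\epsilon$; (ii)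 for all $s,s'\in A$ with $s'>s$ and $\max\{s'-s,\ t(s')-t(s)\}\ge m$: $$|(t(s')-t(s))-(s'-s)|\le|s'-s|^{1-\eta}.$$ Then for every $\lambda\in A$ with $\mathrm{Leb}(A\cap[0,\lambda])>(1-\theta)\lambda$ there are $s_\lambda\in A\cap[0,\lambda]$, $\begin{pmatrix}a&b\\c&d\end{pmatrix}\in SL_2(\mathbf R)$ and $v_\lambda\in V^{\perp}$ with $$u^{t(s_\lambda)}y=h_\lambda\exp(v_\lambda)\,u^{s_\lambda}x,\qquad h_\lambda=\iota\begin{pmatrix}a&b\\c&d\end{pmatrix},$$ $$|a-1|\le C\lambda^{-2\rho},\quad |b|\le C\lambda^{-1-2\rho},\quad |c|\le C\epsilon,\quad |d-1|\le C\lambda^{-2\rho},$$ and $v_\lambda=\sum_{j=1}^{n-2}(b_0^{j}v_0^{j}+b_1^{j}v_1^{j}+b_2^{j}v_2^{j})+S$ with $S\in\mathfrak{so}(n-2)$, $$|b_0^{j}|\le C\lambda^{-\frac{1+2\rho}{2}\cdot 2},\quad |b_1^{j}|\le C\lambda^{-\frac{1+2\rho}{2}},\quad |b_2^{j}|\le C\epsilon,\quad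 |S_{ij}|\le C\epsilon .$$ -/

import Mathlib

open Matrix MeasureTheory Set Topology

noncomputable section

/-! Throughout, `n = k + 2` with `k` an arbitrary natural number, and the `n + 1` coordinates are
indexed by `Fin k ⊕ Fin 3`: first the coordinates `1, …, n - 2`, then `n - 1, n, n + 1`. -/

/-- Square matrices of size `n + 1 = k + 3`. -/
abbrev Mat (k : ℕ) : Type := Matrix (Fin k ⊕ Fin 3) (Fin k ⊕ Fin 3) ℝ

/-- The lower right `3 × 3` corner of the form. -/
def J3 : Matrix (Fin 3) (Fin 3) ℝ := Matrix.diagonal ![1, 1, -1]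

/-- The form `diag (1, …, 1, -1)` of signature `(n, 1)`. -/
def formJ (k : ℕ) : Mat k := Matrix.fromBlocks 1 0 0 J3

theorem J3_mul_J3 : J3 * J3 = 1 := by
  ext i j; fin_cases i <;> fin_cases j <;> simp [J3]

theorem J3_transpose : J3ᵀ = J3 := by
  simp [J3]

theorem formJ_mul_formJ (k : ℕ) : formJ k * formJ k = 1 := by
  simp [formJ, Matrix.fromBlocks_multiply, J3_mul_J3]

/-- The group `SO(n, 1) = {g ∈ SL(n + 1, ℝ) : J gᵀ J = g⁻¹}`. -/
def SOn1 (k : ℕ) : Subgroup (Matrix.SpecialLinearGroup (Fin k ⊕ Fin 3) ℝ) where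
  carrier := {g | formJ k * (g : Mat k)ᵀ * formJ k = (g : Mat k)⁻¹}
  mul_mem' := by
    intro a b ha hb
    change formJ k * ((a * b : Matrix.SpecialLinearGroup (Fin k ⊕ Fin 3) ℝ) : Mat k)ᵀ * formJ k
      = ((a * b : Matrix.SpecialLinearGroup (Fin k ⊕ Fin 3) ℝ) : Mat k)⁻¹
    change formJ k * (a : Mat k)ᵀ * formJ k = (a : Mat k)⁻¹ at ha
    change formJ k * (b : Mat k)ᵀ * formJ k = (b : Mat k)⁻¹ at hb
    rw [Matrix.SpecialLinearGroup.coe_mul, Matrix.mul_inv_rev, transpose_mul, ← ha, ← hb]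
    calc formJ k * ((b : Mat k)ᵀ * (a : Mat k)ᵀ) * formJ k
        = formJ k * (b : Mat k)ᵀ * 1 * (a : Mat k)ᵀ * formJ k := by simp [mul_assoc]
      _ = _ := by rw [← formJ_mul_formJ k]; simp only [mul_assoc]
  one_mem' := by
    change formJ k * ((1 : Matrix.SpecialLinearGroup (Fin k ⊕ Fin 3) ℝ) : Mat k)ᵀ * formJ k
      = ((1 : Matrix.SpecialLinearGroup (Fin k ⊕ Fin 3) ℝ) : Mat k)⁻¹
    simp [formJ_mul_formJ]
  inv_mem' := by
    intro a ha
    change formJ k * (a : Mat k)ᵀ * formJ k = (a : Mat k)⁻¹ at ha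
    have h1 : ((a⁻¹ : Matrix.SpecialLinearGroup (Fin k ⊕ Fin 3) ℝ) : Mat k) = (a : Mat k)⁻¹ := by
      rw [Matrix.SpecialLinearGroup.coe_inv, Matrix.inv_def, a.2]; simp
    have h2 : ((a : Mat k)⁻¹)⁻¹ = (a : Mat k) :=
      Matrix.nonsing_inv_nonsing_inv _ (by rw [a.2]; exact isUnit_one)
    change formJ k * ((a⁻¹ : Matrix.SpecialLinearGroup (Fin k ⊕ Fin 3) ℝ) : Mat k)ᵀ * formJ k
      = ((a⁻¹ : Matrix.SpecialLinearGroup (Fin k ⊕ Fin 3) ℝ) : Mat k)⁻¹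
    rw [h1, h2, ← ha]
    have hJ : (formJ k)ᵀ = formJ k := by
      simp [formJ, Matrix.fromBlocks_transpose, J3_transpose]
    simp only [transpose_mul, transpose_transpose, hJ]
    calc formJ k * (formJ k * ((a : Mat k) * formJ k)) * formJ k
        = (formJ k * formJ k) * (a : Mat k) * (formJ k * formJ k) := by simp only [mul_assoc]
      _ = _ := by simp [formJ_mul_formJ]

/-- The Lie algebra `𝔰𝔬(n, 1) = {v ∈ 𝔰𝔩(n + 1, ℝ) : J vᵀ J = -v}` (as a vector space). -/
def so (k : ℕ) : Submodule ℝ (Mat k) where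
  carrier := {v | v.trace = 0 ∧ formJ k * vᵀ * formJ k = -v}
  add_mem' := by
    rintro a b ⟨ha, ha'⟩ ⟨hb, hb'⟩
    refine ⟨by simp [ha, hb], ?_⟩
    rw [transpose_add, mul_add, add_mul, ha', hb', neg_add]
  zero_mem' := by simp
  smul_mem' := by
    rintro c a ⟨ha, ha'⟩
    refine ⟨by simp [ha], ?_⟩
    rw [transpose_smul, mul_smul_comm, smul_mul_assoc, ha', smul_neg]

theorem formJ_mul_exp (k : ℕ) {v : Mat k} (hv : v ∈ so k) :
    formJ k * (NormedSpace.exp v)ᵀ * formJ k = NormedSpace.exp (-v) := by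
  have hJ : (formJ k)⁻¹ = formJ k := Matrix.inv_eq_left_inv (formJ_mul_formJ k)
  have hu : IsUnit (formJ k) := IsUnit.of_mul_eq_one _ (formJ_mul_formJ k)
  rw [← hv.2, ← Matrix.exp_transpose]
  have h := Matrix.exp_conj (formJ k) vᵀ hu
  rw [hJ] at h
  exact h.symm

theorem det_exp_so (k : ℕ) {v : Mat k} (hv : v ∈ so k) : (NormedSpace.exp v).det = 1 := by
  have hw : (2⁻¹ : ℝ) • v ∈ so k := (so k).smul_mem _ hv
  have h2 : v = (2⁻¹ : ℝ) • v + (2⁻¹ : ℝ) • v := by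
    rw [← add_smul]; norm_num
  have h1 : (NormedSpace.exp ((2⁻¹ : ℝ) • v)).det * (NormedSpace.exp ((2⁻¹ : ℝ) • v)).det = 1 := by
    have hJ : (formJ k).det * (formJ k).det = 1 := by
      rw [← det_mul, formJ_mul_formJ, det_one]
    have h3 := congrArg Matrix.det (formJ_mul_exp k hw)
    rw [det_mul, det_mul, det_transpose] at h3
    have h4 : (NormedSpace.exp (-((2⁻¹ : ℝ) • v))).det * (NormedSpace.exp ((2⁻¹ : ℝ) • v)).det
        = 1 := by
      rw [← det_mul, ← Matrix.exp_add_of_commute _ _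
        (Commute.neg_left (Commute.refl ((2⁻¹ : ℝ) • v)))]
      simp
    rw [← h3] at h4
    linear_combination h4 - (NormedSpace.exp ((2⁻¹ : ℝ) • v)).det ^ 2 * hJ
  rw [h2, Matrix.exp_add_of_commute _ _ (Commute.refl _), det_mul, h1]

/-- The exponential map `exp : 𝔰𝔬(n, 1) → SO(n, 1)` (the matrix exponential). -/
def expG (k : ℕ) (v : so k) : SOn1 k :=
  ⟨⟨NormedSpace.exp (v : Mat k), det_exp_so k v.2⟩, by
    change formJ k * (NormedSpace.exp (v : Mat k))ᵀ * formJ k = (NormedSpace.exp (v : Mat k))⁻¹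
    rw [formJ_mul_exp k v.2, Matrix.exp_neg]⟩

/-! ### The `𝔰𝔩₂`-triple -/

/-- Embedding of `3 × 3` matrices as the lower right corner. -/
def corner (k : ℕ) (M : Matrix (Fin 3) (Fin 3) ℝ) : Mat k := Matrix.fromBlocks 0 0 0 M

/-- The corner of the nilpotent element `U`. -/
def U3 : Matrix (Fin 3) (Fin 3) ℝ := !![0, 1, 1; -1, 0, 0; 1, 0, 0]

/-- The corner of the element `Yₙ` generating the geodesic flow. -/
def Y3 : Matrix (Fin 3) (Fin 3) ℝ := !![0, 0, 0; 0, 0, 1; 0, 1, 0]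

/-- The corner of the opposite nilpotent element. -/
def Ut3 : Matrix (Fin 3) (Fin 3) ℝ := !![0, -1, 1; 1, 0, 0; 1, 0, 0]

theorem corner_mem_so (k : ℕ) {M : Matrix (Fin 3) (Fin 3) ℝ}
    (h : M.trace = 0) (h' : J3 * Mᵀ * J3 = -M) : corner k M ∈ so k := by
  refine ⟨by simpa [corner, Matrix.trace, Fintype.sum_sum_type] using h, ?_⟩
  simp [corner, formJ, Matrix.fromBlocks_transpose, Matrix.fromBlocks_multiply, h',
    Matrix.fromBlocks_neg]

/-- The nilpotent element `U ∈ 𝔰𝔬(n, 1)`. -/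
def Uel (k : ℕ) : so k := ⟨corner k U3, corner_mem_so k (by simp [U3, Matrix.trace, Fin.sum_univ_three])
  (by ext i j; fin_cases i <;> fin_cases j <;> simp [J3, U3, Matrix.mul_apply, Fin.sum_univ_three])⟩

/-- The element `Yₙ ∈ 𝔰𝔬(n, 1)`. -/
def Yel (k : ℕ) : so k := ⟨corner k Y3, corner_mem_so k (by simp [Y3, Matrix.trace, Fin.sum_univ_three])
  (by ext i j; fin_cases i <;> fin_cases j <;> simp [J3, Y3, Matrix.mul_apply, Fin.sum_univ_three])⟩

/-- The element `Ũ ∈ 𝔰𝔬(n, 1)`. -/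
def Utel (k : ℕ) : so k := ⟨corner k Ut3, corner_mem_so k (by simp [Ut3, Matrix.trace, Fin.sum_univ_three])
  (by ext i j; fin_cases i <;> fin_cases j <;> simp [J3, Ut3, Matrix.mul_apply, Fin.sum_univ_three])⟩

/-- The unipotent one-parameter group `u^t = exp (t U)`. -/
def uflow (k : ℕ) (t : ℝ) : SOn1 k := expG k (t • Uel k)

/-- The image of a `2 × 2` matrix under the isogeny `SL(2, ℝ) → SO(2, 1)`, as a `3 × 3` matrix. -/
def iota3 (M : Matrix (Fin 2) (Fin 2) ℝ) : Matrix (Fin 3) (Fin 3) ℝ :=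
  let a := M 0 0; let b := M 0 1; let c := M 1 0; let d := M 1 1
  !![a * d + b * c, a * c - b * d, a * c + b * d;
     a * b - c * d, (a ^ 2 - b ^ 2 - c ^ 2 + d ^ 2) / 2, (a ^ 2 + b ^ 2 - c ^ 2 - d ^ 2) / 2;
     a * b + c * d, (a ^ 2 - b ^ 2 + c ^ 2 - d ^ 2) / 2, (a ^ 2 + b ^ 2 + c ^ 2 + d ^ 2) / 2]

theorem iota3_mul (M N : Matrix (Fin 2) (Fin 2) ℝ) : iota3 (M * N) = iota3 M * iota3 N := by
  ext i j
  fin_cases i <;> fin_cases j <;>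
    simp [iota3, Matrix.mul_apply, Fin.sum_univ_three, Fin.sum_univ_two] <;> ring

theorem iota3_one : iota3 1 = 1 := by
  ext i j
  fin_cases i <;> fin_cases j <;> simp [iota3]

theorem det_iota3 (M : Matrix (Fin 2) (Fin 2) ℝ) : (iota3 M).det = M.det ^ 3 := by
  simp [iota3, Matrix.det_fin_three, Matrix.det_fin_two]; ring

theorem J3_iota3 (M : Matrix (Fin 2) (Fin 2) ℝ) :
    J3 * (iota3 M)ᵀ * J3 = iota3 (adjugate M) := by
  ext i j
  fin_cases i <;> fin_cases j <;>
    simp [iota3, J3, Matrix.mul_apply, Fin.sum_univ_three, Matrix.adjugate_fin_two] <;> ring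

/-- The isogeny `ι : SL(2, ℝ) → SO(2, 1) ⊆ SO(n, 1)` whose derivative sends the elementary matrix
`E₂₁` to `U`, `E₁₂` to `Ũ` and `diag (1/2, -1/2)` to `Yₙ`; its image is the connected group
generated by the one-parameter groups of `U`, `Yₙ`, `Ũ`. -/
def iota (k : ℕ) : Matrix.SpecialLinearGroup (Fin 2) ℝ →* SOn1 k where
  toFun M := ⟨⟨Matrix.fromBlocks 1 0 0 (iota3 M), by simp [det_iota3, M.2]⟩, by
    change formJ k * (Matrix.fromBlocks 1 0 0 (iota3 M) : Mat k)ᵀ * formJ k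
      = (Matrix.fromBlocks 1 0 0 (iota3 M) : Mat k)⁻¹
    have h : iota3 (adjugate (M : Matrix (Fin 2) (Fin 2) ℝ)) * iota3 M = 1 := by
      rw [← iota3_mul, adjugate_mul, M.2, one_smul, iota3_one]
    refine (Matrix.inv_eq_left_inv ?_).symm
    simp [formJ, Matrix.fromBlocks_transpose, Matrix.fromBlocks_multiply, J3_iota3, h]⟩
  map_one' := by
    apply Subtype.ext; apply Subtype.ext
    change (Matrix.fromBlocks 1 0 0 (iota3 1) : Mat k) = 1
    rw [iota3_one, Matrix.fromBlocks_one]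
  map_mul' M N := by
    apply Subtype.ext; apply Subtype.ext
    change (Matrix.fromBlocks 1 0 0 (iota3 ((M : Matrix (Fin 2) (Fin 2) ℝ) * N)) : Mat k)
      = Matrix.fromBlocks 1 0 0 (iota3 M) * Matrix.fromBlocks 1 0 0 (iota3 N)
    simp [iota3_mul, Matrix.fromBlocks_multiply]

/-! ### The complement of `𝔰𝔩₂` -/

/-- The orthogonal complement `V^⊥` of `𝔰𝔩₂ = span {U, Yₙ, Ũ}` in `𝔰𝔬(n, 1)` for the invariant
form `(v, w) ↦ tr (v w)`, of which the Killing form is the multiple by `n - 1`. -/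
def Vperp (k : ℕ) : Submodule ℝ (so k) where
  carrier := {v | ∀ w ∈ Submodule.span ℝ {Uel k, Yel k, Utel k},
    ((v : Mat k) * (w : Mat k)).trace = 0}
  add_mem' := by
    intro a b ha hb w hw
    simp [add_mul, ha w hw, hb w hw]
  zero_mem' := by simp
  smul_mem' := by
    intro c a ha w hw
    simp [ha w hw]

/-- The rows describing the three weight vectors. -/
def wtRow : Fin 3 → Fin 3 → ℝ := ![![0, 1, -1], ![2, 0, 0], ![0, -1, -1]]

/-- For every `j` the weight vectors `v₀, v₁, v₂` (with respect to `Yₙ`, of weights `1, 0, -1`) of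
an irreducible subrepresentation of `V^⊥` of highest weight `ς = 2`, normalized by
`[U, vᵢ] = (i + 1) vᵢ₊₁`. -/
def weightVector (k : ℕ) (j : Fin k) (i : Fin 3) : Mat k :=
  Matrix.fromBlocks 0 (Matrix.vecMulVec (Pi.single j 1) (wtRow i))
    (-(J3 * (Matrix.vecMulVec (Pi.single j 1) (wtRow i))ᵀ)) 0

/-- The elements of `𝔰𝔬(n - 2)`: the sum of the trivial subrepresentations (`ς = 0`) of `V^⊥`. -/
def rotationPart (k : ℕ) (S : Matrix (Fin k) (Fin k) ℝ) : Mat k := Matrix.fromBlocks S 0 0 0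

/-! ### The metric -/

/-- `dG` is a right-invariant metric on `SO(n, 1)` inducing its topology. -/
structure IsRightInvariantMetric (k : ℕ) (dG : SOn1 k → SOn1 k → ℝ) : Prop where
  eq_zero_iff : ∀ g h, dG g h = 0 ↔ g = h
  symm : ∀ g h, dG g h = dG h g
  triangle : ∀ g h l, dG g l ≤ dG g h + dG h l
  right_invariant : ∀ g h l, dG (g * l) (h * l) = dG g h
  hasBasis_nhds : ∀ g, (𝓝 g).HasBasis (fun r : ℝ => 0 < r) (fun r => {h | dG h g < r})

/-- The quotient metric on `X = SO(n, 1) / Γ`: the infimum of the distances of representatives. -/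
def dX (k : ℕ) (dG : SOn1 k → SOn1 k → ℝ) (Γ : Subgroup (SOn1 k)) (x y : SOn1 k ⧸ Γ) : ℝ :=
  ⨅ p : {p : SOn1 k × SOn1 k // (p.1 : SOn1 k ⧸ Γ) = x ∧ (p.2 : SOn1 k ⧸ Γ) = y},
    dG p.1.1 p.1.2

end

section Maximal

variable {X : Type*}

theorem mul_birkhoffSum_indicator_le (T : X → X) (B : Set X) {ω : ℝ} (hω : 0 ≤ ω) (n K : ℕ) (x : X) :
    ω * birkhoffSum T ({x | ∃ N ≤ n, ω * N < birkhoffSum T (B.indicator fun _ => (1 : ℝ)) N x}.indicator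
      fun _ => (1 : ℝ)) K x ≤ birkhoffSum T (B.indicator fun _ => (1 : ℝ)) (K + n) x := by
  set f : X → ℝ := B.indicator fun _ => (1 : ℝ) with hf
  set E : Set X := {x | ∃ N ≤ n, ω * N < birkhoffSum T f N x} with hE
  set e : X → ℝ := E.indicator fun _ => (1 : ℝ) with he
  have f0 : ∀ x, 0 ≤ f x := fun x => indicator_nonneg (fun _ _ => zero_le_one) x
  have e1 : ∀ x, e x ≤ 1 := fun x => indicator_le' (fun _ _ => le_rfl) (fun _ _ => zero_le_one) x
  have S0 : ∀ N x, 0 ≤ birkhoffSum T f N x := fun N x => Finset.sum_nonneg fun i _ => f0 _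
  have Smono : ∀ N N' x, N ≤ N' → birkhoffSum T f N x ≤ birkhoffSum T f N' x := by
    intro N N' x h
    obtain ⟨d, rfl⟩ := Nat.exists_eq_add_of_le h
    rw [birkhoffSum_add]
    linarith [S0 d (T^[N] x)]
  have Se : ∀ N x, birkhoffSum T e N x ≤ N := by
    intro N x
    calc birkhoffSum T e N x ≤ ∑ i ∈ Finset.range N, (1 : ℝ) := Finset.sum_le_sum fun i _ => e1 _
      _ = N := by simp
  induction K using Nat.strong_induction_on generalizing x with
  | _ K ih =>
    rcases Nat.eq_zero_or_pos K with rfl | hK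
    · simpa using S0 _ x
    by_cases hx : x ∈ E
    · obtain ⟨N, hN, hlt⟩ := hx
      have hN0 : 0 < N := by
        rcases Nat.eq_zero_or_pos N with rfl | h
        · simp at hlt
        · exact h
      rcases le_or_gt K N with hKN | hKN
      · calc ω * birkhoffSum T e K x ≤ ω * N := by
              gcongr
              exact (Se K x).trans (by exact_mod_cast hKN)
          _ ≤ birkhoffSum T f N x := hlt.le
          _ ≤ _ := Smono _ _ _ (by omega)
      · obtain ⟨d, rfl⟩ := Nat.exists_eq_add_of_le hKN.le
        have h1 := ih d (by omega) (T^[N] x)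
        rw [add_assoc, birkhoffSum_add T e, birkhoffSum_add T f, mul_add]
        have h2 : ω * birkhoffSum T e N x ≤ ω * N := by gcongr; exact Se N x
        linarith
    · obtain ⟨d, rfl⟩ := Nat.exists_eq_add_of_le' hK
      have h1 := ih d (by omega) (T x)
      have h2 : e x = 0 := indicator_of_notMem hx _
      rw [show d + 1 + n = d + n + 1 by ring, birkhoffSum_succ', birkhoffSum_succ', h2]
      linarith [f0 x]

variable [MeasurableSpace X]

theorem integral_birkhoffSum_indicator {μ : Measure X} [IsFiniteMeasure μ] {T : X → X}
    (hT : MeasurePreserving T μ μ) {B : Set X} (hB : MeasurableSet B) (N : ℕ) :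
    Integrable (birkhoffSum T (B.indicator fun _ => (1 : ℝ)) N) μ ∧
      ∫ x, birkhoffSum T (B.indicator fun _ => (1 : ℝ)) N x ∂μ = N * μ.real B := by
  have h : ∀ i, (fun x => (B.indicator fun _ => (1 : ℝ)) (T^[i] x))
      = ((T^[i]) ⁻¹' B).indicator fun _ => (1 : ℝ) := fun i => rfl
  have hm : ∀ i, MeasurableSet ((T^[i]) ⁻¹' B) := fun i => (hT.iterate i).measurable hB
  have hint : ∀ i, Integrable (fun x => (B.indicator fun _ => (1 : ℝ)) (T^[i] x)) μ := by
    intro i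
    rw [h]
    exact (integrable_const _).indicator (hm i)
  refine ⟨integrable_finsetSum _ fun i _ => hint i, ?_⟩
  simp only [birkhoffSum]
  rw [integral_finsetSum _ fun i _ => hint i]
  have : ∀ i, ∫ x, (B.indicator fun _ => (1 : ℝ)) (T^[i] x) ∂μ = μ.real B := by
    intro i
    rw [h, integral_indicator_const _ (hm i), (hT.iterate i).measureReal_preimage hB.nullMeasurableSet]
    simp
  simp [this]

/-- The maximal inequality for indicator functions along a measure preserving map. -/
theorem measure_exists_birkhoffSum_gt_le {μ : Measure X} [IsFiniteMeasure μ] {T : X → X}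
    (hT : MeasurePreserving T μ μ) {B : Set X} (hB : MeasurableSet B) {ω : ℝ} (hω : 0 < ω) :
    μ {x | ∃ N : ℕ, ω * N < birkhoffSum T (B.indicator fun _ => (1 : ℝ)) N x}
      ≤ ENNReal.ofReal (μ.real B / ω) := by
  set f : X → ℝ := B.indicator fun _ => (1 : ℝ) with hf
  let E : ℕ → Set X := fun n => {x | ∃ N ≤ n, ω * N < birkhoffSum T f N x}
  have hEm : ∀ n, MeasurableSet (E n) := by
    intro n
    have : E n = ⋃ N ∈ Finset.range (n + 1), {x | ω * N < birkhoffSum T f N x} := by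
      ext x; simp [E]
    rw [this]
    refine Finset.measurableSet_biUnion _ fun N _ => measurableSet_lt measurable_const ?_
    exact Finset.measurable_sum _ fun i _ =>
      (measurable_const.indicator hB).comp (hT.iterate i).measurable
  have hU : {x | ∃ N : ℕ, ω * N < birkhoffSum T f N x} = ⋃ n, E n := by
    ext x
    simp only [mem_ofPred_eq, mem_iUnion, E]
    exact ⟨fun ⟨N, h⟩ => ⟨N, N, le_rfl, h⟩, fun ⟨n, N, _, h⟩ => ⟨N, h⟩⟩
  have hmono : Monotone E := fun a b hab x ⟨N, hN, h⟩ => ⟨N, hN.trans hab, h⟩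
  rw [hU, hmono.measure_iUnion]
  refine iSup_le fun n => ?_
  rw [← ofReal_measureReal]
  refine ENNReal.ofReal_le_ofReal ?_
  rw [le_div_iff₀ hω]
  have key : ∀ K : ℕ, ω * (K * μ.real (E n)) ≤ (K + n) * μ.real B := by
    intro K
    obtain ⟨h1, h2⟩ := integral_birkhoffSum_indicator hT (hEm n) K
    obtain ⟨h3, h4⟩ := integral_birkhoffSum_indicator hT hB (K + n)
    rw [← h2, ← integral_const_mul]
    have h5 := integral_mono (h1.const_mul ω) h3
      (fun x => mul_birkhoffSum_indicator_le T B hω.le n K x)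
    rw [h4] at h5
    push_cast at h5
    exact h5
  by_contra! hlt
  obtain ⟨K, hK⟩ := exists_nat_gt (n * μ.real B / (μ.real (E n) * ω - μ.real B))
  rw [div_lt_iff₀ (by linarith)] at hK
  linarith [key K]

end Maximal

section Scales

/-- `p` and `q` form with `s` a triple in `D` with pairwise distances in `[L, E]`. -/
def IsSpreadTriple (D : Set ℝ) (L E s p q : ℝ) : Prop :=
  s ∈ D ∧ p ∈ D ∧ q ∈ D ∧ L ≤ |p - s| ∧ L ≤ |q - s| ∧ L ≤ |p - q| ∧ |p - s| ≤ E ∧ |q - s| ≤ E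

theorem exists_isSpreadTriple {D : Set ℝ} {L E s : ℝ} (hL : 0 ≤ L)
    (hD : ENNReal.ofReal (4 * L) < volume D) (hE : ∀ p ∈ D, ∀ q ∈ D, |p - q| ≤ E) (hs : s ∈ D) :
    ∃ p q, IsSpreadTriple D L E s p q := by
  have hball : ∀ x : ℝ, volume (Metric.ball x L) = ENNReal.ofReal (2 * L) := fun x => Real.volume_ball x L
  obtain ⟨p, hp, hps⟩ : ∃ p ∈ D, p ∉ Metric.ball s L := by
    by_contra! h
    have := (measure_mono (μ := volume) h).trans_eq (hball s)
    exact absurd (hD.trans_le this) (not_lt.2 (ENNReal.ofReal_le_ofReal (by linarith)))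
  obtain ⟨q, hq, hqs⟩ : ∃ q ∈ D, q ∉ Metric.ball s L ∪ Metric.ball p L := by
    by_contra! h
    have := (measure_mono (μ := volume) h).trans (measure_union_le _ _)
    rw [hball, hball, ← ENNReal.ofReal_add (by linarith) (by linarith)] at this
    exact absurd (hD.trans_le this) (not_lt.2 (ENNReal.ofReal_le_ofReal (by linarith)))
  simp only [mem_union, Metric.mem_ball, Real.dist_eq, not_or, not_lt] at hps hqs
  exact ⟨p, q, hs, hp, hq, hps, hqs.1, by rw [abs_sub_comm]; exact hqs.2, hE _ hp _ hs, hE _ hq _ hs⟩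

theorem IsSpreadTriple.mono {D D' : Set ℝ} {L E s p q : ℝ} (h : IsSpreadTriple D L E s p q)
    (hD : D ⊆ D') : IsSpreadTriple D' L E s p q :=
  ⟨hD h.1, hD h.2.1, hD h.2.2.1, h.2.2.2⟩

/-- The points of `D` that belong to a spread triple of a single class lose at most the mass of the
sparse pieces of a subdivision. -/
theorem volume_le_add_of_subdivision {D D' : Set ℝ} {l ℓ L : ℝ} (hl : ℓ ≤ l) (hℓ : 0 < ℓ)
    (hL : 0 ≤ L) (hDl : D ⊆ Icc 0 l)
    (h : ∀ a, ENNReal.ofReal (4 * L) < volume (D ∩ Icc a (a + ℓ)) → D ∩ Icc a (a + ℓ) ⊆ D') :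
    volume D ≤ volume D' + ENNReal.ofReal (8 * L / ℓ * l) := by
  set N := ⌈l / ℓ⌉₊ with hN
  have hl0 : 0 < l := hℓ.trans_le hl
  have hN1 : (N : ℝ) ≤ 2 * (l / ℓ) := by
    have h1 : 1 ≤ l / ℓ := by rwa [le_div_iff₀ hℓ, one_mul]
    have := Nat.ceil_lt_add_one (a := l / ℓ) (by positivity)
    linarith
  have hcov : ∀ x ∈ D, ∃ i < N, x ∈ Icc (i * ℓ) (i * ℓ + ℓ) := by
    intro x hx
    obtain ⟨h0, h1⟩ := hDl hx
    rcases eq_or_lt_of_le h1 with rfl | h1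
    · refine ⟨N - 1, ?_, ?_⟩
      · have : 0 < N := Nat.ceil_pos.2 (by positivity)
        omega
      · have : 0 < N := Nat.ceil_pos.2 (by positivity)
        have h2 : ((N - 1 : ℕ) : ℝ) = N - 1 := by push_cast [Nat.cast_sub this]; ring
        have h3 := Nat.ceil_lt_add_one (a := x / ℓ) (by positivity)
        have h4 := Nat.le_ceil (x / ℓ)
        rw [div_le_iff₀ hℓ] at h4
        rw [← hN] at h3 h4
        have h5 : (N : ℝ) - 1 < x / ℓ := by linarith
        rw [lt_div_iff₀ hℓ] at h5
        rw [h2]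
        constructor <;> nlinarith
    · refine ⟨⌊x / ℓ⌋₊, ?_, ?_⟩
      · rw [Nat.floor_lt (by positivity)]
        exact (div_lt_div_of_pos_right h1 hℓ).trans_le (Nat.le_ceil _)
      · have h3 := Nat.floor_le (a := x / ℓ) (by positivity)
        have h4 := Nat.lt_floor_add_one (x / ℓ)
        rw [le_div_iff₀ hℓ] at h3
        rw [div_lt_iff₀ hℓ] at h4
        constructor <;> nlinarith
  have hsub : D ⊆ D' ∪ ⋃ i ∈ (Finset.range N).filter fun i : ℕ =>
    volume (D ∩ Icc (i * ℓ) (i * ℓ + ℓ)) ≤ ENNReal.ofReal (4 * L), D ∩ Icc (i * ℓ) (i * ℓ + ℓ) := by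
    intro x hx
    obtain ⟨i, hi, hxi⟩ := hcov x hx
    by_cases hb : volume (D ∩ Icc (i * ℓ) (i * ℓ + ℓ)) ≤ ENNReal.ofReal (4 * L)
    · right
      simp only [mem_iUnion]
      exact ⟨i, Finset.mem_filter.2 ⟨Finset.mem_range.2 hi, hb⟩, hx, hxi⟩
    · left
      exact h _ (not_le.1 hb) ⟨hx, hxi⟩
  refine (measure_mono hsub).trans ((measure_union_le _ _).trans ?_)
  gcongr
  refine (measure_biUnion_finset_le _ _).trans ?_
  refine (Finset.sum_le_sum (g := fun _ => ENNReal.ofReal (4 * L))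
    fun i hi => (Finset.mem_filter.1 hi).2).trans ?_
  refine (Finset.sum_le_sum_of_subset (Finset.filter_subset _ _)).trans ?_
  rw [Finset.sum_const, Finset.card_range, nsmul_eq_mul, ← ENNReal.ofReal_natCast,
    ← ENNReal.ofReal_mul (by positivity)]
  refine ENNReal.ofReal_le_ofReal ?_
  calc (N : ℝ) * (4 * L) ≤ 2 * (l / ℓ) * (4 * L) := by gcongr
    _ = _ := by ring

/-- If points at distance at most `M` are of the same class, and points of spread triples of size
`ℓ` of a class are of the same class even when their distance is `ℓ ^ (1 + κ)`, then a
set of large density has a spread triple of macroscopic size of a single class. -/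
theorem exists_spread_triple_of_density {W : Type*} (c : ℝ → W) {κ M : ℝ}
    (hκ : 0 < κ) (hM : 1 < M)
    (hsum : ∀ j : ℕ, (M ^ ((1 + κ) ^ j)) ^ (-κ) ≤ (1 / 64) * (1 / 2) ^ j)
    {l : ℝ} (hl : 0 < l) {A : Set ℝ} (hAl : A ⊆ Icc 0 l)
    (h0 : ∀ s ∈ A, ∀ s' ∈ A, |s - s'| ≤ M → c s = c s')
    (h1 : ∀ ℓ, M ≤ ℓ → ∀ s s' p q p' q',
      IsSpreadTriple {r ∈ A | c r = c s} (ℓ ^ (1 - κ)) ℓ s p q →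
      IsSpreadTriple {r ∈ A | c r = c s'} (ℓ ^ (1 - κ)) ℓ s' p' q' →
      |s - s'| ≤ ℓ ^ (1 + κ) → c s = c s')
    (hA : ENNReal.ofReal (3 / 4 * l) < volume A) :
    ∃ s p q, IsSpreadTriple {r ∈ A | c r = c s} (l / 8) l s p q := by
  set ℓ : ℕ → ℝ := fun j => M ^ ((1 + κ) ^ j) with hℓ
  have hM0 : 0 < M := by linarith
  have hℓM : ∀ j, M ≤ ℓ j := by
    intro j
    have h2 : (1 : ℝ) ≤ (1 + κ) ^ j := one_le_pow₀ (by linarith)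
    calc M = M ^ (1 : ℝ) := (Real.rpow_one M).symm
      _ ≤ _ := Real.rpow_le_rpow_of_exponent_le hM.le h2
  have hℓ0 : ∀ j, 0 < ℓ j := fun j => hM0.trans_le (hℓM j)
  have hℓs : ∀ j, ℓ (j + 1) = ℓ j ^ (1 + κ) := by
    intro j
    simp only [hℓ]
    rw [← Real.rpow_mul hM0.le, pow_succ]
  obtain ⟨J, hJ, hJmin⟩ : ∃ J, l ≤ ℓ J ∧ ∀ j < J, ℓ j < l := by
    have hex : ∃ J, l ≤ ℓ J := by
      have hb : ∀ j : ℕ, 1 + j * κ ≤ (1 + κ) ^ j := fun j =>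
        one_add_mul_le_pow (by linarith) j
      obtain ⟨j, hj⟩ := exists_nat_gt (l / (κ * Real.log M))
      have hlog := Real.log_pos hM
      rw [div_lt_iff₀ (by positivity)] at hj
      refine ⟨j, ?_⟩
      have : Real.log l ≤ (1 + κ) ^ j * Real.log M := by
        have := Real.log_le_self hl.le
        nlinarith [hb j]
      rw [← Real.log_le_log_iff hl (hℓ0 j), Real.log_rpow hM0]
      exact this
    classical
    exact ⟨Nat.find hex, Nat.find_spec hex, fun j hj => not_le.1 (Nat.find_min hex hj)⟩
  have main : ∀ j ≤ J, ∃ D ⊆ A, (∀ s ∈ D, ∀ s' ∈ D, |s - s'| ≤ ℓ j → c s = c s') ∧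
      ENNReal.ofReal ((1 / 2 + 1 / 4 * (1 / 2) ^ j) * l) < volume D := by
    intro j
    induction j with
    | zero =>
      intro _
      refine ⟨A, subset_rfl, ?_, ?_⟩
      · simpa [hℓ] using h0
      · convert hA using 3; norm_num
    | succ j ih =>
      intro hj
      obtain ⟨D, hDA, hDc, hDv⟩ := ih (by omega)
      set L := ℓ j ^ (1 - κ) with hL
      have hL0 : 0 < L := Real.rpow_pos_of_pos (hℓ0 j) _
      let D' : Set ℝ := {s ∈ D | ∃ p q, IsSpreadTriple {r ∈ A | c r = c s} L (ℓ j) s p q}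
      refine ⟨D', fun s hs => hDA hs.1, ?_, ?_⟩
      · rintro s ⟨_, p, q, hpq⟩ s' ⟨_, p', q', hpq'⟩ hss
        exact h1 _ (hℓM j) s s' p q p' q' hpq hpq' (by rwa [← hℓs])
      · have hvol := volume_le_add_of_subdivision (D := D) (D' := D') (L := L)
          (hJmin j (by omega)).le (hℓ0 j) hL0.le (hDA.trans hAl) (by
            intro a ha s hs
            have hE : ∀ p ∈ D ∩ Icc a (a + ℓ j), ∀ q ∈ D ∩ Icc a (a + ℓ j), |p - q| ≤ ℓ j := by
              rintro p ⟨_, hp⟩ q ⟨_, hq⟩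
              rw [abs_le]; constructor <;> linarith [hp.1, hp.2, hq.1, hq.2]
            obtain ⟨p, q, hpq⟩ := exists_isSpreadTriple hL0.le ha hE hs
            exact ⟨hs.1, p, q, hpq.mono fun r hr => ⟨hDA hr.1, hDc _ hr.1 _ hs.1 (hE _ hr _ hs)⟩⟩)
        have hq : 8 * L / ℓ j ≤ 1 / 8 * (1 / 2) ^ j := by
          have : L / ℓ j = ℓ j ^ (-κ) := by
            rw [hL, Real.rpow_sub (hℓ0 j), Real.rpow_one, Real.rpow_neg (hℓ0 j).le]
            field_simp [(hℓ0 j).ne']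
          rw [mul_div_assoc, this]
          linarith [hsum j]
        by_contra! hcon
        refine absurd (hDv.trans_le (hvol.trans (add_le_add_left hcon _))) (not_lt.2 ?_)
        rw [← ENNReal.ofReal_add (by positivity) (by positivity)]
        refine ENNReal.ofReal_le_ofReal ?_
        rw [← add_mul]
        refine mul_le_mul_of_nonneg_right ?_ hl.le
        rw [pow_succ]
        linarith
  obtain ⟨D, hDA, hDc, hDv⟩ := main J le_rfl
  have hE : ∀ p ∈ D, ∀ q ∈ D, |p - q| ≤ l := by
    intro p hp q hq
    have hp' := hAl (hDA hp)
    have hq' := hAl (hDA hq)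
    rw [abs_le]; constructor <;> linarith [hp'.1, hp'.2, hq'.1, hq'.2]
  have hDv' : ENNReal.ofReal (4 * (l / 8)) < volume D := by
    refine lt_of_le_of_lt (ENNReal.ofReal_le_ofReal ?_) hDv
    have : (0 : ℝ) ≤ (1 / 2) ^ J := by positivity
    nlinarith
  obtain ⟨s, hs⟩ : D.Nonempty := by
    by_contra h
    rw [not_nonempty_iff_eq_empty] at h
    simp [h] at hDv'
  obtain ⟨p, q, hpq⟩ := exists_isSpreadTriple (by positivity) hDv' hE hs
  exact ⟨s, p, q, hpq.mono fun r hr => ⟨hDA hr, hDc _ hr _ hs ((hE _ hr _ hs).trans hJ)⟩⟩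

end Scales

section Group

/-- The inclusion of `SO(n, 1)` into the matrices. -/
def toMat (k : ℕ) : SOn1 k →* Mat k where
  toFun g := g.1.1
  map_one' := rfl
  map_mul' _ _ := rfl

theorem toMat_injective (k : ℕ) : Function.Injective (toMat k) := fun _ _ h =>
  Subtype.ext (Subtype.ext h)

theorem continuous_toMat (k : ℕ) : Continuous (toMat k) :=
  continuous_subtype_val.comp continuous_subtype_val

theorem toMat_inv (k : ℕ) (g : SOn1 k) : toMat k g⁻¹ = formJ k * (toMat k g)ᵀ * formJ k := by
  have h : formJ k * (toMat k g)ᵀ * formJ k = (toMat k g)⁻¹ := g.2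
  rw [h]
  refine (Matrix.inv_eq_left_inv ?_).symm
  rw [← map_mul, inv_mul_cancel, map_one]

theorem isClosedEmbedding_toMat (k : ℕ) : IsClosedEmbedding (toMat k) := by
  refine ⟨⟨?_, toMat_injective k⟩, ?_⟩
  · exact IsInducing.subtypeVal.comp IsInducing.subtypeVal
  · have : range (toMat k) = {M : Mat k | M.det = 1} ∩ {M | formJ k * Mᵀ * formJ k * M = 1} := by
      ext M
      constructor
      · rintro ⟨g, rfl⟩
        refine ⟨g.1.2, ?_⟩
        change formJ k * (toMat k g)ᵀ * formJ k * (toMat k g) = 1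
        rw [← toMat_inv, ← map_mul, inv_mul_cancel, map_one]
      · rintro ⟨h1, h2⟩
        exact ⟨⟨⟨M, h1⟩, (Matrix.inv_eq_left_inv h2).symm⟩, rfl⟩
    rw [this]
    refine IsClosed.inter (isClosed_eq (by fun_prop) continuous_const)
      (isClosed_eq (by fun_prop) continuous_const)

instance (k : ℕ) : SigmaCompactSpace (SOn1 k) :=
  haveI : SigmaCompactSpace (Mat k) :=
    inferInstanceAs (SigmaCompactSpace (Fin k ⊕ Fin 3 → Fin k ⊕ Fin 3 → ℝ))
  (isClosedEmbedding_toMat k).sigmaCompactSpace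

theorem toMat_iota (k : ℕ) (M : Matrix.SpecialLinearGroup (Fin 2) ℝ) :
    toMat k (iota k M) = Matrix.fromBlocks 1 0 0 (iota3 M) := rfl

theorem toMat_expG (k : ℕ) (v : so k) : toMat k (expG k v) = NormedSpace.exp (v : Mat k) := rfl

theorem exists_smul_eq_of_dX_lt {k : ℕ} {dG : SOn1 k → SOn1 k → ℝ}
    (hdG : IsRightInvariantMetric k dG) {Γ : Subgroup (SOn1 k)} {x y : SOn1 k ⧸ Γ} {ε : ℝ}
    (h : dX k dG Γ x y < ε) : ∃ g : SOn1 k, x = g • y ∧ dG g 1 < ε := by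
  obtain ⟨x', rfl⟩ := QuotientGroup.mk_surjective x
  obtain ⟨y', rfl⟩ := QuotientGroup.mk_surjective y
  have : Nonempty {p : SOn1 k × SOn1 k // (p.1 : SOn1 k ⧸ Γ) = (x' : SOn1 k ⧸ Γ) ∧
    (p.2 : SOn1 k ⧸ Γ) = (y' : SOn1 k ⧸ Γ)} := ⟨⟨(x', y'), rfl, rfl⟩⟩
  obtain ⟨⟨⟨a, b⟩, ha, hb⟩, hab⟩ := exists_lt_of_ciInf_lt h
  refine ⟨a * b⁻¹, ?_, ?_⟩
  · rw [← ha, ← hb, MulAction.Quotient.smul_mk, smul_eq_mul, inv_mul_cancel_right]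
  · have := hdG.right_invariant a b b⁻¹
    rw [mul_inv_cancel] at this
    rwa [this]

theorem IsRightInvariantMetric.pow_le {k : ℕ} {dG : SOn1 k → SOn1 k → ℝ}
    (hdG : IsRightInvariantMetric k dG) (g : SOn1 k) (n : ℕ) : dG (g ^ n) 1 ≤ n * dG g 1 := by
  induction n with
  | zero => simp [(hdG.eq_zero_iff 1 1).2 rfl]
  | succ n ih =>
    have h1 := hdG.triangle (g ^ (n + 1)) g 1
    have h2 := hdG.right_invariant (g ^ n) 1 g
    rw [one_mul, ← pow_succ] at h2
    push_cast
    linarith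

open scoped Matrix.Norms.Operator

theorem norm_one_add_pow_sub_le {R : Type*} [NormedRing R] (x : R) (n : ℕ) (h : n * ‖x‖ ≤ 1) :
    ‖(1 + x) ^ n - 1 - n • x‖ ≤ (n * ‖x‖) ^ 2 := by
  induction n with
  | zero => simp
  | succ n ih =>
    push_cast at h ⊢
    have h0 := norm_nonneg x
    have h1 : (n : ℝ) * ‖x‖ ≤ 1 := by linarith
    have e : (1 + x) ^ (n + 1) - 1 - (n + 1) • x
        = ((1 + x) ^ n - 1 - n • x) + x * ((1 + x) ^ n - 1 - n • x) + n • (x * x) := by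
      rw [pow_succ', add_smul, mul_sub, mul_sub, mul_smul_comm, add_mul]
      simp only [one_smul, one_mul, mul_one]
      abel
    rw [e]
    have h2 := ih h1
    have h3 : ‖x * ((1 + x) ^ n - 1 - n • x)‖ ≤ ‖x‖ * (n * ‖x‖) ^ 2 :=
      (norm_mul_le _ _).trans (by gcongr)
    have h4 : ‖n • (x * x)‖ ≤ n * ‖x‖ ^ 2 := by
      refine (norm_nsmul_le).trans ?_
      have := norm_mul_le x x
      rw [pow_two]
      gcongr
    have h5 := norm_add₃_le (a := (1 + x) ^ n - 1 - n • x)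
      (b := x * ((1 + x) ^ n - 1 - n • x)) (c := n • (x * x))
    have h6 : ‖x‖ * (n * ‖x‖) ^ 2 ≤ n * ‖x‖ ^ 2 := by
      have : 0 ≤ n * ‖x‖ ^ 2 := by positivity
      nlinarith
    nlinarith

/-- A right-invariant metric inducing the topology dominates the norm distance near `1`. -/
theorem IsRightInvariantMetric.exists_norm_le {k : ℕ} {dG : SOn1 k → SOn1 k → ℝ}
    (hdG : IsRightInvariantMetric k dG) :
    ∃ C > 0, ∃ r > 0, ∀ g, dG g 1 < r → ‖toMat k g - 1‖ ≤ C * dG g 1 := by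
  have hnhd : {g : SOn1 k | ‖toMat k g - 1‖ < 1 / 16} ∈ 𝓝 (1 : SOn1 k) := by
    have hc : Continuous fun g : SOn1 k => ‖toMat k g - 1‖ :=
      ((continuous_toMat k).sub continuous_const).norm
    refine hc.continuousAt.preimage_mem_nhds (Iio_mem_nhds ?_)
    simp
  obtain ⟨r, hr, hsub⟩ := (hdG.hasBasis_nhds 1).mem_iff.1 hnhd
  refine ⟨1 / (2 * r), by positivity, r, hr, fun g hg => ?_⟩
  set x := toMat k g - 1 with hx
  have hlt : ‖x‖ < 1 / 16 := hsub hg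
  rcases (norm_nonneg x).eq_or_lt with h0 | h0
  · rw [← h0]
    have h1 := hdG.triangle g 1 g
    rw [(hdG.eq_zero_iff g g).2 rfl, hdG.symm 1 g] at h1
    have : 0 ≤ dG g 1 := by linarith
    positivity
  set n := ⌊1 / (2 * ‖x‖)⌋₊ with hn
  have hn1 : (n : ℝ) * ‖x‖ ≤ 1 / 2 := by
    have := Nat.floor_le (a := 1 / (2 * ‖x‖)) (by positivity)
    rw [← hn, le_div_iff₀ (by positivity)] at this
    linarith
  have hn2 : 1 / 4 ≤ (n : ℝ) * ‖x‖ := by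
    have := Nat.lt_floor_add_one (1 / (2 * ‖x‖))
    rw [← hn, div_lt_iff₀ (by positivity)] at this
    linarith
  have hp := norm_one_add_pow_sub_le x n (by linarith)
  have hgn : toMat k (g ^ n) = (1 + x) ^ n := by rw [map_pow, hx]; congr 1; abel
  have hr' : r ≤ dG (g ^ n) 1 := by
    by_contra! hlt'
    have h1 : ‖toMat k (g ^ n) - 1‖ < 1 / 16 := hsub hlt'
    rw [hgn] at h1
    have h2 : ‖n • x‖ ≤ ‖(1 + x) ^ n - 1‖ + ‖(1 + x) ^ n - 1 - n • x‖ := by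
      have := norm_sub_le ((1 + x) ^ n - 1) ((1 + x) ^ n - 1 - n • x)
      rwa [sub_sub_cancel] at this
    have h3 : ‖n • x‖ = n * ‖x‖ := by
      rw [← Nat.cast_smul_eq_nsmul ℝ, norm_smul]; simp
    nlinarith
  have h4 := hdG.pow_le g n
  have h5 : r * ‖x‖ ≤ 1 / 2 * dG g 1 := by
    have : 0 ≤ dG g 1 := by
      by_contra! hneg
      have : (n : ℝ) * dG g 1 ≤ 0 := mul_nonpos_of_nonneg_of_nonpos (by positivity) hneg.le
      linarith
    calc r * ‖x‖ ≤ (n * dG g 1) * ‖x‖ := by gcongr; linarith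
      _ = (n * ‖x‖) * dG g 1 := by ring
      _ ≤ _ := by gcongr
  rw [div_mul_eq_mul_div, le_div_iff₀ (by positivity)]
  linarith

end Group

section Local

/-- The matrix with blocks `S`, `B` of an element of `V^⊥`. -/
def vmat {k : ℕ} (S : Matrix (Fin k) (Fin k) ℝ) (B : Matrix (Fin k) (Fin 3) ℝ) : Mat k :=
  Matrix.fromBlocks S B (-(J3 * Bᵀ)) 0

theorem vmat_mem_so {k : ℕ} {S : Matrix (Fin k) (Fin k) ℝ} (hS : Sᵀ = -S)
    (B : Matrix (Fin k) (Fin 3) ℝ) : vmat S B ∈ so k := by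
  refine ⟨?_, ?_⟩
  · have h : S.trace = 0 := by
      have := congrArg Matrix.trace hS
      rw [trace_transpose, trace_neg] at this
      linarith
    simpa [vmat, Matrix.trace, Fintype.sum_sum_type] using h
  · simp [vmat, formJ, Matrix.fromBlocks_transpose, Matrix.fromBlocks_multiply, hS, J3_transpose,
      Matrix.fromBlocks_neg, Matrix.mul_assoc, J3_mul_J3]

theorem vmat_mem_Vperp {k : ℕ} {S : Matrix (Fin k) (Fin k) ℝ} (hS : Sᵀ = -S)
    (B : Matrix (Fin k) (Fin 3) ℝ) : (⟨vmat S B, vmat_mem_so hS B⟩ : so k) ∈ Vperp k := by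
  intro w hw
  obtain ⟨M, hM⟩ : ∃ M, (w : Mat k) = corner k M := by
    induction hw using Submodule.span_induction with
    | mem x hx =>
      rcases hx with rfl | rfl | rfl
      · exact ⟨_, rfl⟩
      · exact ⟨_, rfl⟩
      · exact ⟨_, rfl⟩
    | zero => exact ⟨0, by simp [corner]⟩
    | add x y _ _ hx hy =>
      obtain ⟨M, hM⟩ := hx
      obtain ⟨N, hN⟩ := hy
      exact ⟨M + N, by simp [hM, hN, corner, Matrix.fromBlocks_add]⟩
    | smul c x _ hx =>
      obtain ⟨M, hM⟩ := hx
      exact ⟨c • M, by simp [hM, corner, Matrix.fromBlocks_smul]⟩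
  rw [hM]
  simp [vmat, corner, Matrix.fromBlocks_multiply, Matrix.trace, Fintype.sum_sum_type]

/-- Lower triangular unipotent elements. -/
def lowSL (c : ℝ) : Matrix.SpecialLinearGroup (Fin 2) ℝ :=
  ⟨!![1, 0; c, 1], by simp [Matrix.det_fin_two]⟩

/-- Upper triangular unipotent elements. -/
def uppSL (b : ℝ) : Matrix.SpecialLinearGroup (Fin 2) ℝ :=
  ⟨!![1, b; 0, 1], by simp [Matrix.det_fin_two]⟩

/-- Diagonal elements, lying over `exp (τ Yₙ)`. -/
noncomputable def diagSL (τ : ℝ) : Matrix.SpecialLinearGroup (Fin 2) ℝ :=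
  ⟨!![Real.exp (τ / 2), 0; 0, Real.exp (-(τ / 2))], by
    rw [Matrix.det_fin_two]; simp [← Real.exp_add]⟩

theorem iota3_low (c : ℝ) :
    iota3 (lowSL c) = 1 + c • U3 + (c ^ 2 / 2) • (U3 * U3) := by
  ext i j
  fin_cases i <;> fin_cases j <;>
    simp [iota3, lowSL, U3] <;> ring

theorem iota3_upp (c : ℝ) :
    iota3 (uppSL c) = 1 + c • Ut3 + (c ^ 2 / 2) • (Ut3 * Ut3) := by
  ext i j
  fin_cases i <;> fin_cases j <;>
    simp [iota3, uppSL, Ut3] <;> ring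

theorem iota3_diag (c : ℝ) :
    iota3 (diagSL c) = 1 + Real.sinh c • Y3 + (Real.cosh c - 1) • (Y3 * Y3) := by
  have h1 : Real.exp (c / 2) ^ 2 = Real.exp c := by
    rw [← Real.exp_nat_mul]; congr 1; push_cast; ring
  have h2 : Real.exp (-(c / 2)) ^ 2 = Real.exp (-c) := by
    rw [← Real.exp_nat_mul]; congr 1; push_cast; ring
  have h3 : Real.exp (c / 2) * Real.exp (-(c / 2)) = 1 := by
    rw [← Real.exp_add]; simp
  ext i j
  fin_cases i <;> fin_cases j <;>
    simp [iota3, diagSL, Y3, Real.sinh_eq, Real.cosh_eq,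
      h1, h2, h3]

theorem exp_of_cube_eq_zero {n : Type*} [Fintype n] [DecidableEq n] {N : Matrix n n ℝ}
    (h : N ^ 3 = 0) : NormedSpace.exp N = 1 + N + (1 / 2 : ℝ) • N ^ 2 := by
  have h1 : ∀ i ∉ Finset.range 3, ((i.factorial : ℝ)⁻¹) • N ^ i = 0 := by
    intro i hi
    rw [Finset.mem_range, not_lt] at hi
    rw [pow_eq_zero_of_le hi h, smul_zero]
  rw [NormedSpace.exp_eq_tsum ℝ]
  change ∑' i, ((i.factorial : ℝ)⁻¹) • N ^ i = _
  rw [tsum_eq_sum h1]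
  simp [Finset.sum_range_succ, Nat.factorial]

theorem corner_pow (k : ℕ) (M : Matrix (Fin 3) (Fin 3) ℝ) (n : ℕ) :
    corner k M ^ (n + 1) = corner k (M ^ (n + 1)) := by
  induction n with
  | zero => simp
  | succ n ih => rw [pow_succ, ih, pow_succ M (n + 1)]; simp [corner, Matrix.fromBlocks_multiply]

theorem uflow_eq (k : ℕ) (t : ℝ) : uflow k t = iota k (lowSL t) := by
  apply toMat_injective
  change NormedSpace.exp (t • corner k U3) = Matrix.fromBlocks 1 0 0 (iota3 (lowSL t))
  have h3 : U3 ^ 3 = 0 := by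
    ext i j
    fin_cases i <;> fin_cases j <;>
      simp [U3, pow_succ, Matrix.mul_apply, Fin.sum_univ_three]
  have hN : (t • corner k U3) ^ 3 = 0 := by
    rw [smul_pow, corner_pow, h3]; simp [corner]
  rw [exp_of_cube_eq_zero hN, iota3_low, smul_pow, corner_pow, ← Matrix.fromBlocks_one]
  simp only [corner, Matrix.fromBlocks_smul, Matrix.fromBlocks_add, smul_zero, add_zero, smul_smul]
  rw [← pow_two]
  congr 3
  ring

/-- The anti-invariant part of a matrix under `X ↦ J Xᵀ J`. -/
noncomputable def skewPart (k : ℕ) : Mat k →ₗ[ℝ] Mat k where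
  toFun X := (1 / 2 : ℝ) • (X - formJ k * Xᵀ * formJ k)
  map_add' X Y := by simp only [transpose_add, mul_add, add_mul]; module
  map_smul' c X := by
    simp only [transpose_smul, mul_smul_comm, smul_mul_assoc, RingHom.id_apply]; module

/-- The invariant part of a matrix under `X ↦ J Xᵀ J`. -/
noncomputable def symmPart (k : ℕ) : Mat k →ₗ[ℝ] Mat k where
  toFun X := (1 / 2 : ℝ) • (X + formJ k * Xᵀ * formJ k)
  map_add' X Y := by simp only [transpose_add, mul_add, add_mul]; module
  map_smul' c X := by
    simp only [transpose_smul, mul_smul_comm, smul_mul_assoc, RingHom.id_apply]; module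

theorem formJ_transpose (k : ℕ) : (formJ k)ᵀ = formJ k := by
  simp [formJ, Matrix.fromBlocks_transpose, J3_transpose]

theorem formJ_conj_conj (k : ℕ) (X : Mat k) :
    formJ k * (formJ k * X * formJ k) * formJ k = X := by
  calc formJ k * (formJ k * X * formJ k) * formJ k
      = (formJ k * formJ k) * X * (formJ k * formJ k) := by simp only [mul_assoc]
    _ = X := by simp [formJ_mul_formJ]

theorem formJ_symmPart (k : ℕ) (X : Mat k) :
    formJ k * (symmPart k X)ᵀ * formJ k = symmPart k X := by
  simp only [symmPart, LinearMap.coe_mk, AddHom.coe_mk, transpose_smul, transpose_add,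
    transpose_mul, transpose_transpose, formJ_transpose, mul_smul_comm, smul_mul_assoc, mul_add,
    add_mul]
  rw [← mul_assoc (formJ k) X, formJ_conj_conj, add_comm]

theorem formJ_skewPart (k : ℕ) (X : Mat k) :
    formJ k * (skewPart k X)ᵀ * formJ k = -skewPart k X := by
  simp only [skewPart, LinearMap.coe_mk, AddHom.coe_mk, transpose_smul, transpose_sub,
    transpose_mul, transpose_transpose, formJ_transpose, mul_smul_comm, smul_mul_assoc, mul_sub,
    sub_mul]
  rw [← mul_assoc (formJ k) X, formJ_conj_conj]
  module

theorem skewPart_add_symmPart (k : ℕ) (X : Mat k) : skewPart k X + symmPart k X = X := by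
  simp only [skewPart, symmPart, LinearMap.coe_mk, AddHom.coe_mk]
  module

theorem skewPart_toBlocks₁₁ (k : ℕ) (X : Mat k) :
    (skewPart k X).toBlocks₁₁ᵀ = -(skewPart k X).toBlocks₁₁ := by
  have h := congrArg Matrix.toBlocks₁₁ (formJ_skewPart k X)
  rw [← Matrix.fromBlocks_toBlocks (skewPart k X)] at h
  simpa [formJ, Matrix.fromBlocks_transpose, Matrix.fromBlocks_multiply, Matrix.fromBlocks_neg]
    using h

/-- The decomposition of the anti-invariant part along `V^⊥` and the `𝔰𝔩₂`-triple. -/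
theorem skewPart_eq (k : ℕ) (X : Mat k) :
    skewPart k X = vmat (skewPart k X).toBlocks₁₁ (skewPart k X).toBlocks₁₂ + corner k
      (((skewPart k X (.inr 0) (.inr 1) + skewPart k X (.inr 0) (.inr 2)) / 2) • U3
        + (skewPart k X (.inr 1) (.inr 2)) • Y3
        + ((skewPart k X (.inr 0) (.inr 2) - skewPart k X (.inr 0) (.inr 1)) / 2) • Ut3) := by
  have h := formJ_skewPart k X
  generalize skewPart k X = Z at h ⊢
  obtain ⟨S, B, C, D, rfl⟩ : ∃ S B C D, Z = Matrix.fromBlocks S B C D :=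
    ⟨_, _, _, _, (Matrix.fromBlocks_toBlocks Z).symm⟩
  simp only [formJ, Matrix.fromBlocks_transpose, Matrix.fromBlocks_multiply,
    Matrix.fromBlocks_neg, Matrix.fromBlocks_inj] at h
  obtain ⟨h1, h2, h3, h4⟩ := h
  simp only [vmat, corner, Matrix.fromBlocks_add, Matrix.toBlocks_fromBlocks₁₁,
    Matrix.toBlocks_fromBlocks₁₂, add_zero, zero_add, Matrix.fromBlocks_apply₂₂]
  congr 1
  · simp at h3
    rw [h3, neg_neg]
  · simp at h4
    ext i j
    have e := fun i j => congrFun (congrFun h4 i) j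
    simp only [J3, Matrix.diagonal_mul, Matrix.mul_diagonal, Matrix.transpose_apply,
      Matrix.neg_apply] at e
    have e00 := e 0 0
    have e11 := e 1 1
    have e22 := e 2 2
    have e01 := e 0 1
    have e02 := e 0 2
    have e12 := e 1 2
    simp at e00 e11 e22 e01 e02 e12
    fin_cases i <;> fin_cases j <;> simp [U3, Y3, Ut3] <;> linarith

end Local

section LocalInverse

open scoped Matrix.Norms.Operator

theorem fromBlocks_quadratic (k : ℕ) (M : Matrix (Fin 3) (Fin 3) ℝ) (x y : ℝ) :
    (Matrix.fromBlocks 1 0 0 (1 + x • M + y • (M * M)) : Mat k)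
      = 1 + x • corner k M + y • (corner k M * corner k M) := by
  rw [← Matrix.fromBlocks_one]
  simp only [corner, Matrix.fromBlocks_smul, Matrix.fromBlocks_multiply, smul_zero, Matrix.mul_zero,
    Matrix.zero_mul, zero_add, Matrix.fromBlocks_add, add_zero]

theorem hasStrictDerivAt_quadratic {k : ℕ} (N : Mat k) {f g : ℝ → ℝ} (hf : HasStrictDerivAt f 1 0)
    (hg : HasStrictDerivAt g 0 0) :
    HasStrictDerivAt (fun x => 1 + f x • N + g x • (N * N)) N 0 := by
  exact (((hf.smul_const N).const_add 1).add (hg.smul_const (N * N))).congr_deriv (by simp)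

theorem hasStrictDerivAt_iota_low (k : ℕ) :
    HasStrictDerivAt (fun c => toMat k (iota k (lowSL c))) (corner k U3) 0 := by
  simp only [toMat_iota, iota3_low, fromBlocks_quadratic]
  refine hasStrictDerivAt_quadratic _ (hasStrictDerivAt_id 0) ?_
  simpa using ((hasStrictDerivAt_id (0 : ℝ)).pow 2).div_const 2

theorem hasStrictDerivAt_iota_upp (k : ℕ) :
    HasStrictDerivAt (fun c => toMat k (iota k (uppSL c))) (corner k Ut3) 0 := by
  simp only [toMat_iota, iota3_upp, fromBlocks_quadratic]
  refine hasStrictDerivAt_quadratic _ (hasStrictDerivAt_id 0) ?_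
  simpa using ((hasStrictDerivAt_id (0 : ℝ)).pow 2).div_const 2

theorem hasStrictDerivAt_iota_diag (k : ℕ) :
    HasStrictDerivAt (fun c => toMat k (iota k (diagSL c))) (corner k Y3) 0 := by
  simp only [toMat_iota, iota3_diag, fromBlocks_quadratic]
  refine hasStrictDerivAt_quadratic _ ?_ ?_
  · simpa using Real.hasStrictDerivAt_sinh 0
  · simpa [HasStrictDerivAt] using ((Real.hasStrictDerivAt_cosh 0).sub_const 1)

/-- The coefficients of the `𝔰𝔩₂`-part of a matrix with respect to `U`, `Yₙ`, `Ũ`. -/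
noncomputable def sl2Coeff (k : ℕ) : Fin 3 → Mat k →L[ℝ] ℝ :=
  ![LinearMap.toContinuousLinearMap
      { toFun := fun X => (skewPart k X (.inr 0) (.inr 1) + skewPart k X (.inr 0) (.inr 2)) / 2
        map_add' := fun X Y => by simp only [map_add, Matrix.add_apply]; ring
        map_smul' := fun c X => by
          simp only [map_smul, Matrix.smul_apply, smul_eq_mul, RingHom.id_apply]; ring },
    LinearMap.toContinuousLinearMap
      { toFun := fun X => skewPart k X (.inr 1) (.inr 2)
        map_add' := fun X Y => by simp only [map_add, Matrix.add_apply]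
        map_smul' := fun c X => by
          simp only [map_smul, Matrix.smul_apply, smul_eq_mul, RingHom.id_apply] },
    LinearMap.toContinuousLinearMap
      { toFun := fun X => (skewPart k X (.inr 0) (.inr 2) - skewPart k X (.inr 0) (.inr 1)) / 2
        map_add' := fun X Y => by simp only [map_add, Matrix.add_apply]; ring
        map_smul' := fun c X => by
          simp only [map_smul, Matrix.smul_apply, smul_eq_mul, RingHom.id_apply]; ring }]

theorem vmat_add {k : ℕ} (S S' : Matrix (Fin k) (Fin k) ℝ) (B B' : Matrix (Fin k) (Fin 3) ℝ) :
    vmat S B + vmat S' B' = vmat (S + S') (B + B') := by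
  simp only [vmat, Matrix.fromBlocks_add, transpose_add, Matrix.mul_add, neg_add, add_zero]

theorem smul_vmat {k : ℕ} (c : ℝ) (S : Matrix (Fin k) (Fin k) ℝ) (B : Matrix (Fin k) (Fin 3) ℝ) :
    c • vmat S B = vmat (c • S) (c • B) := by
  simp only [vmat, Matrix.fromBlocks_smul, transpose_smul, Matrix.mul_smul, smul_neg,
    smul_zero]

/-- The projection to `V^⊥`. -/
noncomputable def perpPart (k : ℕ) : Mat k →L[ℝ] Mat k :=
  LinearMap.toContinuousLinearMap
    { toFun := fun X => vmat (skewPart k X).toBlocks₁₁ (skewPart k X).toBlocks₁₂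
      map_add' := fun X Y => by
        rw [map_add, vmat_add]
        rfl
      map_smul' := fun c X => by
        rw [map_smul, RingHom.id_apply, smul_vmat]
        rfl }

/-- The local coordinates on the general linear group adapted to the decomposition. -/
noncomputable def localCoord (k : ℕ) (X : Mat k) : Mat k :=
  toMat k (iota k (lowSL (sl2Coeff k 0 X))) * toMat k (iota k (diagSL (sl2Coeff k 1 X)))
    * toMat k (iota k (uppSL (sl2Coeff k 2 X))) * NormedSpace.exp (perpPart k X)
    * (1 + symmPart k X)

theorem lowSL_zero : lowSL 0 = 1 := by
  ext i j; fin_cases i <;> fin_cases j <;> simp [lowSL]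

theorem uppSL_zero : uppSL 0 = 1 := by
  ext i j; fin_cases i <;> fin_cases j <;> simp [uppSL]

theorem diagSL_zero : diagSL 0 = 1 := by
  ext i j; fin_cases i <;> fin_cases j <;> simp [diagSL]

theorem localCoord_zero (k : ℕ) : localCoord k 0 = 1 := by
  simp [localCoord, lowSL_zero, uppSL_zero, diagSL_zero]

theorem hasStrictFDerivAt_localCoord (k : ℕ) :
    HasStrictFDerivAt (localCoord k) ((ContinuousLinearEquiv.refl ℝ (Mat k)) : Mat k →L[ℝ] Mat k)
      0 := by
  have hc : ∀ {φ : ℝ → Mat k} {N : Mat k} (i : Fin 3), HasStrictDerivAt φ N 0 →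
      HasStrictFDerivAt (fun X => φ (sl2Coeff k i X)) ((sl2Coeff k i).smulRight N) 0 := by
    intro φ N i h
    have h0 : HasStrictDerivAt φ N (sl2Coeff k i 0) := by rwa [map_zero]
    have := h0.hasStrictFDerivAt.comp (0 : Mat k) (sl2Coeff k i).hasStrictFDerivAt
    refine this.congr_fderiv ?_
    ext1 X
    rfl
  have h1 := hc 0 (hasStrictDerivAt_iota_low k)
  have h2 := hc 1 (hasStrictDerivAt_iota_diag k)
  have h3 := hc 2 (hasStrictDerivAt_iota_upp k)
  have : CompleteSpace (Mat k) := FiniteDimensional.complete ℝ _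
  have h4 : HasStrictFDerivAt (fun X => NormedSpace.exp (perpPart k X)) (perpPart k) 0 := by
    have h0 : HasStrictFDerivAt (NormedSpace.exp : Mat k → Mat k) (1 : Mat k →L[ℝ] Mat k)
      (perpPart k 0) := by
      rw [map_zero]; exact hasStrictFDerivAt_exp_zero
    exact h0.comp (0 : Mat k) (perpPart k).hasStrictFDerivAt
  have h5 : HasStrictFDerivAt (fun X => 1 + symmPart k X)
      (LinearMap.toContinuousLinearMap (symmPart k)) 0 :=
    (LinearMap.toContinuousLinearMap (symmPart k)).hasStrictFDerivAt.const_add 1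
  have h := (((h1.mul' h2).mul' h3).mul' h4).mul' h5
  refine h.congr_fderiv ?_
  ext1 X
  have e := skewPart_add_symmPart k X
  rw [skewPart_eq] at e
  simp [lowSL_zero, uppSL_zero, diagSL_zero]
  conv_rhs => rw [← e]
  have hcorner : ∀ x y z : ℝ, corner k (x • U3 + y • Y3 + z • Ut3)
      = x • corner k U3 + y • corner k Y3 + z • corner k Ut3 := by
    intro x y z
    simp only [corner, Matrix.fromBlocks_smul, Matrix.fromBlocks_add, smul_zero, add_zero]
  have e1 : ∀ L : Mat k →L[ℝ] Mat k, ((1 : Mat k) • L) X = L X := fun L => one_mul _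
  have e2 : ∀ L : Mat k →L[ℝ] Mat k, ((1 : (Mat k)ᵐᵒᵖ) • L) X = L X := fun L => mul_one _
  erw [e1, e1, e1, e1, e2]
  change symmPart k X + (vmat (toBlocks₁₁ (skewPart k X)) (toBlocks₁₂ (skewPart k X))
    + ((((skewPart k X (.inr 0) (.inr 2) - skewPart k X (.inr 0) (.inr 1)) / 2) • corner k Ut3)
    + ((skewPart k X (.inr 1) (.inr 2) • corner k Y3)
    + (((skewPart k X (.inr 0) (.inr 1) + skewPart k X (.inr 0) (.inr 2)) / 2)
        • corner k U3)))) = vmat (toBlocks₁₁ (skewPart k X)) (toBlocks₁₂ (skewPart k X)) + corner k _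
        + symmPart k X
  rw [hcorner]
  abel

theorem norm_entry_le {m n : Type*} [Fintype m] [Fintype n] (A : Matrix m n ℝ) (i : m) (j : n) :
    |A i j| ≤ ‖A‖ := by
  rw [← Real.norm_eq_abs, ← coe_nnnorm, ← coe_nnnorm, NNReal.coe_le_coe,
    Matrix.linfty_opNNNorm_def]
  refine le_trans ?_ (Finset.le_sup (f := fun i => ∑ j, ‖A i j‖₊) (Finset.mem_univ i))
  exact Finset.single_le_sum (f := fun j => ‖A i j‖₊) (fun _ _ => zero_le) (Finset.mem_univ j)

theorem norm_le_of_entry_le {m n : Type*} [Fintype m] [Fintype n] (A : Matrix m n ℝ) {r : ℝ}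
    (hr : 0 ≤ r) (h : ∀ i j, |A i j| ≤ r) : ‖A‖ ≤ Fintype.card n * r := by
  lift r to NNReal using hr
  rw [← coe_nnnorm, ← NNReal.coe_natCast, ← NNReal.coe_mul, NNReal.coe_le_coe,
    Matrix.linfty_opNNNorm_def]
  refine Finset.sup_le fun i _ => ?_
  refine (Finset.sum_le_card_nsmul _ _ r fun j _ => ?_).trans_eq (by simp)
  rw [← NNReal.coe_le_coe]
  exact h i j

theorem low_diag_upp_entries {c τ b r : ℝ} (hr : r ≤ 1) (hc : |c| ≤ r) (hτ : |τ| ≤ r)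
    (hb : |b| ≤ r) {h : Matrix.SpecialLinearGroup (Fin 2) ℝ}
    (hh : h = lowSL c * diagSL τ * uppSL b) :
    |h 0 0 - 1| ≤ 3 * r ∧ |h 0 1| ≤ 3 * r ∧ |h 1 0| ≤ 3 * r ∧ |h 1 1 - 1| ≤ 3 * r := by
  have hr0 : 0 ≤ r := (abs_nonneg c).trans hc
  have e0 : h 0 0 = Real.exp (τ / 2) := by
    rw [hh, Matrix.SpecialLinearGroup.coe_mul, Matrix.SpecialLinearGroup.coe_mul]
    simp [lowSL, diagSL, uppSL]
  have e1 : h 0 1 = Real.exp (τ / 2) * b := by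
    rw [hh, Matrix.SpecialLinearGroup.coe_mul, Matrix.SpecialLinearGroup.coe_mul]
    simp [lowSL, diagSL, uppSL]
  have e2 : h 1 0 = c * Real.exp (τ / 2) := by
    rw [hh, Matrix.SpecialLinearGroup.coe_mul, Matrix.SpecialLinearGroup.coe_mul]
    simp [lowSL, diagSL, uppSL]
  have e3 : h 1 1 = c * Real.exp (τ / 2) * b + Real.exp (-(τ / 2)) := by
    rw [hh, Matrix.SpecialLinearGroup.coe_mul, Matrix.SpecialLinearGroup.coe_mul]
    simp [lowSL, diagSL, uppSL]
  have hτ2 : |τ / 2| ≤ 1 := by rw [abs_div, abs_two]; linarith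
  have h1 : |Real.exp (τ / 2) - 1| ≤ r := by
    have := Real.abs_exp_sub_one_le hτ2
    rw [abs_div, abs_two] at this
    linarith
  have h2 : |Real.exp (-(τ / 2)) - 1| ≤ r := by
    have := Real.abs_exp_sub_one_le (x := -(τ / 2)) (by rwa [abs_neg])
    rw [abs_neg, abs_div, abs_two] at this
    linarith
  have h3 : |Real.exp (τ / 2)| ≤ 2 := by
    rw [Real.abs_exp]
    linarith [(abs_le.1 h1).2]
  have h4 : |c * Real.exp (τ / 2)| ≤ 2 * r := by
    rw [abs_mul]
    nlinarith [abs_nonneg c, abs_nonneg (Real.exp (τ / 2))]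
  refine ⟨?_, ?_, ?_, ?_⟩
  · rw [e0]; linarith
  · rw [e1, abs_mul]
    nlinarith [abs_nonneg b, abs_nonneg (Real.exp (τ / 2))]
  · rw [e2]; linarith
  · rw [e3, add_sub_assoc]
    refine (abs_add_le _ _).trans ?_
    rw [abs_mul]
    nlinarith [abs_nonneg b, abs_nonneg (c * Real.exp (τ / 2))]

/-- Elements of `SO(n, 1)` near `1` are products of an element near `1` of the image of `SL(2, ℝ)`
and the exponential of a small element of `V^⊥`. -/
theorem exists_local_decomposition (k : ℕ) : ∃ C > 0, ∃ δ > 0, ∀ g : SOn1 k, ‖toMat k g - 1‖ < δ →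
    ∃ (h : Matrix.SpecialLinearGroup (Fin 2) ℝ) (S : Matrix (Fin k) (Fin k) ℝ)
      (B : Matrix (Fin k) (Fin 3) ℝ), Sᵀ = -S ∧
      toMat k g = toMat k (iota k h) * NormedSpace.exp (vmat S B) ∧
      |h 0 0 - 1| ≤ C * ‖toMat k g - 1‖ ∧ |h 0 1| ≤ C * ‖toMat k g - 1‖ ∧
      |h 1 0| ≤ C * ‖toMat k g - 1‖ ∧ |h 1 1 - 1| ≤ C * ‖toMat k g - 1‖ ∧
      (∀ i j, |S i j| ≤ C * ‖toMat k g - 1‖) ∧ (∀ i j, |B i j| ≤ C * ‖toMat k g - 1‖) := by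
  have : CompleteSpace (Mat k) := FiniteDimensional.complete ℝ _
  have hf := hasStrictFDerivAt_localCoord k
  have h1 := hf.eventually_right_inverse
  obtain ⟨c, hc, h2⟩ := hf.to_localInverse.hasFDerivAt.isBigO_sub.exists_pos
  rw [Asymptotics.isBigOWith_iff] at h2
  have h0 : hf.localInverse (localCoord k) _ 0 1 = 0 := by
    have := hf.localInverse_apply_image
    rwa [localCoord_zero] at this
  rw [localCoord_zero, h0] at h2
  rw [localCoord_zero] at h1
  set φ := hf.localInverse (localCoord k) _ 0 with hφ
  obtain ⟨δ, hδ, hball⟩ := Metric.eventually_nhds_iff.1 (h1.and h2)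
  set σ := LinearMap.toContinuousLinearMap (symmPart k) with hσ
  obtain ⟨C0, hC0, n0⟩ := (sl2Coeff k 0).bound
  obtain ⟨C1, hC1, n1⟩ := (sl2Coeff k 1).bound
  obtain ⟨C2, hC2, n2⟩ := (sl2Coeff k 2).bound
  obtain ⟨C3, hC3, n3⟩ := (perpPart k).bound
  obtain ⟨C4, hC4, n4⟩ := σ.bound
  set Cs := C0 + C1 + C2 + C3 + C4 with hCs
  have hCs0 : 0 < Cs := by positivity
  refine ⟨3 * Cs * c, by positivity, min δ (1 / (Cs * c)), by positivity, fun g hg => ?_⟩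
  obtain ⟨hX, hXn⟩ := hball (y := toMat k g) (by rw [dist_eq_norm]; exact hg.trans_le (min_le_left _ _))
  set X := φ (toMat k g) with hXdef
  rw [sub_zero] at hXn
  have hsmall : Cs * ‖X‖ < 1 := by
    have h3 := hg.trans_le (min_le_right _ _)
    rw [lt_div_iff₀ (by positivity)] at h3
    calc Cs * ‖X‖ ≤ Cs * (c * ‖toMat k g - 1‖) := by gcongr
      _ = ‖toMat k g - 1‖ * (Cs * c) := by ring
      _ < 1 := h3
  have hle : ∀ {r C : ℝ}, r ≤ C * ‖X‖ → C ≤ Cs → r ≤ Cs * ‖X‖ := fun hr hL =>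
    hr.trans (mul_le_mul_of_nonneg_right hL (norm_nonneg _))
  set h := lowSL (sl2Coeff k 0 X) * diagSL (sl2Coeff k 1 X) * uppSL (sl2Coeff k 2 X) with hh
  have hS := skewPart_toBlocks₁₁ k X
  set S := (skewPart k X).toBlocks₁₁ with hSdef
  set B := (skewPart k X).toBlocks₁₂ with hBdef
  have hX' : toMat k (iota k h * expG k ⟨vmat S B, vmat_mem_so hS B⟩) * (1 + symmPart k X)
      = toMat k g := by
    rw [← hX, localCoord, hh, map_mul, map_mul, map_mul, map_mul, map_mul, toMat_expG]
    rfl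
  have hsymm : symmPart k X = 0 := by
    set p := iota k h * expG k ⟨vmat S B, vmat_mem_so hS B⟩ with hp
    have hq : toMat k (p⁻¹ * g) = 1 + symmPart k X := by
      rw [map_mul, ← hX', ← mul_assoc, ← map_mul, inv_mul_cancel, map_one, one_mul]
    have hq2 : (1 + symmPart k X) * (1 + symmPart k X) = 1 := by
      have h3 := toMat_inv k (p⁻¹ * g)
      rw [hq, transpose_add, mul_add, add_mul, formJ_symmPart, transpose_one, mul_one,
        formJ_mul_formJ] at h3
      nth_rewrite 1 [← h3]
      rw [← hq, ← map_mul, inv_mul_cancel, map_one]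
    have hq3 : (2 : ℝ) • symmPart k X = -(symmPart k X * symmPart k X) := by
      have : (1 + symmPart k X) * (1 + symmPart k X)
        = 1 + (2 : ℝ) • symmPart k X + symmPart k X * symmPart k X := by
        rw [two_smul]; noncomm_ring
      rw [this] at hq2
      have h3 := sub_eq_zero.2 hq2
      rw [eq_neg_iff_add_eq_zero, ← h3]
      abel
    have hn := congrArg norm hq3
    rw [norm_smul, norm_neg] at hn
    have h4 := norm_mul_le (symmPart k X) (symmPart k X)
    have h5 : ‖symmPart k X‖ ≤ Cs * ‖X‖ := hle (n4 X) (by linarith)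
    rw [← hn] at h4
    have h6 := norm_nonneg (symmPart k X)
    rw [Real.norm_eq_abs, abs_two] at h4
    have h7 : ‖symmPart k X‖ = 0 := by nlinarith
    exact norm_eq_zero.1 h7
  rw [hsymm, add_zero, mul_one, map_mul, toMat_expG] at hX'
  have hCX : 3 * (Cs * ‖X‖) ≤ 3 * Cs * c * ‖toMat k g - 1‖ := by
    have : Cs * ‖X‖ ≤ Cs * (c * ‖toMat k g - 1‖) := by gcongr
    linarith
  obtain ⟨b1, b2, b3, b4⟩ := low_diag_upp_entries hsmall.le (hle (n0 X) (by linarith))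
    (hle (n1 X) (by linarith)) (hle (n2 X) (by linarith)) hh
  have hperp : ‖vmat S B‖ ≤ Cs * ‖X‖ := hle (n3 X) (by linarith)
  have hpos : 0 ≤ Cs * ‖X‖ := by positivity
  refine ⟨h, S, B, hS, hX'.symm, b1.trans hCX, b2.trans hCX, b3.trans hCX, b4.trans hCX, ?_, ?_⟩
  · intro i j
    have := norm_entry_le (vmat S B) (.inl i) (.inl j)
    rw [vmat, Matrix.fromBlocks_apply₁₁] at this
    rw [← vmat] at this
    linarith
  · intro i j
    have := norm_entry_le (vmat S B) (.inl i) (.inr j)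
    rw [vmat, Matrix.fromBlocks_apply₁₂] at this
    rw [← vmat] at this
    linarith

end LocalInverse

section Displacement

open scoped Matrix.Norms.Operator

theorem mul_exp_of_semiconj {m n : Type*} [Fintype m] [DecidableEq m] [Fintype n] [DecidableEq n]
    {D : Matrix m n ℝ} {A : Matrix n n ℝ} {A' : Matrix m m ℝ} (h : D * A = A' * D) :
    D * NormedSpace.exp A = NormedSpace.exp A' * D := by
  have : CompleteSpace (Matrix n n ℝ) := FiniteDimensional.complete ℝ _
  have : CompleteSpace (Matrix m m ℝ) := FiniteDimensional.complete ℝ _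
  have hpow : ∀ i : ℕ, D * A ^ i = A' ^ i * D := by
    intro i
    induction i with
    | zero => simp
    | succ i ih => rw [pow_succ, ← Matrix.mul_assoc, ih, Matrix.mul_assoc, h, ← Matrix.mul_assoc,
        ← pow_succ]
  have h1 := (NormedSpace.exp_series_hasSum_exp' (𝕂 := ℝ) A).map
    (AddMonoidHom.mk' (fun M : Matrix n n ℝ => D * M) (fun _ _ => Matrix.mul_add _ _ _))
    (by exact (continuous_const (y := D)).matrix_mul continuous_id)
  have h2 := (NormedSpace.exp_series_hasSum_exp' (𝕂 := ℝ) A').map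
    (AddMonoidHom.mk' (fun M : Matrix m m ℝ => M * D) (fun _ _ => Matrix.add_mul _ _ _))
    (by exact continuous_id.matrix_mul (continuous_const (y := D)))
  refine h1.unique ?_
  convert h2 using 1
  · funext i
    simp [hpow i]
  · rfl

/-- The upper right block of `exp v` controls the block `B` of `v ∈ V^⊥`. -/
theorem exists_norm_mul_le_exp_block (k : ℕ) : ∃ δ > 0, ∀ (S : Matrix (Fin k) (Fin k) ℝ)
    (B : Matrix (Fin k) (Fin 3) ℝ), ‖S‖ < δ → ‖B‖ < δ → ∀ u : Matrix (Fin 3) (Fin 3) ℝ,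
      ‖B * u‖ ≤ 2 * ‖(NormedSpace.exp (vmat S B)).toBlocks₁₂ * u‖ := by
  let P : Matrix (Fin k) (Fin k) ℝ × Matrix (Fin k) (Fin 3) ℝ → Matrix (Fin k) (Fin k) ℝ :=
    fun z => (NormedSpace.exp (Matrix.fromBlocks z.1 1 (-(z.2 * (J3 * z.2ᵀ))) 0 :
      Matrix (Fin k ⊕ Fin k) (Fin k ⊕ Fin k) ℝ)).toBlocks₁₂
  have hP : ∀ S B, (NormedSpace.exp (vmat S B)).toBlocks₁₂ = P (S, B) * B := by
    intro S B
    have h := mul_exp_of_semiconj (D := (Matrix.fromBlocks 1 0 0 B :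
        Matrix (Fin k ⊕ Fin k) (Fin k ⊕ Fin 3) ℝ)) (A := vmat S B)
      (A' := Matrix.fromBlocks S 1 (-(B * (J3 * Bᵀ))) 0) (by
        simp [vmat, Matrix.fromBlocks_multiply])
    have h' := congrArg Matrix.toBlocks₁₂ h
    rw [← Matrix.fromBlocks_toBlocks (NormedSpace.exp (vmat S B)),
      ← Matrix.fromBlocks_toBlocks (NormedSpace.exp (Matrix.fromBlocks S 1 (-(B * (J3 * Bᵀ))) 0)),
      Matrix.fromBlocks_multiply, Matrix.fromBlocks_multiply] at h'
    simpa using h'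
  have hcont : Continuous P := by
    have : CompleteSpace (Matrix (Fin k ⊕ Fin k) (Fin k ⊕ Fin k) ℝ) :=
      FiniteDimensional.complete ℝ _
    have h1 : Continuous fun z : Matrix (Fin k) (Fin k) ℝ × Matrix (Fin k) (Fin 3) ℝ =>
        (Matrix.fromBlocks z.1 1 (-(z.2 * (J3 * z.2ᵀ))) 0 :
          Matrix (Fin k ⊕ Fin k) (Fin k ⊕ Fin k) ℝ) :=
      continuous_fst.matrix_fromBlocks continuous_const
        (continuous_snd.matrix_mul (continuous_const.matrix_mul continuous_snd.matrix_transpose)).neg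
        continuous_const
    have h2 := (NormedSpace.exp_continuous (𝔸 := Matrix (Fin k ⊕ Fin k) (Fin k ⊕ Fin k) ℝ)).comp h1
    refine continuous_matrix fun i j => ?_
    exact h2.matrix_elem (.inl i) (.inr j)
  have hP0 : P 0 = 1 := by
    have hN : (Matrix.fromBlocks 0 1 0 0 : Matrix (Fin k ⊕ Fin k) (Fin k ⊕ Fin k) ℝ) ^ 2 = 0 := by
      simp [pow_two, Matrix.fromBlocks_multiply]
    have hN3 : (Matrix.fromBlocks 0 1 0 0 : Matrix (Fin k ⊕ Fin k) (Fin k ⊕ Fin k) ℝ) ^ 3 = 0 := by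
      rw [pow_succ, hN, zero_mul]
    have : P 0 = (NormedSpace.exp (Matrix.fromBlocks 0 1 0 0 :
        Matrix (Fin k ⊕ Fin k) (Fin k ⊕ Fin k) ℝ)).toBlocks₁₂ := by simp [P]
    rw [this, exp_of_cube_eq_zero hN3, hN]
    ext i j
    simp [Matrix.toBlocks₁₂]
  obtain ⟨δ, hδ, hball⟩ := Metric.continuousAt_iff.1 hcont.continuousAt (1 / 2) (by norm_num)
  refine ⟨δ, hδ, fun S B hS hB u => ?_⟩
  have hlt : ‖P (S, B) - 1‖ < 1 / 2 := by
    have := hball (x := (S, B)) (by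
      rw [dist_eq_norm, sub_zero]
      exact max_lt hS hB)
    rwa [hP0, dist_eq_norm] at this
  have e : B * u = P (S, B) * B * u - (P (S, B) - 1) * (B * u) := by
    rw [Matrix.sub_mul, Matrix.one_mul, Matrix.mul_assoc]; abel
  have h1 : ‖(P (S, B) - 1) * (B * u)‖ ≤ 1 / 2 * ‖B * u‖ :=
    (Matrix.linfty_opNorm_mul _ _).trans (by gcongr)
  have h2 := norm_sub_le (P (S, B) * B * u) ((P (S, B) - 1) * (B * u))
  rw [← e] at h2
  rw [hP]
  linarith

theorem iota3_inv_mul (M : Matrix.SpecialLinearGroup (Fin 2) ℝ) :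
    iota3 (M⁻¹ : Matrix.SpecialLinearGroup (Fin 2) ℝ) * iota3 M = 1 := by
  rw [← iota3_mul, ← Matrix.SpecialLinearGroup.coe_mul, inv_mul_cancel,
    Matrix.SpecialLinearGroup.coe_one, iota3_one]

theorem iota_mul_exp_vmat (k : ℕ) (M : Matrix.SpecialLinearGroup (Fin 2) ℝ)
    (S : Matrix (Fin k) (Fin k) ℝ) (B : Matrix (Fin k) (Fin 3) ℝ) :
    toMat k (iota k M) * NormedSpace.exp (vmat S B)
      = NormedSpace.exp (vmat S (B * iota3 (M⁻¹ : Matrix.SpecialLinearGroup (Fin 2) ℝ)))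
        * toMat k (iota k M) := by
  refine mul_exp_of_semiconj ?_
  have h1 : J3 * (iota3 (M⁻¹ : Matrix.SpecialLinearGroup (Fin 2) ℝ))ᵀ = iota3 M * J3 := by
    have h := J3_iota3 (M⁻¹ : Matrix.SpecialLinearGroup (Fin 2) ℝ)
    have h2 : adjugate ((M⁻¹ : Matrix.SpecialLinearGroup (Fin 2) ℝ) : Matrix (Fin 2) (Fin 2) ℝ)
        = M := by
      rw [← Matrix.SpecialLinearGroup.coe_inv, inv_inv]
    rw [h2] at h
    rw [← h, Matrix.mul_assoc, J3_mul_J3, Matrix.mul_one]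
  rw [toMat_iota, vmat, vmat, Matrix.fromBlocks_multiply, Matrix.fromBlocks_multiply]
  simp only [Matrix.one_mul, Matrix.zero_mul, add_zero, Matrix.mul_zero, zero_add, Matrix.mul_one,
    Matrix.mul_neg, Matrix.transpose_mul, Matrix.mul_assoc, iota3_inv_mul,
    neg_zero]
  rw [← Matrix.mul_assoc J3, h1, Matrix.mul_assoc]

theorem abs_sub_one_le_of_sq {x δ : ℝ} (h : |x ^ 2 - 1| ≤ δ) (hx : 0 < x) : |x - 1| ≤ δ := by
  have h1 : x ^ 2 - 1 = (x - 1) * (x + 1) := by ring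
  rw [h1, abs_mul, abs_of_pos (by linarith : 0 < x + 1)] at h
  nlinarith [abs_nonneg (x - 1)]

theorem abs_le_of_mul_of_sq {x y δ : ℝ} (hx : |x ^ 2 - 1| ≤ 3 / 4) (h : |x * y| ≤ δ) :
    |y| ≤ 2 * δ := by
  rw [abs_mul] at h
  have h1 : 1 / 2 ≤ |x| := by
    have := (abs_le.1 hx).1
    rw [← sq_abs] at this
    nlinarith [abs_nonneg x]
  nlinarith [abs_nonneg y]

/-- Matrices with image near `1` in `SO(2, 1)` are near `1` or `-1`. -/
theorem near_pm_one_of_iota3 {a b c d δ : ℝ} (hdet : a * d - b * c = 1) (hδ : δ ≤ 1 / 100)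
    (h : ∀ i j, |(iota3 !![a, b; c, d] - 1) i j| ≤ δ) :
    ∃ s : ℝ, (s = 1 ∨ s = -1) ∧ |a - s| ≤ 10 * δ ∧ |b| ≤ 10 * δ ∧ |c| ≤ 10 * δ ∧ |d - s| ≤ 10 * δ := by
  have e00 := abs_le.1 (h 0 0)
  have e01 := abs_le.1 (h 0 1)
  have e02 := abs_le.1 (h 0 2)
  have e10 := abs_le.1 (h 1 0)
  have e20 := abs_le.1 (h 2 0)
  have e11 := abs_le.1 (h 1 1)
  have e12 := abs_le.1 (h 1 2)
  have e21 := abs_le.1 (h 2 1)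
  have e22 := abs_le.1 (h 2 2)
  simp [iota3] at e00 e01 e02 e10 e20 e11 e12 e21 e22
  have hδ0 : 0 ≤ δ := by linarith
  have ha : |a ^ 2 - 1| ≤ 2 * δ := by rw [abs_le]; constructor <;> linarith
  have hd : |d ^ 2 - 1| ≤ 2 * δ := by rw [abs_le]; constructor <;> linarith
  have hbd : |d * b| ≤ δ := by rw [abs_le]; constructor <;> linarith
  have hac : |a * c| ≤ δ := by rw [abs_le]; constructor <;> linarith
  have had : 0 < a * d := by linarith
  have hb := abs_le_of_mul_of_sq (hd.trans (by linarith)) hbd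
  have hc := abs_le_of_mul_of_sq (ha.trans (by linarith)) hac
  rcases lt_or_ge 0 a with h0 | h0
  · have hd0 : 0 < d := (pos_iff_pos_of_mul_pos had).1 h0
    refine ⟨1, .inl rfl, ?_, by linarith, by linarith, ?_⟩
    · linarith [abs_sub_one_le_of_sq ha h0]
    · linarith [abs_sub_one_le_of_sq hd hd0]
  · have ha0 : 0 < -a := by
      rcases h0.eq_or_lt with h1 | h1
      · simp [h1] at had
      · linarith
    have hd0 : 0 < -d := by
      by_contra! hcon
      have : a * d ≤ 0 := mul_nonpos_of_nonpos_of_nonneg h0 (by linarith)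
      linarith
    refine ⟨-1, .inr rfl, ?_, by linarith, by linarith, ?_⟩
    · have := abs_sub_one_le_of_sq (x := -a) (δ := 2 * δ) (by rwa [neg_sq]) ha0
      rw [show a - -1 = -(-a - 1) by ring, abs_neg]; linarith
    · have := abs_sub_one_le_of_sq (x := -d) (δ := 2 * δ) (by rwa [neg_sq]) hd0
      rw [show d - -1 = -(-d - 1) by ring, abs_neg]; linarith

theorem abs_vmat_le {k : ℕ} {S : Matrix (Fin k) (Fin k) ℝ} {B : Matrix (Fin k) (Fin 3) ℝ} {r : ℝ}
    (hr : 0 ≤ r) (hS : ∀ i j, |S i j| ≤ r) (hB : ∀ i j, |B i j| ≤ r) (i j) : |vmat S B i j| ≤ r := by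
  rcases i with i | i <;> rcases j with j | j
  · exact hS i j
  · exact hB i j
  · have : vmat S B (.inr i) (.inl j) = -(![1, 1, -1] i * B j i) := by
      simp [vmat, J3, Matrix.diagonal_mul]
    rw [this, abs_neg, abs_mul]
    have h1 : |(![1, 1, -1] : Fin 3 → ℝ) i| = 1 := by fin_cases i <;> simp
    rw [h1, one_mul]
    exact hB j i
  · simpa [vmat] using hr

theorem exists_norm_exp_sub_one_le (k : ℕ) : ∃ C > 0, ∃ δ > 0, ∀ w : Mat k, ‖w‖ < δ →
    ‖NormedSpace.exp w - 1‖ ≤ C * ‖w‖ := by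
  have : CompleteSpace (Mat k) := FiniteDimensional.complete ℝ _
  have h : HasFDerivAt (NormedSpace.exp : Mat k → Mat k) (1 : Mat k →L[ℝ] Mat k) 0 :=
    hasFDerivAt_exp_zero
  obtain ⟨C, hC, h2⟩ := h.isBigO_sub.exists_pos
  rw [Asymptotics.isBigOWith_iff] at h2
  obtain ⟨δ, hδ, hb⟩ := Metric.eventually_nhds_iff.1 h2
  refine ⟨C, hC, δ, hδ, fun w hw => ?_⟩
  have := hb (y := w) (by rwa [dist_zero_right])
  rwa [NormedSpace.exp_zero, sub_zero] at this

theorem lowSL_inv (s : ℝ) : (lowSL s)⁻¹ = lowSL (-s) := by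
  rw [inv_eq_iff_mul_eq_one]
  ext i j
  rw [Matrix.SpecialLinearGroup.coe_mul]
  fin_cases i <;> fin_cases j <;> simp [lowSL]

theorem lowSL_mul_mul_lowSL (h : Matrix.SpecialLinearGroup (Fin 2) ℝ) (s t : ℝ) :
    ((lowSL t * h * lowSL (-s) : Matrix.SpecialLinearGroup (Fin 2) ℝ) : Matrix (Fin 2) (Fin 2) ℝ)
      = !![h 0 0 - s * h 0 1, h 0 1;
          h 1 0 + t * h 0 0 - s * h 1 1 - s * t * h 0 1, h 1 1 + t * h 0 1] := by
  rw [Matrix.SpecialLinearGroup.coe_mul, Matrix.SpecialLinearGroup.coe_mul]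
  ext i j
  rw [Matrix.mul_apply, Fin.sum_univ_two, Matrix.mul_apply, Matrix.mul_apply, Fin.sum_univ_two,
    Fin.sum_univ_two]
  fin_cases i <;> fin_cases j <;> simp [lowSL] <;> ring

theorem toMat_displacement {k : ℕ} {g : SOn1 k} {h : Matrix.SpecialLinearGroup (Fin 2) ℝ}
    {S : Matrix (Fin k) (Fin k) ℝ} {B : Matrix (Fin k) (Fin 3) ℝ}
    (hg : toMat k g = toMat k (iota k h) * NormedSpace.exp (vmat S B))
    (M N : Matrix.SpecialLinearGroup (Fin 2) ℝ) :
    toMat k (iota k M * g * (iota k N)⁻¹) = toMat k (iota k (M * h * N⁻¹))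
      * NormedSpace.exp (vmat S (B * iota3 (N⁻¹ : Matrix.SpecialLinearGroup (Fin 2) ℝ))) := by
  have h1 := iota_mul_exp_vmat k N S B
  set w := vmat S (B * iota3 (N⁻¹ : Matrix.SpecialLinearGroup (Fin 2) ℝ))
  have h3 : toMat k (iota k N⁻¹) * toMat k (iota k N) = 1 := by
    rw [← map_mul, ← map_mul, inv_mul_cancel, map_one, map_one]
  have h4 : toMat k (iota k N) * toMat k (iota k N⁻¹) = 1 := by
    rw [← map_mul, ← map_mul, mul_inv_cancel, map_one, map_one]
  have h2 : NormedSpace.exp (vmat S B) * toMat k (iota k N⁻¹)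
      = toMat k (iota k N⁻¹) * NormedSpace.exp w := by
    calc NormedSpace.exp (vmat S B) * toMat k (iota k N⁻¹)
        = toMat k (iota k N⁻¹) * (toMat k (iota k N) * NormedSpace.exp (vmat S B))
          * toMat k (iota k N⁻¹) := by rw [← mul_assoc, h3, one_mul]
      _ = _ := by rw [h1, mul_assoc, mul_assoc, h4, mul_one]
  rw [map_mul, map_mul, hg, ← map_inv, map_mul (iota k), map_mul (iota k), map_mul (toMat k),
    map_mul (toMat k), mul_assoc, mul_assoc, h2, mul_assoc, mul_assoc]

theorem toBlocks₁₂_displacement {k : ℕ} {g : SOn1 k} {h : Matrix.SpecialLinearGroup (Fin 2) ℝ}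
    {v : Mat k} (hg : toMat k g = toMat k (iota k h) * v)
    (M N : Matrix.SpecialLinearGroup (Fin 2) ℝ) :
    (toMat k (iota k M * g * (iota k N)⁻¹)).toBlocks₁₂
      = v.toBlocks₁₂ * iota3 (N⁻¹ : Matrix.SpecialLinearGroup (Fin 2) ℝ) := by
  rw [map_mul, map_mul, hg, ← map_inv, toMat_iota, toMat_iota, toMat_iota,
    ← Matrix.fromBlocks_toBlocks v, Matrix.fromBlocks_multiply, Matrix.fromBlocks_multiply,
    Matrix.fromBlocks_multiply]
  simp

/-- The local decomposition of `g`, together with the bounds that smallness of the displacements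
`u^t g u^{-s}` imposes on its factors. -/
theorem exists_decomposition_displacement (k : ℕ) : ∃ C > 0, ∃ δ > 0, ∀ (g : SOn1 k) (r : ℝ),
    ‖toMat k g - 1‖ ≤ r → r < δ →
    ∃ (h : Matrix.SpecialLinearGroup (Fin 2) ℝ) (S : Matrix (Fin k) (Fin k) ℝ)
      (B : Matrix (Fin k) (Fin 3) ℝ), Sᵀ = -S ∧
      toMat k g = toMat k (iota k h) * NormedSpace.exp (vmat S B) ∧
      |h 0 0 - 1| ≤ C * r ∧ |h 0 1| ≤ C * r ∧ |h 1 0| ≤ C * r ∧ |h 1 1 - 1| ≤ C * r ∧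
      (∀ i j, |S i j| ≤ C * r) ∧ (∀ i j, |B i j| ≤ C * r) ∧
      ∀ s t : ℝ, 0 ≤ s * t → ‖toMat k (uflow k t * g * (uflow k s)⁻¹) - 1‖ ≤ r →
        (∀ i j, |(B * iota3 (lowSL (-s))) i j| ≤ C * r) ∧ |h 0 0 - s * h 0 1 - 1| ≤ C * r ∧
        |h 1 1 + t * h 0 1 - 1| ≤ C * r ∧
        |h 1 0 + t * h 0 0 - s * h 1 1 - s * t * h 0 1| ≤ C * r := by
  obtain ⟨C1, hC1, δ1, hδ1, H1⟩ := exists_local_decomposition k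
  obtain ⟨δ2, hδ2, H2⟩ := exists_norm_mul_le_exp_block k
  obtain ⟨C3, hC3, δ3, hδ3, H3⟩ := exists_norm_exp_sub_one_le k
  set q := C1 + 6 with hq
  set N : ℝ := ((Fintype.card (Fin k ⊕ Fin 3) : ℕ) : ℝ) with hN
  have hN3 : 3 ≤ N := by simp [hN]
  have hNk : (k : ℝ) ≤ N := by simp [hN]
  set Cw := N * q with hCw
  have hCw0 : 0 < Cw := by positivity
  set Ci := 2 + C3 * Cw with hCi
  have hCi0 : 0 < Ci := by positivity
  set C := 10 * Ci + C1 + 6 with hC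
  refine ⟨C, by positivity, min (min δ1 (δ2 / Cw)) (min (δ3 / Cw) (min (1 / (C3 * Cw)) (1 / (100 * C)))),
    by positivity, fun g r hg hr => ?_⟩
  have hr0 : 0 ≤ r := (norm_nonneg _).trans hg
  simp only [lt_min_iff] at hr
  obtain ⟨⟨r1, r2⟩, r3, r4, r5⟩ := hr
  rw [lt_div_iff₀ (by positivity)] at r2 r3 r4 r5
  obtain ⟨h, S, B, hS, hgh, b1, b2, b3, b4, b5, b6⟩ := H1 g (hg.trans_lt r1)
  have hup : ∀ {x D : ℝ}, x ≤ C1 * ‖toMat k g - 1‖ → C1 ≤ D → x ≤ D * r := by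
    intro x D hx hD
    calc x ≤ C1 * ‖toMat k g - 1‖ := hx
      _ ≤ C1 * r := by gcongr
      _ ≤ D * r := by gcongr
  have hC1C : C1 ≤ C := by linarith
  have hC1q : C1 ≤ q := by linarith
  refine ⟨h, S, B, hS, hgh, hup b1 hC1C, hup b2 hC1C, hup b3 hC1C, hup b4 hC1C,
    fun i j => hup (b5 i j) hC1C, fun i j => hup (b6 i j) hC1C, fun s t hst hg' => ?_⟩
  set g' := uflow k t * g * (uflow k s)⁻¹ with hg'def
  have hqr : 0 ≤ q * r := by positivity
  have hSn : ‖S‖ < δ2 := by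
    refine (norm_le_of_entry_le S hqr fun i j => hup (b5 i j) hC1q).trans_lt ?_
    rw [Fintype.card_fin]
    calc (k : ℝ) * (q * r) ≤ N * (q * r) := by gcongr
      _ = r * Cw := by rw [hCw]; ring
      _ < δ2 := r2
  have hBn : ‖B‖ < δ2 := by
    refine (norm_le_of_entry_le B hqr fun i j => hup (b6 i j) hC1q).trans_lt ?_
    rw [Fintype.card_fin]
    calc ((3 : ℕ) : ℝ) * (q * r) ≤ N * (q * r) := by gcongr; exact_mod_cast hN3
      _ = r * Cw := by rw [hCw]; ring
      _ < δ2 := r2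
  have hBu : ∀ i j, |(B * iota3 (lowSL (-s))) i j| ≤ 6 * r := by
    have hblock : (toMat k g').toBlocks₁₂
        = (NormedSpace.exp (vmat S B)).toBlocks₁₂ * iota3 (lowSL (-s)) := by
      rw [hg'def, uflow_eq, uflow_eq, toBlocks₁₂_displacement hgh, lowSL_inv]
    have hn : ‖(toMat k g').toBlocks₁₂‖ ≤ 3 * r := by
      have := norm_le_of_entry_le (toMat k g').toBlocks₁₂ hr0 (fun i j => by
        have h1 := (norm_entry_le (toMat k g' - 1) (.inl i) (.inr j)).trans hg'
        simpa [Matrix.toBlocks₁₂] using h1)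
      simpa using this
    intro i j
    have h1 := norm_entry_le (B * iota3 (lowSL (-s))) i j
    have h2 := H2 S B hSn hBn (iota3 (lowSL (-s)))
    rw [← hblock] at h2
    linarith
  set w := vmat S (B * iota3 (lowSL (-s))) with hw
  have hwn : ‖w‖ ≤ Cw * r := by
    have := norm_le_of_entry_le w hqr (abs_vmat_le hqr (fun i j => hup (b5 i j) hC1q)
      fun i j => (hBu i j).trans (by gcongr; linarith))
    rw [hCw, mul_assoc]
    exact this
  set M := lowSL t * h * lowSL (-s) with hM
  have hgM : toMat k (iota k M) = toMat k g' * NormedSpace.exp (-w) := by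
    have h1 := toMat_displacement hgh (lowSL t) (lowSL s)
    rw [lowSL_inv, ← uflow_eq, ← uflow_eq, ← hg'def, ← hw, ← hM] at h1
    rw [h1, mul_assoc, ← Matrix.exp_add_of_commute _ _ (Commute.neg_right (Commute.refl w)),
      add_neg_cancel, NormedSpace.exp_zero, mul_one]
  have hMn : ‖toMat k (iota k M) - 1‖ ≤ Ci * r := by
    have h1 : ‖NormedSpace.exp (-w) - 1‖ ≤ C3 * (Cw * r) := by
      refine (H3 (-w) ?_).trans ?_
      · rw [norm_neg]; linarith
      · rw [norm_neg]; gcongr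
    have e : toMat k (iota k M) - 1 = (toMat k g' - 1) * (NormedSpace.exp (-w) - 1)
        + (toMat k g' - 1) + (NormedSpace.exp (-w) - 1) := by
      rw [hgM]; noncomm_ring
    rw [e]
    refine (norm_add₃_le).trans ?_
    have h2 : ‖(toMat k g' - 1) * (NormedSpace.exp (-w) - 1)‖ ≤ r * 1 :=
      (norm_mul_le _ _).trans (by
        gcongr
        linarith)
    rw [hCi]
    linarith
  have hentry : ∀ i j, |(iota3 M - 1) i j| ≤ Ci * r := by
    intro i j
    have h1 := (norm_entry_le (toMat k (iota k M) - 1) (.inr i) (.inr j)).trans hMn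
    have h2 : (toMat k (iota k M) - 1) (.inr i) (.inr j) = (iota3 M - 1) i j := by
      rw [toMat_iota, ← Matrix.fromBlocks_one]
      rfl
    rwa [h2] at h1
  set a := h 0 0
  set b := h 0 1
  set c := h 1 0
  set d := h 1 1
  have hMmat : (M : Matrix (Fin 2) (Fin 2) ℝ)
      = !![a - s * b, b; c + t * a - s * d - s * t * b, d + t * b] :=
    lowSL_mul_mul_lowSL h s t
  have hdet := M.2
  rw [hMmat, Matrix.det_fin_two_of] at hdet
  rw [hMmat] at hentry
  have h10 : 10 * (Ci * r) ≤ C * r := by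
    rw [← mul_assoc]
    gcongr
    linarith
  have hCr : C * r ≤ 1 / 100 := by linarith
  have hC1r : C1 * r ≤ 1 / 100 := le_trans (by gcongr) hCr
  obtain ⟨σ, hσ, k1, k2, k3, k4⟩ := near_pm_one_of_iota3 hdet (by linarith) hentry
  have hσ1 : σ = 1 := by
    rcases hσ with rfl | rfl
    · rfl
    · exfalso
      have l1 := (abs_le.1 (hup b1 le_rfl)).1
      have l4 := (abs_le.1 (hup b4 le_rfl)).1
      have l2 := (abs_le.1 k1).2
      have l3 := (abs_le.1 k4).2
      have p1 : 0 < s * b := by linarith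
      have p2 : t * b < 0 := by linarith
      have p3 : (s * b) * (t * b) < 0 := mul_neg_of_pos_of_neg p1 p2
      nlinarith [sq_nonneg b]
  subst hσ1
  refine ⟨fun i j => (hBu i j).trans (by gcongr; linarith), k1.trans h10, k4.trans h10,
    k3.trans h10⟩

end Displacement

section Closing

/-- The coordinates of the rows of `B` with respect to the weight vectors. -/
noncomputable def weightCoord {k : ℕ} (B : Matrix (Fin k) (Fin 3) ℝ) (j : Fin k) : Fin 3 → ℝ :=
  ![(B j 1 - B j 2) / 2, B j 0 / 2, -(B j 1 + B j 2) / 2]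

theorem abs_weightCoord_le {k : ℕ} {B : Matrix (Fin k) (Fin 3) ℝ} {r : ℝ}
    (hB : ∀ i j, |B i j| ≤ r) (j : Fin k) (i : Fin 3) : |weightCoord B j i| ≤ r := by
  have h0 := abs_le.1 (hB j 0)
  have h1 := abs_le.1 (hB j 1)
  have h2 := abs_le.1 (hB j 2)
  fin_cases i <;> simp only [weightCoord] <;> rw [abs_le] <;> constructor <;> simp <;> linarith

theorem abs_le_of_weightCoord {k : ℕ} {B : Matrix (Fin k) (Fin 3) ℝ} {r : ℝ} {j : Fin k}
    (h0 : |weightCoord B j 0| ≤ r) (h1 : |weightCoord B j 1| ≤ r) (h2 : |weightCoord B j 2| ≤ r)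
    (i : Fin 3) : |B j i| ≤ 2 * r := by
  simp only [weightCoord] at h0 h1 h2
  rw [abs_le] at h0 h1 h2
  simp at h0 h1 h2
  fin_cases i <;> rw [abs_le] <;> constructor <;> simp <;> linarith

theorem vmat_eq_sum_weightVector {k : ℕ} (S : Matrix (Fin k) (Fin k) ℝ)
    (B : Matrix (Fin k) (Fin 3) ℝ) :
    vmat S B = (∑ j, ∑ i, weightCoord B j i • weightVector k j i) + rotationPart k S := by
  have hB : B = ∑ j, ∑ i, weightCoord B j i • Matrix.vecMulVec (Pi.single j 1) (wtRow i) := by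
    ext p q
    simp only [Matrix.sum_apply, Fin.sum_univ_three]
    rw [Finset.sum_eq_single p]
    · fin_cases q <;> simp [weightCoord, wtRow] <;> ring
    · intro j _ hj
      simp [Matrix.vecMulVec_apply, Pi.single_eq_of_ne hj.symm]
    · simp
  have hw : ∀ j i, weightVector k j i = vmat 0 (Matrix.vecMulVec (Pi.single j 1) (wtRow i)) :=
    fun _ _ => rfl
  have hr : rotationPart k S = vmat S 0 := by simp [rotationPart, vmat]
  have hadd : ∀ B : Matrix (Fin k) (Fin 3) ℝ, vmat S B = vmat 0 B + vmat S 0 := fun B => by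
    rw [vmat_add, zero_add, add_zero]
  let L : Matrix (Fin k) (Fin 3) ℝ →ₗ[ℝ] Mat k :=
    { toFun := vmat 0
      map_add' := fun B B' => by rw [vmat_add, add_zero]
      map_smul' := fun c B => by rw [RingHom.id_apply, smul_vmat, smul_zero] }
  rw [hadd, hr]
  congr 1
  change L B = _
  conv_lhs => rw [hB]
  simp only [map_sum, map_smul]
  rfl

theorem weightCoord_mul_low {k : ℕ} (B : Matrix (Fin k) (Fin 3) ℝ) (s : ℝ) (j : Fin k) :
    weightCoord (B * iota3 (lowSL (-s))) j 2
      = weightCoord B j 2 + 2 * s * weightCoord B j 1 + s ^ 2 * weightCoord B j 0 := by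
  simp [weightCoord, Matrix.mul_apply, Fin.sum_univ_three, iota3, lowSL]
  ring

theorem weightCoord_mul_diag {k : ℕ} (B : Matrix (Fin k) (Fin 3) ℝ) (τ : ℝ) (j : Fin k) :
    weightCoord (B * iota3 (diagSL (-τ))) j 0 = Real.exp τ * weightCoord B j 0 ∧
    weightCoord (B * iota3 (diagSL (-τ))) j 1 = weightCoord B j 1 ∧
    weightCoord (B * iota3 (diagSL (-τ))) j 2 = Real.exp (-τ) * weightCoord B j 2 := by
  have h1 : Real.exp (-τ / 2) ^ 2 = Real.exp (-τ) := by
    rw [← Real.exp_nat_mul]; congr 1; push_cast; ring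
  have h2 : Real.exp (-(-τ / 2)) ^ 2 = Real.exp τ := by
    rw [← Real.exp_nat_mul]; congr 1; push_cast; ring
  have h3 : Real.exp (-τ / 2) * Real.exp (-(-τ / 2)) = 1 := by
    rw [← Real.exp_add]; simp
  refine ⟨?_, ?_, ?_⟩ <;>
    simp [weightCoord, Matrix.mul_apply, Fin.sum_univ_three, iota3, diagSL, h1, h2, h3] <;> ring

theorem diagSL_inv (τ : ℝ) : (diagSL τ)⁻¹ = diagSL (-τ) := by
  rw [inv_eq_iff_mul_eq_one]
  ext i j
  rw [Matrix.SpecialLinearGroup.coe_mul]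
  fin_cases i <;> fin_cases j <;> simp [diagSL, ← Real.exp_add, neg_div]

theorem diagSL_conj (h : Matrix.SpecialLinearGroup (Fin 2) ℝ) (τ : ℝ) :
    ((diagSL τ * h * (diagSL τ)⁻¹ : Matrix.SpecialLinearGroup (Fin 2) ℝ) :
      Matrix (Fin 2) (Fin 2) ℝ)
      = !![h 0 0, Real.exp τ * h 0 1; Real.exp (-τ) * h 1 0, h 1 1] := by
  have h1 : Real.exp (τ / 2) * Real.exp (τ / 2) = Real.exp τ := by
    rw [← Real.exp_add]; congr 1; ring
  have h2 : Real.exp (-(τ / 2)) * Real.exp (-(τ / 2)) = Real.exp (-τ) := by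
    rw [← Real.exp_add]; congr 1; ring
  have h3 : Real.exp (τ / 2) * Real.exp (-(τ / 2)) = 1 := by
    rw [← Real.exp_add]; simp
  rw [diagSL_inv, Matrix.SpecialLinearGroup.coe_mul, Matrix.SpecialLinearGroup.coe_mul]
  ext i j
  rw [Matrix.mul_apply, Fin.sum_univ_two, Matrix.mul_apply, Matrix.mul_apply, Fin.sum_univ_two,
    Fin.sum_univ_two]
  fin_cases i <;> fin_cases j <;> simp [diagSL, neg_div]
  · linear_combination h 0 0 * h3
  · linear_combination h 0 1 * h1
  · linear_combination h 1 0 * h2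
  · linear_combination h 1 1 * h3

theorem diagSL_conj_low (s τ : ℝ) :
    diagSL τ * lowSL s * (diagSL τ)⁻¹ = lowSL (Real.exp (-τ) * s) := by
  apply Subtype.ext
  change ((diagSL τ * lowSL s * (diagSL τ)⁻¹ : Matrix.SpecialLinearGroup (Fin 2) ℝ) :
      Matrix (Fin 2) (Fin 2) ℝ) = _
  rw [diagSL_conj]
  ext i j
  fin_cases i <;> fin_cases j <;> simp [lowSL]

/-- The data of an element of `SL(2, ℝ)` and an element of `V^⊥` whose conjugates by the diagonal
element of parameter `log R` are of size `δ`. -/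
structure IsSmallAt {k : ℕ} (δ R : ℝ) (h : Matrix.SpecialLinearGroup (Fin 2) ℝ)
    (S : Matrix (Fin k) (Fin k) ℝ) (B : Matrix (Fin k) (Fin 3) ℝ) : Prop where
  h00 : |h 0 0 - 1| ≤ δ
  h01 : R * |h 0 1| ≤ δ
  h10 : |h 1 0| ≤ δ
  h11 : |h 1 1 - 1| ≤ δ
  rot : ∀ i j, |S i j| ≤ δ
  w0 : ∀ j, R * |weightCoord B j 0| ≤ δ
  w1 : ∀ j, |weightCoord B j 1| ≤ δ
  w2 : ∀ j, |weightCoord B j 2| ≤ δ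

theorem IsSmallAt.conj {k : ℕ} {δ τ : ℝ} {h : Matrix.SpecialLinearGroup (Fin 2) ℝ}
    {S : Matrix (Fin k) (Fin k) ℝ} {B : Matrix (Fin k) (Fin 3) ℝ} (hτ : 0 ≤ τ)
    (hs : IsSmallAt δ (Real.exp τ) h S B) :
    IsSmallAt δ 1 (diagSL τ * h * (diagSL τ)⁻¹) S
      (B * iota3 ((diagSL τ)⁻¹ : Matrix.SpecialLinearGroup (Fin 2) ℝ)) := by
  have hτ1 : Real.exp (-τ) ≤ 1 := Real.exp_le_one_iff.2 (by linarith)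
  have e := diagSL_conj h τ
  have ec : ∀ x : ℝ, |Real.exp (-τ) * x| ≤ |x| := fun x => by
    rw [abs_mul, Real.abs_exp]
    exact mul_le_of_le_one_left (abs_nonneg _) hτ1
  have ee : ∀ x : ℝ, 1 * |Real.exp τ * x| = Real.exp τ * |x| := fun x => by
    rw [one_mul, abs_mul, Real.abs_exp]
  constructor
  · rw [e]; exact hs.h00
  · rw [e]; exact (ee _).trans_le hs.h01
  · rw [e]; exact (ec _).trans hs.h10
  · rw [e]; exact hs.h11
  · exact hs.rot
  · intro j
    rw [diagSL_inv, (weightCoord_mul_diag B τ j).1, ee]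
    exact hs.w0 j
  · intro j
    rw [diagSL_inv, (weightCoord_mul_diag B τ j).2.1]
    exact hs.w1 j
  · intro j
    rw [diagSL_inv, (weightCoord_mul_diag B τ j).2.2]
    exact (ec _).trans (hs.w2 j)

theorem isSmallAt_low {k : ℕ} {δ x : ℝ} (hx : |x| ≤ δ) :
    IsSmallAt δ 1 (lowSL x) (0 : Matrix (Fin k) (Fin k) ℝ) 0 := by
  have hδ : 0 ≤ δ := (abs_nonneg x).trans hx
  constructor <;> simp [lowSL, weightCoord, hδ, hx]

open scoped Matrix.Norms.Operator in
theorem exists_mem_of_isSmallAt_one {k : ℕ} {W : Set (SOn1 k)} (hW : W ∈ 𝓝 1) :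
    ∃ δ > 0, ∀ (g : SOn1 k) (h : Matrix.SpecialLinearGroup (Fin 2) ℝ)
      (S : Matrix (Fin k) (Fin k) ℝ) (B : Matrix (Fin k) (Fin 3) ℝ),
      toMat k g = toMat k (iota k h) * NormedSpace.exp (vmat S B) → IsSmallAt δ 1 h S B → g ∈ W := by
  have hind : 𝓝 (1 : SOn1 k) = (𝓝 (toMat k 1)).comap (toMat k) :=
    (isClosedEmbedding_toMat k).isInducing.nhds_eq_comap 1
  rw [hind, map_one] at hW
  obtain ⟨V, hV, hVW⟩ := hW
  let F : Matrix (Fin 2) (Fin 2) ℝ × Matrix (Fin k) (Fin k) ℝ × Matrix (Fin k) (Fin 3) ℝ → Mat k :=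
    fun z => Matrix.fromBlocks 1 0 0 (iota3 z.1) * NormedSpace.exp (vmat z.2.1 z.2.2)
  have hF : Continuous F := by
    have : CompleteSpace (Mat k) := FiniteDimensional.complete ℝ _
    have h1 : Continuous fun z : Matrix (Fin 2) (Fin 2) ℝ × Matrix (Fin k) (Fin k) ℝ ×
        Matrix (Fin k) (Fin 3) ℝ => iota3 z.1 := by
      refine continuous_matrix fun i j => ?_
      have e : ∀ p q, Continuous fun z : Matrix (Fin 2) (Fin 2) ℝ × Matrix (Fin k) (Fin k) ℝ ×
        Matrix (Fin k) (Fin 3) ℝ => z.1 p q := fun p q => continuous_fst.matrix_elem p q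
      have e00 := e 0 0
      have e01 := e 0 1
      have e10 := e 1 0
      have e11 := e 1 1
      fin_cases i <;> fin_cases j <;> simp [iota3] <;> fun_prop
    have h2 : Continuous fun z : Matrix (Fin 2) (Fin 2) ℝ × Matrix (Fin k) (Fin k) ℝ ×
        Matrix (Fin k) (Fin 3) ℝ => (vmat z.2.1 z.2.2 : Mat k) :=
      continuous_snd.fst.matrix_fromBlocks continuous_snd.snd
        (continuous_const.matrix_mul continuous_snd.snd.matrix_transpose).neg continuous_const
    have h3 := (NormedSpace.exp_continuous (𝔸 := Mat k)).comp h2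
    exact (continuous_const.matrix_fromBlocks continuous_const continuous_const h1).mul h3
  have hF1 : F (1, 0, 0) = 1 := by
    simp [F, iota3_one, vmat]
  have hpre : F ⁻¹' V ∈ 𝓝 ((1, 0, 0) : Matrix (Fin 2) (Fin 2) ℝ × Matrix (Fin k) (Fin k) ℝ ×
      Matrix (Fin k) (Fin 3) ℝ) := hF.continuousAt.preimage_mem_nhds (by rwa [hF1])
  obtain ⟨r, hr, hball⟩ := Metric.mem_nhds_iff.1 hpre
  set N : ℝ := k + 7 with hN
  have hN0 : 0 < N := by positivity
  refine ⟨r / (2 * N), by positivity, fun g h S B hg hs => ?_⟩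
  set δ := r / (2 * N) with hδ
  have hδ0 : 0 < δ := by positivity
  have hNδ : N * δ < r := by
    rw [hδ, mul_div_assoc', div_lt_iff₀ (by positivity)]
    nlinarith
  have hk0 : (0 : ℝ) ≤ k := by positivity
  have b1 : ‖((h : Matrix (Fin 2) (Fin 2) ℝ) - 1)‖ < r := by
    refine (norm_le_of_entry_le _ hδ0.le (fun i j => ?_)).trans_lt (lt_of_le_of_lt ?_ hNδ)
    · have h01 := hs.h01
      rw [one_mul] at h01
      fin_cases i <;> fin_cases j <;> simp
      · exact hs.h00
      · exact h01
      · exact hs.h10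
      · exact hs.h11
    · rw [Fintype.card_fin]; gcongr; push_cast; linarith
  have b2 : ‖S‖ < r := by
    refine (norm_le_of_entry_le _ hδ0.le hs.rot).trans_lt (lt_of_le_of_lt ?_ hNδ)
    rw [Fintype.card_fin]; gcongr; linarith
  have b3 : ‖B‖ < r := by
    refine (norm_le_of_entry_le B (r := 2 * δ) (by positivity) (fun j i => ?_)).trans_lt
      (lt_of_le_of_lt ?_ hNδ)
    · have h0 := hs.w0 j
      rw [one_mul] at h0
      exact abs_le_of_weightCoord h0 (hs.w1 j) (hs.w2 j) i
    · rw [Fintype.card_fin]; push_cast; nlinarith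
  have hmem : ((h : Matrix (Fin 2) (Fin 2) ℝ), S, B) ∈ F ⁻¹' V := by
    apply hball
    rw [Metric.mem_ball, dist_eq_norm]
    simp only [Prod.mk_sub_mk, sub_zero, Prod.norm_mk]
    exact max_lt b1 (max_lt b2 b3)
  apply hVW
  rw [mem_preimage, hg, toMat_iota]
  exact hmem

/-- Points of the image of a compact set have no stabilizers near the identity. -/
theorem exists_nhds_stabilizer_trivial {G : Type*} [Group G] [TopologicalSpace G]
    [IsTopologicalGroup G] (Γ : Subgroup G) [DiscreteTopology Γ] {C : Set G} (hC : IsCompact C) :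
    ∃ W ∈ 𝓝 (1 : G), ∀ p ∈ ((↑) : G → G ⧸ Γ) '' C, ∀ g ∈ W, g • p = p → g = 1 := by
  obtain ⟨V, hV, hV1⟩ : ∃ V ∈ 𝓝 (1 : G), ∀ g ∈ V, g ∈ Γ → g = 1 := by
    have : {(1 : Γ)} ∈ 𝓝 (1 : Γ) := by simp
    rw [nhds_subtype_eq_comap] at this
    obtain ⟨V, hV, hsub⟩ := this
    refine ⟨V, hV, fun g hg hgΓ => ?_⟩
    have h1 : (⟨g, hgΓ⟩ : Γ) ∈ ({1} : Set Γ) := hsub hg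
    exact congrArg Subtype.val h1
  obtain ⟨V', hV'V, hV'o, hV'1⟩ := mem_nhds_iff.1 hV
  let f : G × G → G := fun z => z.2⁻¹ * z.1 * z.2
  have hf : Continuous f := by fun_prop
  have hsub : ({1} : Set G) ×ˢ C ⊆ f ⁻¹' V' := by
    rintro ⟨a, c⟩ ⟨ha, _⟩
    rw [mem_singleton_iff] at ha
    subst ha
    simpa [f] using hV'1
  obtain ⟨u, v, hu, _, hu1, hv, huv⟩ :=
    generalized_tube_lemma isCompact_singleton hC (hV'o.preimage hf) hsub
  refine ⟨u, hu.mem_nhds (hu1 rfl), ?_⟩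
  rintro _ ⟨c, hc, rfl⟩ g hg hgc
  have h1 : c⁻¹ * g * c ∈ Γ := by
    rw [MulAction.Quotient.smul_mk, smul_eq_mul, eq_comm, QuotientGroup.eq] at hgc
    rwa [mul_assoc]
  have h2 := hV1 _ (hV'V (huv (mk_mem_prod hg (hv hc)))) h1
  have h3 : g = c * (c⁻¹ * g * c) * c⁻¹ := by group
  rw [h3, show c⁻¹ * g * c = 1 from h2]
  group

theorem exists_nhds_closing {G : Type*} [Group G] [TopologicalSpace G]
    [IsTopologicalGroup G] (Γ : Subgroup G) [DiscreteTopology Γ] {C : Set G} (hC : IsCompact C) :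
    ∃ V ∈ 𝓝 (1 : G), ∀ (a : G) (p : G ⧸ Γ), a • p ∈ ((↑) : G → G ⧸ Γ) '' C → ∀ u u' g g' : G,
      a * u * a⁻¹ ∈ V → a * u' * a⁻¹ ∈ V → a * g * a⁻¹ ∈ V → a * g' * a⁻¹ ∈ V →
      u' • g • p = g' • u • p → u' * g = g' * u := by
  obtain ⟨W, hW, hWst⟩ := exists_nhds_stabilizer_trivial Γ hC
  have hcont : Continuous fun z : G × G × G × G => z.1⁻¹ * z.2.1⁻¹ * z.2.2.1 * z.2.2.2 := by
    fun_prop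
  have hpre := hcont.continuousAt.preimage_mem_nhds (x := (1, 1, 1, 1)) (t := W) (by simpa using hW)
  rw [nhds_prod_eq, nhds_prod_eq, nhds_prod_eq, Filter.mem_prod_iff] at hpre
  obtain ⟨V1, hV1, Z, hZ, h1⟩ := hpre
  obtain ⟨V2, hV2, Z', hZ', h2⟩ := Filter.mem_prod_iff.1 hZ
  obtain ⟨V3, hV3, V4, hV4, h3⟩ := Filter.mem_prod_iff.1 hZ'
  refine ⟨V1 ∩ V2 ∩ (V3 ∩ V4), Filter.inter_mem (Filter.inter_mem hV1 hV2)
    (Filter.inter_mem hV3 hV4), fun a p hp u u' g g' hu hu' hg hg' heq => ?_⟩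
  have hW' : (a * u * a⁻¹)⁻¹ * (a * g' * a⁻¹)⁻¹ * (a * u' * a⁻¹) * (a * g * a⁻¹) ∈ W :=
    h1 (mk_mem_prod hu.1.1 (h2 (mk_mem_prod hg'.1.2 (h3 (mk_mem_prod hu'.2.1 hg.2.2)))))
  set γ := u⁻¹ * g'⁻¹ * u' * g with hγ
  have hγp : γ • p = p := by
    rw [hγ]
    simp only [mul_smul]
    rw [heq, inv_smul_smul, inv_smul_smul]
  have hconjγ : a * γ * a⁻¹ = (a * u * a⁻¹)⁻¹ * (a * g' * a⁻¹)⁻¹ * (a * u' * a⁻¹)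
      * (a * g * a⁻¹) := by rw [hγ]; group
  have h1 : a * γ * a⁻¹ = 1 := by
    refine hWst _ hp _ (by rwa [hconjγ]) ?_
    rw [mul_smul, mul_smul, inv_smul_smul, hγp]
  have h2 : γ = 1 := by
    have : γ = a⁻¹ * (a * γ * a⁻¹) * a := by group
    rw [this, h1]; group
  have h3 : u' * g = g' * u * γ := by rw [hγ]; group
  rw [h3, h2, mul_one]

/-- If the geodesic flow brings a point to a compact set, then nearby orbits of the unipotent flow
that return close to each other after a comparatively short time return through the same
displacement. -/
theorem exists_closing {k : ℕ} (Γ : Subgroup (SOn1 k)) [DiscreteTopology Γ] {C : Set (SOn1 k)}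
    (hC : IsCompact C) : ∃ δ > 0, ∀ (τ : ℝ) (p : SOn1 k ⧸ Γ), 0 ≤ τ →
      iota k (diagSL τ) • p ∈ ((↑) : SOn1 k → SOn1 k ⧸ Γ) '' C →
      ∀ s t : ℝ, |s| ≤ δ * Real.exp τ → |t| ≤ δ * Real.exp τ → ∀ (g g' : SOn1 k)
        (h h' : Matrix.SpecialLinearGroup (Fin 2) ℝ) (S S' : Matrix (Fin k) (Fin k) ℝ)
        (B B' : Matrix (Fin k) (Fin 3) ℝ),
      toMat k g = toMat k (iota k h) * NormedSpace.exp (vmat S B) →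
      toMat k g' = toMat k (iota k h') * NormedSpace.exp (vmat S' B') →
      IsSmallAt δ (Real.exp τ) h S B → IsSmallAt δ (Real.exp τ) h' S' B' →
      uflow k t • g • p = g' • uflow k s • p → uflow k t * g = g' * uflow k s := by
  obtain ⟨V, hV, hVW⟩ := exists_nhds_closing Γ hC
  obtain ⟨δ, hδ, hsmall⟩ := exists_mem_of_isSmallAt_one hV
  refine ⟨δ, hδ, fun τ p hτ hp s t hs ht g g' h h' S S' B B' hg hg' hsm hsm' heq => ?_⟩
  have hu : ∀ s : ℝ, |s| ≤ δ * Real.exp τ →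
      iota k (diagSL τ) * uflow k s * (iota k (diagSL τ))⁻¹ ∈ V := by
    intro s hs
    have e : iota k (diagSL τ) * uflow k s * (iota k (diagSL τ))⁻¹
        = iota k (lowSL (Real.exp (-τ) * s)) := by
      rw [uflow_eq, ← map_inv, ← map_mul, ← map_mul, diagSL_conj_low]
    rw [e]
    refine hsmall _ (lowSL (Real.exp (-τ) * s)) 0 0 (by simp [vmat]) (isSmallAt_low ?_)
    rw [abs_mul, Real.abs_exp]
    calc Real.exp (-τ) * |s| ≤ Real.exp (-τ) * (δ * Real.exp τ) := by gcongr
      _ = δ * (Real.exp (-τ) * Real.exp τ) := by ring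
      _ = δ := by rw [← Real.exp_add]; simp
  exact hVW _ p hp _ _ g g' (hu s hs) (hu t ht)
    (hsmall _ _ _ _ (toMat_displacement hg (diagSL τ) (diagSL τ)) (hsm.conj hτ))
    (hsmall _ _ _ _ (toMat_displacement hg' (diagSL τ) (diagSL τ)) (hsm'.conj hτ)) heq

end Closing

section Estimates

/-- A matrix of determinant `1` that is displaced little at two well separated times is very close
to the lower triangular unipotent group. -/
theorem abs_entries_le_of_displacement {a b c d r η L E s₁ t₁ s₂ t₂ : ℝ} (hη : η ∈ Ioo (0 : ℝ) 1)
    (hdet : a * d - b * c = 1) (hr : r ≤ 1 / 100) (ha : |a - 1| ≤ r) (hb : |b| ≤ r) (hc : |c| ≤ r)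
    (hd : |d - 1| ≤ r) (hL : 1 ≤ L) (hL2 : 2 ≤ L ^ η) (hs₁ : L ≤ |s₁|) (hs₂ : L ≤ |s₂|)
    (hs : L ≤ |s₁ - s₂|) (hE : |s₁| ≤ E)
    (ht₁ : |t₁ - s₁| ≤ |s₁| ^ (1 - η)) (ht₂ : |t₂ - s₂| ≤ |s₂| ^ (1 - η))
    (ht : |(t₁ - t₂) - (s₁ - s₂)| ≤ |s₁ - s₂| ^ (1 - η))
    (h₁ : |c + t₁ * a - s₁ * d - s₁ * t₁ * b| ≤ r) (h₂ : |c + t₂ * a - s₂ * d - s₂ * t₂ * b| ≤ r) :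
    |b| ≤ 16 * L ^ (-1 - η) ∧ |a - 1| ≤ 100 * (E * L ^ (-1 - η)) ∧
      |d - 1| ≤ 100 * (E * L ^ (-1 - η)) := by
  obtain ⟨hη0, hη1⟩ := hη
  have hL0 : 0 < L := by linarith
  set x := L ^ (-η) with hx
  have hx0 : 0 < x := Real.rpow_pos_of_pos hL0 _
  have hx2 : x ≤ 1 / 2 := by
    rw [hx, Real.rpow_neg hL0.le, ← one_div]
    exact one_div_le_one_div_of_le two_pos hL2
  have hxL : x / L = L ^ (-1 - η) := by
    rw [hx, show -1 - η = -η - 1 by ring, Real.rpow_sub_one hL0.ne']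
  have hLx : 1 ≤ L * x := by
    have : L * x = L ^ (1 - η) := by
      rw [hx, show 1 - η = 1 + -η by ring, Real.rpow_add hL0, Real.rpow_one]
    rw [this]
    exact Real.one_le_rpow hL (by linarith)
  have hpow : ∀ s : ℝ, L ≤ |s| → |s| ^ (1 - η) ≤ |s| * x := by
    intro s hs
    have hs0 : 0 < |s| := by linarith
    rw [show 1 - η = 1 + -η by ring, Real.rpow_add hs0, Real.rpow_one]
    gcongr
    exact Real.rpow_le_rpow_of_nonpos hL0 hs (by linarith)
  have hr0 : 0 ≤ r := (abs_nonneg _).trans hb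
  have ha2 : |a| ≤ 101 / 100 := by
    have := abs_le.1 ha
    rw [abs_le]; constructor <;> linarith
  have hd2 : |d| ≤ 101 / 100 := by
    have := abs_le.1 hd
    rw [abs_le]; constructor <;> linarith
  have key : ∀ s t : ℝ, L ≤ |s| → |t - s| ≤ |s| ^ (1 - η) →
      |c + t * a - s * d - s * t * b| ≤ r → |a - d - t * b| ≤ 4 * x := by
    intro s t hs ht h
    have hs0 : 0 < |s| := by linarith
    have e : s * (a - d - t * b) = (c + t * a - s * d - s * t * b) - c - (t - s) * a := by ring
    have h1 : |s * (a - d - t * b)| ≤ r + r + |s| * x * (101 / 100) := by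
      rw [e]
      refine (abs_sub _ _).trans (add_le_add ((abs_sub _ _).trans (add_le_add h hc)) ?_)
      rw [abs_mul]
      exact mul_le_mul (ht.trans (hpow s hs)) ha2 (abs_nonneg _) (by positivity)
    have h2 : 1 ≤ |s| * x := hLx.trans (by gcongr)
    rw [abs_mul] at h1
    refine le_of_mul_le_mul_left ?_ hs0
    nlinarith
  have k1 := key s₁ t₁ hs₁ ht₁ h₁
  have k2 := key s₂ t₂ hs₂ ht₂ h₂
  have hbL : L * |b| ≤ 16 * x := by
    have h1 : |(t₁ - t₂) * b| ≤ 8 * x := by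
      have e : (t₁ - t₂) * b = (a - d - t₂ * b) - (a - d - t₁ * b) := by ring
      rw [e]
      refine (abs_sub _ _).trans ?_
      linarith
    have h2 : |s₁ - s₂| ≤ 2 * |t₁ - t₂| := by
      have h3 := ht.trans (hpow _ hs)
      have h4 := abs_sub_abs_le_abs_sub (s₁ - s₂) (t₁ - t₂)
      rw [abs_sub_comm (s₁ - s₂)] at h4
      have h5 : |s₁ - s₂| * x ≤ |s₁ - s₂| * (1 / 2) := by gcongr
      linarith
    rw [abs_mul] at h1
    nlinarith [abs_nonneg b]
  have hb' : |b| ≤ 16 * (x / L) := by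
    rw [← mul_div_assoc, le_div_iff₀ hL0]; linarith
  have hLE : L ≤ E := hs₁.trans hE
  have hy0 : 0 < x / L := by positivity
  have hxy : x ≤ E * (x / L) := by
    rw [mul_div_assoc', le_div_iff₀ hL0]
    nlinarith
  have had : |a - d| ≤ 36 * (E * (x / L)) := by
    have h1 : |t₁| ≤ 2 * E := by
      have h3 := ht₁.trans (hpow _ hs₁)
      have h4 := abs_sub_abs_le_abs_sub t₁ s₁
      have h5 : |s₁| * x ≤ |s₁| * (1 / 2) := by gcongr
      linarith [abs_nonneg s₁]
    have e : a - d = (a - d - t₁ * b) + t₁ * b := by ring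
    rw [e]
    refine (abs_add_le _ _).trans ?_
    rw [abs_mul]
    have h2 : |t₁| * |b| ≤ 2 * E * (16 * (x / L)) :=
      mul_le_mul h1 hb' (abs_nonneg _) (by linarith)
    linarith
  have hbc : |b * c| ≤ E * (x / L) := by
    rw [abs_mul]
    have h1 : |b| * |c| ≤ 16 * (x / L) * (1 / 100) :=
      mul_le_mul hb' (hc.trans hr) (abs_nonneg _) (by positivity)
    have h2 : 1 * (x / L) ≤ E * (x / L) := by gcongr; linarith
    linarith
  have fin : ∀ p q : ℝ, |p - 1| ≤ r → |p| ≤ 101 / 100 → p * q - b * c = 1 →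
      |p - q| ≤ 36 * (E * (x / L)) → |p - 1| ≤ 100 * (E * (x / L)) := by
    intro p q hp hp2 hpq hd
    have e : (p - 1) * (p + 1) = p * (p - q) + b * c := by linear_combination hpq
    have h1 : |p - 1| * |p + 1| ≤ 101 / 100 * (36 * (E * (x / L))) + E * (x / L) := by
      rw [← abs_mul, e]
      refine (abs_add_le _ _).trans (add_le_add ?_ hbc)
      rw [abs_mul]
      exact mul_le_mul hp2 hd (abs_nonneg _) (by norm_num)
    have h2 : 1 ≤ |p + 1| := by
      rw [abs_of_pos] <;> linarith [(abs_le.1 hp).1]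
    have h3 : |p - 1| * 1 ≤ |p - 1| * |p + 1| := by gcongr
    have h4 : 0 ≤ E * (x / L) := mul_nonneg (by linarith) hy0.le
    linarith
  rw [← hxL]
  refine ⟨hb', fin a d ha ha2 hdet had, fin d a hd hd2 (by linarith) ?_⟩
  rw [abs_sub_comm]
  exact had

theorem abs_weights_le_of_displacement {b₀ b₁ b₂ r L E s₁ s₂ : ℝ} (hL : 0 < L) (hb₂ : |b₂| ≤ r)
    (hs₁ : L ≤ |s₁|) (hs₂ : L ≤ |s₂|) (hs : L ≤ |s₁ - s₂|) (hE : |s₁| ≤ E)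
    (h₁ : |b₂ + 2 * s₁ * b₁ + s₁ ^ 2 * b₀| ≤ r) (h₂ : |b₂ + 2 * s₂ * b₁ + s₂ ^ 2 * b₀| ≤ r) :
    |b₀| ≤ 4 * r / L ^ 2 ∧ |b₁| ≤ 3 * r * E / L ^ 2 := by
  have hr0 : 0 ≤ r := (abs_nonneg _).trans hb₂
  have key : ∀ s : ℝ, L ≤ |s| → |b₂ + 2 * s * b₁ + s ^ 2 * b₀| ≤ r →
      L * |2 * b₁ + s * b₀| ≤ 2 * r := by
    intro s hs h
    have e : s * (2 * b₁ + s * b₀) = (b₂ + 2 * s * b₁ + s ^ 2 * b₀) - b₂ := by ring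
    calc L * |2 * b₁ + s * b₀| ≤ |s| * |2 * b₁ + s * b₀| := by gcongr
      _ = |s * (2 * b₁ + s * b₀)| := (abs_mul _ _).symm
      _ ≤ 2 * r := by
        rw [e]
        refine (abs_sub _ _).trans ?_
        linarith
  have k1 := key s₁ hs₁ h₁
  have k2 := key s₂ hs₂ h₂
  have h0 : L ^ 2 * |b₀| ≤ 4 * r := by
    have e : (s₁ - s₂) * b₀ = (2 * b₁ + s₁ * b₀) - (2 * b₁ + s₂ * b₀) := by ring
    calc L ^ 2 * |b₀| = L * (L * |b₀|) := by ring
      _ ≤ L * (|s₁ - s₂| * |b₀|) := by gcongr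
      _ = L * |(s₁ - s₂) * b₀| := by rw [abs_mul]
      _ ≤ L * (|2 * b₁ + s₁ * b₀| + |2 * b₁ + s₂ * b₀|) := by
        rw [e]; gcongr; exact abs_sub _ _
      _ ≤ 4 * r := by linarith
  refine ⟨by rw [le_div_iff₀ (by positivity)]; linarith, ?_⟩
  rw [le_div_iff₀ (by positivity)]
  have e : 2 * b₁ = (2 * b₁ + s₁ * b₀) - s₁ * b₀ := by ring
  have h1 : 2 * |b₁| ≤ |2 * b₁ + s₁ * b₀| + |s₁| * |b₀| := by
    have h3 := abs_sub (2 * b₁ + s₁ * b₀) (s₁ * b₀)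
    rw [← e, abs_mul, abs_mul, abs_two] at h3
    exact h3
  have hE0 : 0 ≤ E := hL.le.trans (hs₁.trans hE)
  have h2 : L ^ 2 * (|s₁| * |b₀|) ≤ E * (4 * r) := by
    calc L ^ 2 * (|s₁| * |b₀|) = |s₁| * (L ^ 2 * |b₀|) := by ring
      _ ≤ E * (4 * r) := by gcongr
  have h3 : L ^ 2 * |2 * b₁ + s₁ * b₀| ≤ E * (2 * r) := by
    calc L ^ 2 * |2 * b₁ + s₁ * b₀| = L * (L * |2 * b₁ + s₁ * b₀|) := by ring
      _ ≤ E * (2 * r) := mul_le_mul (hs₁.trans hE) k1 (by positivity) hE0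
  have h4 : 2 * (|b₁| * L ^ 2) ≤ L ^ 2 * |2 * b₁ + s₁ * b₀| + L ^ 2 * (|s₁| * |b₀|) := by
    rw [← mul_add]
    calc 2 * (|b₁| * L ^ 2) = L ^ 2 * (2 * |b₁|) := by ring
      _ ≤ _ := by gcongr
  linarith

theorem exists_scale {κ δ m : ℝ} (hκ : 0 < κ) (hκ1 : κ ≤ 1 / 10) (hδ : 0 < δ) :
    ∃ M : ℝ, 1 < M ∧ m ≤ M ∧ m ≤ M ^ (1 - κ) ∧ 2 ≤ (M ^ (1 - κ)) ^ (10 * κ) ∧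
      100 * M ^ (-κ) ≤ δ ∧ 2 < κ * Real.log M ∧
      ∀ j : ℕ, (M ^ ((1 + κ) ^ j)) ^ (-κ) ≤ (1 / 64) * (1 / 2) ^ j := by
  have t1 := tendsto_rpow_atTop (y := 1 - κ) (by linarith)
  have t2 := (tendsto_rpow_atTop (y := 10 * κ) (by linarith)).comp t1
  have t3 := tendsto_rpow_neg_atTop hκ
  have t4 := tendsto_rpow_neg_atTop (y := κ ^ 2) (by positivity)
  have t5 := Real.tendsto_log_atTop
  obtain ⟨M, h1, h2, h3, h4, h5, h6, h7, h8⟩ := ((Filter.eventually_gt_atTop (1 : ℝ)).and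
    ((Filter.eventually_ge_atTop m).and ((t1.eventually_ge_atTop m).and
    ((t2.eventually_ge_atTop 2).and ((t3.eventually_le_const (u := δ / 100) (by positivity)).and
    ((t5.eventually_gt_atTop (2 / κ)).and ((t3.eventually_le_const (u := 1 / 64) (by norm_num)).and
    (t4.eventually_le_const (u := 1 / 2) (by norm_num))))))))).exists
  have hM0 : 0 < M := by linarith
  refine ⟨M, h1, h2, h3, h4, by linarith, ?_, fun j => ?_⟩
  · rw [div_lt_iff₀ hκ] at h6; linarith
  · have hb : 1 + j * κ ≤ (1 + κ) ^ j := one_add_mul_le_pow (by linarith) j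
    calc (M ^ ((1 + κ) ^ j)) ^ (-κ) = M ^ ((1 + κ) ^ j * (-κ)) := (Real.rpow_mul hM0.le _ _).symm
      _ ≤ M ^ (-κ + -(κ ^ 2) * j) := by
        refine Real.rpow_le_rpow_of_exponent_le h1.le ?_
        nlinarith
      _ = M ^ (-κ) * (M ^ (-(κ ^ 2))) ^ j := by
        rw [Real.rpow_add hM0, Real.rpow_mul hM0.le, Real.rpow_natCast]
      _ ≤ (1 / 64) * (1 / 2) ^ j := by gcongr

end Estimates

section Recurrence

theorem exists_iterate_notMem_of_birkhoffSum_le {X : Type*} {T : X → X} {B : Set X} {ω : ℝ} {x : X}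
    (hω : 0 ≤ ω) (h : ∀ N : ℕ, birkhoffSum T (B.indicator fun _ => (1 : ℝ)) N x ≤ ω * N) {p q : ℝ}
    (hp : 0 ≤ p) (hq : 0 ≤ q) (hpq : p + 2 + ω * q < q) : ∃ i : ℕ, p ≤ i ∧ i ≤ q ∧ T^[i] x ∉ B := by
  by_contra! hcon
  have hN := h ⌊q⌋₊
  have h1 : ((⌊q⌋₊ - ⌈p⌉₊ : ℕ) : ℝ) ≤ birkhoffSum T (B.indicator fun _ => (1 : ℝ)) ⌊q⌋₊ x := by
    calc ((⌊q⌋₊ - ⌈p⌉₊ : ℕ) : ℝ) = ∑ i ∈ Finset.Ico ⌈p⌉₊ ⌊q⌋₊, (1 : ℝ) := by simp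
      _ ≤ ∑ i ∈ Finset.Ico ⌈p⌉₊ ⌊q⌋₊, (B.indicator fun _ => (1 : ℝ)) (T^[i] x) := by
        refine Finset.sum_le_sum fun i hi => ?_
        rw [Finset.mem_Ico] at hi
        rw [indicator_of_mem]
        exact hcon i (Nat.ceil_le.1 hi.1) ((Nat.cast_le.2 hi.2.le).trans (Nat.floor_le hq))
      _ ≤ _ := by
        refine Finset.sum_le_sum_of_subset_of_nonneg ?_ fun i _ _ =>
          indicator_nonneg (fun _ _ => zero_le_one) _
        intro i hi
        rw [Finset.mem_Ico] at hi
        exact Finset.mem_range.2 hi.2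
  have h2 := Nat.lt_floor_add_one q
  have h3 := Nat.ceil_lt_add_one hp
  have h4 : (⌊q⌋₊ : ℝ) - ⌈p⌉₊ ≤ ((⌊q⌋₊ - ⌈p⌉₊ : ℕ) : ℝ) := by
    rw [sub_le_iff_le_add]
    exact_mod_cast le_tsub_add
  have h5 : ω * ⌊q⌋₊ ≤ ω * q := by gcongr; exact Nat.floor_le hq
  linarith


/-- There is a large compact set of points whose orbits under the time one map of the geodesic flow
spend, at all times, most of their time in a fixed compact set. -/
theorem exists_compact_recurrent {k : ℕ} (Γ : Subgroup (SOn1 k)) [DiscreteTopology Γ]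
    [MeasurableSpace (SOn1 k ⧸ Γ)] [BorelSpace (SOn1 k ⧸ Γ)]
    (μ : Measure (SOn1 k ⧸ Γ)) [IsProbabilityMeasure μ]
    [SMulInvariantMeasure (SOn1 k) (SOn1 k ⧸ Γ) μ] (a : SOn1 k) {σ ω : ℝ} (hσ : 0 < σ) (hσ1 : σ < 1)
    (hω : 0 < ω) : ∃ C : Set (SOn1 k), IsCompact C ∧ ∃ K : Set (SOn1 k ⧸ Γ), IsCompact K ∧
      ENNReal.ofReal (1 - σ) < μ K ∧ ∀ x ∈ K, ∀ N : ℕ, birkhoffSum (fun x => a • x)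
        ((((↑) : SOn1 k → SOn1 k ⧸ Γ) '' C)ᶜ.indicator fun _ => (1 : ℝ)) N x ≤ ω * N := by
  have : IsClosed (Γ : Set (SOn1 k)) := Subgroup.isClosed_of_discrete
  have : T2Space (SOn1 k ⧸ Γ) := inferInstance
  set π : SOn1 k → SOn1 k ⧸ Γ := fun g => (g : SOn1 k ⧸ Γ) with hπ
  let F : ℕ → Set (SOn1 k ⧸ Γ) := fun n => π '' compactCovering (SOn1 k) n
  have hFc : ∀ n, IsCompact (F n) := fun n =>
    (isCompact_compactCovering _ n).image continuous_quotient_mk'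
  have hFm : ∀ n, MeasurableSet (F n) := fun n => (hFc n).isClosed.measurableSet
  have hlarge : ∀ τ : ℝ, 0 < τ → ∃ n, μ.real (F n)ᶜ < τ := by
    intro τ hτ
    have hmono : Monotone F := fun i j hij => image_mono (compactCovering_subset _ hij)
    have hU : ⋃ n, F n = univ := by
      rw [← image_iUnion, iUnion_compactCovering, image_univ]
      exact (QuotientGroup.mk_surjective).range_eq
    have ht := tendsto_measure_iUnion_atTop (μ := μ) hmono
    rw [hU, measure_univ] at ht
    have ht2 := (ENNReal.tendsto_toReal ENNReal.one_ne_top).comp ht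
    obtain ⟨n, hn⟩ := (ht2.eventually (lt_mem_nhds (a := 1 - τ) (by simpa using hτ))).exists
    refine ⟨n, ?_⟩
    rw [probReal_compl_eq_one_sub (hFm n)]
    change 1 - τ < μ.real (F n) at hn
    linarith
  obtain ⟨n, hn⟩ := hlarge (ω * (σ / 2)) (by positivity)
  obtain ⟨n', hn'⟩ := hlarge (σ / 2) (by positivity)
  set T : SOn1 k ⧸ Γ → SOn1 k ⧸ Γ := fun x => a • x with hT
  have hTc : Continuous T := continuous_const_smul a
  have hTm : MeasurePreserving T μ μ := measurePreserving_smul a μ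
  let f : SOn1 k ⧸ Γ → ℝ := (F n)ᶜ.indicator fun _ => (1 : ℝ)
  let E : Set (SOn1 k ⧸ Γ) := {x | ∀ N : ℕ, birkhoffSum T f N x ≤ ω * N}
  have hf : LowerSemicontinuous f :=
    (hFc n).isClosed.isOpen_compl.lowerSemicontinuous_indicator zero_le_one
  have hE : IsClosed E := by
    have : E = ⋂ N : ℕ, (birkhoffSum T f N) ⁻¹' Iic (ω * N) := by ext x; simp [E]
    rw [this]
    refine isClosed_iInter fun N => LowerSemicontinuous.isClosed_preimage ?_ _
    exact lowerSemicontinuous_sum fun i _ => hf.comp (hTc.iterate i)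
  have hmax := measure_exists_birkhoffSum_gt_le hTm (hFm n).compl hω
  have hEc : μ.real Eᶜ ≤ σ / 2 := by
    have e : Eᶜ = {x | ∃ N : ℕ, ω * N < birkhoffSum T f N x} := by ext x; simp [E]
    rw [e]
    refine ENNReal.toReal_le_of_le_ofReal (by positivity) (hmax.trans ?_)
    refine ENNReal.ofReal_le_ofReal ?_
    rw [div_le_iff₀ hω]
    linarith
  refine ⟨compactCovering (SOn1 k) n, isCompact_compactCovering _ n, E ∩ F n',
    (hFc n').inter_left hE, ?_, fun x hx N => hx.1 N⟩
  have hm : MeasurableSet (E ∩ F n') := hE.measurableSet.inter (hFm n')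
  have h1 : μ.real (E ∩ F n')ᶜ < σ := by
    rw [compl_inter]
    refine (measureReal_union_le _ _).trans_lt ?_
    linarith
  rw [probReal_compl_eq_one_sub hm] at h1
  rw [← ofReal_measureReal, ENNReal.ofReal_lt_ofReal_iff']
  constructor <;> linarith

end Recurrence

section Returns

open scoped Matrix.Norms.Operator

/-- An element of `SO(n, 1)` at distance `q` from `1`, decomposed along the image of `SL(2, ℝ)` and
`V^⊥` with factors of size `r`, together with the bounds implied by displacements of size `q`. -/
structure IsDecomposed {k : ℕ} (q r : ℝ) (g : SOn1 k) (h : Matrix.SpecialLinearGroup (Fin 2) ℝ)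
    (S : Matrix (Fin k) (Fin k) ℝ) (B : Matrix (Fin k) (Fin 3) ℝ) : Prop where
  norm_le : ‖toMat k g - 1‖ ≤ q
  skew : Sᵀ = -S
  eq_mul : toMat k g = toMat k (iota k h) * NormedSpace.exp (vmat S B)
  h00 : |h 0 0 - 1| ≤ r
  h01 : |h 0 1| ≤ r
  h10 : |h 1 0| ≤ r
  h11 : |h 1 1 - 1| ≤ r
  rot : ∀ i j, |S i j| ≤ r
  row : ∀ i j, |B i j| ≤ r
  disp : ∀ s t : ℝ, 0 ≤ s * t → ‖toMat k (uflow k t * g * (uflow k s)⁻¹) - 1‖ ≤ q →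
    (∀ i j, |(B * iota3 (lowSL (-s))) i j| ≤ r) ∧
      |h 1 0 + t * h 0 0 - s * h 1 1 - s * t * h 0 1| ≤ r

theorem IsRightInvariantMetric.exists_isDecomposed {k : ℕ} {dG : SOn1 k → SOn1 k → ℝ}
    (hdG : IsRightInvariantMetric k dG) : ∃ c, ∃ D > 0, ∃ ε₁ > 0, ∀ ε ≤ ε₁, ∀ g, dG g 1 < ε →
      ∃ h S B, IsDecomposed (c * ε) (D * ε) g h S B := by
  obtain ⟨c, hc, r₀, hr₀, H0⟩ := hdG.exists_norm_le
  obtain ⟨C, hC, δ, hδ, H1⟩ := exists_decomposition_displacement k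
  refine ⟨c, C * c, by positivity, min r₀ (δ / (2 * c)), by positivity, fun ε hε g hg => ?_⟩
  have hn : ‖toMat k g - 1‖ ≤ c * ε :=
    (H0 g (hg.trans_le (hε.trans (min_le_left _ _)))).trans (by gcongr)
  have hlt : c * ε < δ := by
    have := hε.trans (min_le_right _ _)
    rw [le_div_iff₀ (by positivity)] at this
    linarith
  obtain ⟨h, S, B, h1, h2, h3, h4, h5, h6, h7, h8, h9⟩ := H1 g (c * ε) hn hlt
  rw [← mul_assoc] at h3 h4 h5 h6
  simp only [← mul_assoc] at h7 h8 h9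
  exact ⟨h, S, B, hn, h1, h2, h3, h4, h5, h6, h7, h8, fun s t hst hn' =>
    ⟨(h9 s t hst hn').1, (h9 s t hst hn').2.2.2⟩⟩

theorem uflow_sub (k : ℕ) (a b : ℝ) : uflow k (a - b) = uflow k a * (uflow k b)⁻¹ := by
  have h : lowSL (a - b) = lowSL a * (lowSL b)⁻¹ := by
    rw [lowSL_inv]
    ext i j
    rw [Matrix.SpecialLinearGroup.coe_mul]
    fin_cases i <;> fin_cases j <;> simp [lowSL] ; ring
  rw [uflow_eq, uflow_eq, uflow_eq, h, map_mul, map_inv]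

/-- The element moving `x` to `y`, transported from the times `s` and `t`. -/
noncomputable def initialDisplacement {k : ℕ} (s t : ℝ) (g : SOn1 k) : SOn1 k :=
  (uflow k t)⁻¹ * g * uflow k s

theorem initialDisplacement_eq_iff {k : ℕ} {s t s' t' : ℝ} {g g' : SOn1 k} :
    initialDisplacement s t g = initialDisplacement s' t' g'
      ↔ uflow k (t' - t) * g = g' * uflow k (s' - s) := by
  rw [initialDisplacement, initialDisplacement, uflow_sub, uflow_sub]
  constructor
  · intro h
    calc uflow k t' * (uflow k t)⁻¹ * g
        = uflow k t' * ((uflow k t)⁻¹ * g * uflow k s) * (uflow k s)⁻¹ := by group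
      _ = g' * (uflow k s' * (uflow k s)⁻¹) := by rw [h]; group
  · intro h
    calc (uflow k t)⁻¹ * g * uflow k s
        = (uflow k t')⁻¹ * (uflow k t' * (uflow k t)⁻¹ * g) * uflow k s := by group
      _ = (uflow k t')⁻¹ * g' * uflow k s' := by rw [h]; group

theorem IsDecomposed.bounds {k : ℕ} {q r η L E s₁ t₁ s₂ t₂ : ℝ} {g : SOn1 k}
    {h : Matrix.SpecialLinearGroup (Fin 2) ℝ} {S : Matrix (Fin k) (Fin k) ℝ}
    {B : Matrix (Fin k) (Fin 3) ℝ} (hD : IsDecomposed q r g h S B) (hη : η ∈ Ioo (0 : ℝ) 1)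
    (hr : r ≤ 1 / 100) (hL : 1 ≤ L) (hL2 : 2 ≤ L ^ η) (hs₁ : L ≤ |s₁|) (hs₂ : L ≤ |s₂|)
    (hs : L ≤ |s₁ - s₂|) (hE : |s₁| ≤ E)
    (ht₁ : |t₁ - s₁| ≤ |s₁| ^ (1 - η)) (ht₂ : |t₂ - s₂| ≤ |s₂| ^ (1 - η))
    (ht : |(t₁ - t₂) - (s₁ - s₂)| ≤ |s₁ - s₂| ^ (1 - η)) (hst₁ : 0 ≤ s₁ * t₁) (hst₂ : 0 ≤ s₂ * t₂)
    (hn₁ : ‖toMat k (uflow k t₁ * g * (uflow k s₁)⁻¹) - 1‖ ≤ q)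
    (hn₂ : ‖toMat k (uflow k t₂ * g * (uflow k s₂)⁻¹) - 1‖ ≤ q) :
    (|h 0 1| ≤ 16 * L ^ (-1 - η) ∧ |h 0 0 - 1| ≤ 100 * (E * L ^ (-1 - η)) ∧
      |h 1 1 - 1| ≤ 100 * (E * L ^ (-1 - η))) ∧
      ∀ j, |weightCoord B j 0| ≤ 4 * r / L ^ 2 ∧ |weightCoord B j 1| ≤ 3 * r * E / L ^ 2 := by
  obtain ⟨hB₁, hc₁⟩ := hD.disp s₁ t₁ hst₁ hn₁
  obtain ⟨hB₂, hc₂⟩ := hD.disp s₂ t₂ hst₂ hn₂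
  have hdet := h.2
  rw [Matrix.det_fin_two] at hdet
  refine ⟨abs_entries_le_of_displacement hη hdet hr hD.h00 hD.h01 hD.h10 hD.h11 hL hL2 hs₁ hs₂ hs
    hE ht₁ ht₂ ht hc₁ hc₂, fun j => ?_⟩
  have e₁ := abs_weightCoord_le hB₁ j 2
  have e₂ := abs_weightCoord_le hB₂ j 2
  rw [weightCoord_mul_low] at e₁ e₂
  exact abs_weights_le_of_displacement (by linarith) (abs_weightCoord_le hD.row j 2) hs₁ hs₂ hs hE
    e₁ e₂

/-- The bounds of a return triple of size `ℓ` make the conjugates by the geodesic flow small up to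
the time `(1 + 4 κ) log ℓ`. -/
theorem IsDecomposed.isSmallAt {k : ℕ} {q r κ ℓ δ R : ℝ} {g : SOn1 k}
    {h : Matrix.SpecialLinearGroup (Fin 2) ℝ} {S : Matrix (Fin k) (Fin k) ℝ}
    {B : Matrix (Fin k) (Fin 3) ℝ} (hD : IsDecomposed q r g h S B) (hr : r ≤ 1 / 100) (hrδ : r ≤ δ)
    (hκ : 0 < κ) (hκ1 : κ ≤ 1 / 10) (hℓ : 1 ≤ ℓ) (hℓδ : 100 * ℓ ^ (-κ) ≤ δ)
    (hR : R ≤ ℓ ^ (1 + 4 * κ))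
    (hb : (|h 0 1| ≤ 16 * (ℓ ^ (1 - κ)) ^ (-1 - 10 * κ) ∧
      |h 0 0 - 1| ≤ 100 * (ℓ * (ℓ ^ (1 - κ)) ^ (-1 - 10 * κ)) ∧
      |h 1 1 - 1| ≤ 100 * (ℓ * (ℓ ^ (1 - κ)) ^ (-1 - 10 * κ))) ∧
      ∀ j, |weightCoord B j 0| ≤ 4 * r / (ℓ ^ (1 - κ)) ^ 2 ∧
        |weightCoord B j 1| ≤ 3 * r * ℓ / (ℓ ^ (1 - κ)) ^ 2) :
    IsSmallAt δ R h S B := by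
  obtain ⟨⟨b1, b2, b3⟩, b4⟩ := hb
  have hℓ0 : 0 < ℓ := by linarith
  have hr0 : 0 ≤ r := (abs_nonneg _).trans hD.h01
  set x := ℓ ^ (-κ) with hx
  have hx0 : 0 < x := Real.rpow_pos_of_pos hℓ0 _
  have hle : ∀ y : ℝ, y ≤ -κ → ℓ ^ y ≤ x := fun y hy => Real.rpow_le_rpow_of_exponent_le hℓ hy
  have e1 : (ℓ ^ (1 - κ)) ^ (-1 - 10 * κ) = ℓ ^ ((1 - κ) * (-1 - 10 * κ)) :=
    (Real.rpow_mul hℓ0.le _ _).symm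
  have e2 : ((ℓ ^ (1 - κ)) ^ 2)⁻¹ = ℓ ^ (-2 + 2 * κ) := by
    rw [← Real.rpow_natCast, ← Real.rpow_mul hℓ0.le, ← Real.rpow_neg hℓ0.le]
    congr 1
    push_cast
    ring
  have f1 : ℓ ^ (1 + 4 * κ) * ℓ ^ ((1 - κ) * (-1 - 10 * κ)) ≤ x := by
    rw [← Real.rpow_add hℓ0]
    exact hle _ (by nlinarith)
  have f2 : ℓ * ℓ ^ ((1 - κ) * (-1 - 10 * κ)) ≤ x := by
    nth_rewrite 1 [← Real.rpow_one ℓ]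
    rw [← Real.rpow_add hℓ0]
    exact hle _ (by nlinarith)
  have f3 : ℓ ^ (1 + 4 * κ) * ℓ ^ (-2 + 2 * κ) ≤ x := by
    rw [← Real.rpow_add hℓ0]
    exact hle _ (by linarith)
  have f4 : ℓ * ℓ ^ (-2 + 2 * κ) ≤ x := by
    nth_rewrite 1 [← Real.rpow_one ℓ]
    rw [← Real.rpow_add hℓ0]
    exact hle _ (by linarith)
  rw [e1] at b1 b2 b3
  simp only [div_eq_mul_inv, e2] at b4
  constructor
  · linarith
  · calc R * |h 0 1| ≤ ℓ ^ (1 + 4 * κ) * (16 * ℓ ^ ((1 - κ) * (-1 - 10 * κ))) := by gcongr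
      _ ≤ δ := by linarith
  · exact hD.h10.trans hrδ
  · linarith
  · exact fun i j => (hD.rot i j).trans hrδ
  · intro j
    calc R * |weightCoord B j 0| ≤ ℓ ^ (1 + 4 * κ) * (4 * r * ℓ ^ (-2 + 2 * κ)) := by
          gcongr; exact (b4 j).1
      _ = 4 * r * (ℓ ^ (1 + 4 * κ) * ℓ ^ (-2 + 2 * κ)) := by ring
      _ ≤ 4 * r * x := by gcongr
      _ ≤ δ := by nlinarith
  · intro j
    calc |weightCoord B j 1| ≤ 3 * r * ℓ * ℓ ^ (-2 + 2 * κ) := (b4 j).2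
      _ = 3 * r * (ℓ * ℓ ^ (-2 + 2 * κ)) := by ring
      _ ≤ 3 * r * x := by gcongr
      _ ≤ δ := by nlinarith
  · exact fun j => (abs_weightCoord_le hD.row j 2).trans hrδ

theorem IsDecomposed.isSmallAt_of_mul_le {k : ℕ} {q r δ R : ℝ} {g : SOn1 k}
    {h : Matrix.SpecialLinearGroup (Fin 2) ℝ} {S : Matrix (Fin k) (Fin k) ℝ}
    {B : Matrix (Fin k) (Fin 3) ℝ} (hD : IsDecomposed q r g h S B) (hrδ : r ≤ δ) (hR0 : 0 ≤ R)
    (hR : R * r ≤ δ) : IsSmallAt δ R h S B where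
  h00 := hD.h00.trans hrδ
  h01 := (mul_le_mul_of_nonneg_left hD.h01 hR0).trans hR
  h10 := hD.h10.trans hrδ
  h11 := hD.h11.trans hrδ
  rot i j := (hD.rot i j).trans hrδ
  w0 j := (mul_le_mul_of_nonneg_left (abs_weightCoord_le hD.row j 0) hR0).trans hR
  w1 j := (abs_weightCoord_le hD.row j 1).trans hrδ
  w2 j := (abs_weightCoord_le hD.row j 2).trans hrδ

/-- A time change `t` on a set `A` that is sublinearly close to the identity at scales above `m`. -/
structure IsTameTimeChange (A : Set ℝ) (t : ℝ → ℝ) (m η : ℝ) : Prop where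
  mono : MonotoneOn t A
  dist_le : ∀ s ∈ A, ∀ s' ∈ A, s < s' → m ≤ max (s' - s) (t s' - t s) →
    |(t s' - t s) - (s' - s)| ≤ |s' - s| ^ (1 - η)

theorem IsTameTimeChange.mul_nonneg {A : Set ℝ} {t : ℝ → ℝ} {m η : ℝ}
    (ht : IsTameTimeChange A t m η) {s p : ℝ} (hs : s ∈ A) (hp : p ∈ A) :
    0 ≤ (p - s) * (t p - t s) := by
  rcases le_total s p with h | h
  · exact _root_.mul_nonneg (by linarith) (by linarith [ht.mono hs hp h])
  · exact mul_nonneg_of_nonpos_of_nonpos (by linarith) (by linarith [ht.mono hp hs h])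

theorem IsTameTimeChange.abs_sub_le {A : Set ℝ} {t : ℝ → ℝ} {m η : ℝ}
    (ht : IsTameTimeChange A t m η) (hm : 0 < m) {s p : ℝ} (hs : s ∈ A) (hp : p ∈ A)
    (h : m ≤ |p - s|) : |(t p - t s) - (p - s)| ≤ |p - s| ^ (1 - η) := by
  rcases lt_trichotomy s p with hsp | rfl | hsp
  · rw [abs_of_pos (sub_pos.2 hsp)] at h
    exact ht.dist_le s hs p hp hsp (h.trans (le_max_left _ _))
  · simp at h; linarith
  · rw [abs_sub_comm, abs_of_pos (sub_pos.2 hsp)] at h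
    have := ht.dist_le p hp s hs hsp (h.trans (le_max_left _ _))
    rw [abs_sub_comm p s, abs_sub_comm]
    convert this using 2
    ring

theorem IsTameTimeChange.abs_le {A : Set ℝ} {t : ℝ → ℝ} {m η Q : ℝ}
    (ht : IsTameTimeChange A t m η) (hη : η ∈ Ioo (0 : ℝ) 1) (hQ : 1 ≤ Q) (hmQ : m ≤ Q) {s p : ℝ}
    (hs : s ∈ A) (hp : p ∈ A) (h : |p - s| ≤ Q) : |t p - t s| ≤ 2 * Q := by
  wlog hsp : s < p generalizing s p
  · rcases (not_lt.1 hsp).eq_or_lt with rfl | hlt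
    · simp; linarith
    · rw [abs_sub_comm]
      exact this hp hs (by rwa [abs_sub_comm]) hlt
  have hmono := ht.mono hs hp hsp.le
  rcases le_or_gt m (max (p - s) (t p - t s)) with hm | hm
  · have h1 := ht.dist_le s hs p hp hsp hm
    have h2 : |p - s| ^ (1 - η) ≤ Q := by
      calc |p - s| ^ (1 - η) ≤ Q ^ (1 - η) :=
            Real.rpow_le_rpow (abs_nonneg _) h (by linarith [hη.2])
        _ ≤ Q ^ (1 : ℝ) := Real.rpow_le_rpow_of_exponent_le hQ (by linarith [hη.1])
        _ = Q := Real.rpow_one Q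
    have h3 := abs_sub_abs_le_abs_sub (t p - t s) (p - s)
    linarith
  · have h1 := (le_max_right (p - s) (t p - t s)).trans_lt hm
    rw [abs_of_nonneg (by linarith)]
    linarith

/-- The bounds at a point of a return triple of a single class. -/
theorem bounds_of_isSpreadTriple {k : ℕ} {A : Set ℝ} {t : ℝ → ℝ} {m η q r L E : ℝ}
    (ht : IsTameTimeChange A t m η) (hη : η ∈ Ioo (0 : ℝ) 1) (hm : 0 < m) {g : ℝ → SOn1 k}
    {h : ℝ → Matrix.SpecialLinearGroup (Fin 2) ℝ} {S : ℝ → Matrix (Fin k) (Fin k) ℝ}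
    {B : ℝ → Matrix (Fin k) (Fin 3) ℝ}
    (hD : ∀ s ∈ A, IsDecomposed q r (g s) (h s) (S s) (B s)) (hr : r ≤ 1 / 100) (hL : 1 ≤ L)
    (hL2 : 2 ≤ L ^ η) (hmL : m ≤ L) {s p p' : ℝ}
    (hT : IsSpreadTriple {a ∈ A | initialDisplacement a (t a) (g a)
      = initialDisplacement s (t s) (g s)} L E s p p') :
    (|h s 0 1| ≤ 16 * L ^ (-1 - η) ∧ |h s 0 0 - 1| ≤ 100 * (E * L ^ (-1 - η)) ∧
      |h s 1 1 - 1| ≤ 100 * (E * L ^ (-1 - η))) ∧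
      ∀ j, |weightCoord (B s) j 0| ≤ 4 * r / L ^ 2 ∧
        |weightCoord (B s) j 1| ≤ 3 * r * E / L ^ 2 := by
  obtain ⟨⟨hs, -⟩, ⟨hp, hpc⟩, ⟨hp', hpc'⟩, h1, h2, h3, h4, -⟩ := hT
  have hn : ∀ a ∈ A, initialDisplacement a (t a) (g a) = initialDisplacement s (t s) (g s) →
      ‖toMat k (uflow k (t a - t s) * g s * (uflow k (a - s))⁻¹) - 1‖ ≤ q := by
    intro a ha hac
    rw [initialDisplacement_eq_iff.1 hac.symm, mul_inv_cancel_right]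
    exact (hD a ha).norm_le
  have e : p - s - (p' - s) = p - p' := by ring
  refine (hD s hs).bounds hη hr hL hL2 h1 h2 (by rwa [e]) h4
    (ht.abs_sub_le hm hs hp (hmL.trans h1)) (ht.abs_sub_le hm hs hp' (hmL.trans h2)) ?_
    (ht.mul_nonneg hs hp) (ht.mul_nonneg hs hp') (hn p hp hpc) (hn p' hp' hpc')
  rw [e, show t p - t s - (t p' - t s) = t p - t p' by ring]
  exact ht.abs_sub_le hm hp' hp (hmL.trans h3)

end Returns

section Main

open scoped Matrix.Norms.Operator

theorem diagSL_one_pow (j : ℕ) : diagSL 1 ^ j = diagSL j := by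
  induction j with
  | zero =>
    rw [pow_zero]
    ext a b
    fin_cases a <;> fin_cases b <;> simp [diagSL]
  | succ j ih =>
    rw [pow_succ, ih]
    ext a b
    rw [Matrix.SpecialLinearGroup.coe_mul]
    fin_cases a <;> fin_cases b <;> simp [diagSL, ← Real.exp_add] <;> ring

/-- If the trajectory of `p` under the geodesic flow often visits a compact set, then two
displacements over `p` that stay small up to the time `(1 + 4 κ) log ℓ` and are related by times at
most `2 ℓ ^ (1 + κ)` are related in the group. -/
theorem exists_closing_of_recurrent {k : ℕ} (Γ : Subgroup (SOn1 k)) [DiscreteTopology Γ]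
    {C : Set (SOn1 k)} (hC : IsCompact C) {κ : ℝ} (hκ : 0 < κ) (hκ1 : κ ≤ 1 / 10) :
    ∃ δ > 0, ∀ ℓ : ℝ, 0 < ℓ → 2 < κ * Real.log ℓ → 100 * ℓ ^ (-κ) ≤ δ → ∀ p : SOn1 k ⧸ Γ,
      (∀ N : ℕ, birkhoffSum (fun x : SOn1 k ⧸ Γ => iota k (diagSL 1) • x)
        ((((↑) : SOn1 k → SOn1 k ⧸ Γ) '' C)ᶜ.indicator fun _ => (1 : ℝ)) N p ≤ κ / 2 * N) →
      ∀ s t : ℝ, |s| ≤ ℓ ^ (1 + κ) → |t| ≤ 2 * ℓ ^ (1 + κ) → ∀ (g g' : SOn1 k)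
        (h h' : Matrix.SpecialLinearGroup (Fin 2) ℝ) (S S' : Matrix (Fin k) (Fin k) ℝ)
        (B B' : Matrix (Fin k) (Fin 3) ℝ),
      toMat k g = toMat k (iota k h) * NormedSpace.exp (vmat S B) →
      toMat k g' = toMat k (iota k h') * NormedSpace.exp (vmat S' B') →
      (∀ R, 0 ≤ R → R ≤ ℓ ^ (1 + 4 * κ) → IsSmallAt δ R h S B) →
      (∀ R, 0 ≤ R → R ≤ ℓ ^ (1 + 4 * κ) → IsSmallAt δ R h' S' B') →
      uflow k t • g • p = g' • uflow k s • p → uflow k t * g = g' * uflow k s := by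
  obtain ⟨δ, hδ, H⟩ := exists_closing Γ hC
  refine ⟨δ, hδ, fun ℓ hℓ hlog hℓδ p hp s t hs ht g g' h h' S S' B B' hg hg' hsm hsm' heq => ?_⟩
  set q := Real.log ℓ with hq
  have hq0 : 0 < q := by
    by_contra hcon
    nlinarith
  obtain ⟨i, hi1, hi2, hi⟩ := exists_iterate_notMem_of_birkhoffSum_le (by positivity) hp
    (p := (1 + 2 * κ) * q) (q := (1 + 4 * κ) * q) (by positivity) (by positivity)
    (by nlinarith [mul_pos hκ hq0])
  rw [Set.notMem_compl_iff] at hi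
  have hpow : ∀ j : ℕ, (fun x : SOn1 k ⧸ Γ => iota k (diagSL 1) • x)^[j] p
      = iota k (diagSL j) • p := by
    intro j
    rw [smul_iterate, ← map_pow, diagSL_one_pow]
  rw [hpow] at hi
  have hexp : ∀ y : ℝ, ℓ ^ y = Real.exp (y * q) := fun y => by
    rw [Real.rpow_def_of_pos hℓ, mul_comm]
  have hlow : ℓ ^ (1 + κ) ≤ ℓ ^ (-κ) * Real.exp i := by
    rw [hexp, hexp, ← Real.exp_add]
    exact Real.exp_le_exp.2 (by nlinarith)
  have hup : Real.exp i ≤ ℓ ^ (1 + 4 * κ) := by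
    rw [hexp]
    exact Real.exp_le_exp.2 hi2
  have hbd : 2 * ℓ ^ (1 + κ) ≤ δ * Real.exp i := by
    have h1 : 0 < ℓ ^ (-κ) * Real.exp i := by positivity
    nlinarith [mul_le_mul_of_nonneg_right hℓδ (Real.exp_pos (i : ℝ)).le]
  have h0 : 0 < ℓ ^ (1 + κ) := by positivity
  exact H i p (Nat.cast_nonneg i) hi s t (by linarith) (by linarith) g g' h h' S S' B B' hg hg'
    (hsm _ (Real.exp_pos _).le hup) (hsm' _ (Real.exp_pos _).le hup) heq

theorem le_rpow_neg_of_mul_sq_le {r l R x : ℝ} (hr0 : 0 ≤ r) (hr : r ≤ 1) (hl : 0 < l) (hlR : l ≤ R)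
    (h : r * R ^ 2 ≤ 1) (hx0 : 0 ≤ x) (hx : x ≤ 2) : r ≤ l ^ (-x) := by
  rcases le_total l 1 with hl1 | hl1
  · exact hr.trans (Real.one_le_rpow_of_pos_of_le_one_of_nonpos hl hl1 (by linarith))
  · have h1 : r * l ^ 2 ≤ 1 := le_trans (by gcongr) h
    calc r ≤ 1 / l ^ 2 := by rwa [le_div_iff₀ (by positivity)]
      _ = l ^ (-2 : ℝ) := by rw [Real.rpow_neg hl.le]; norm_num
      _ ≤ l ^ (-x) := Real.rpow_le_rpow_of_exponent_le hl1 (by linarith)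

theorem div_eight_rpow_le {l η : ℝ} (hl : 0 < l) (hη : η ≤ 1) :
    (l / 8) ^ (-1 - η) ≤ 64 * l ^ (-1 - η) := by
  rw [Real.div_rpow hl.le (by norm_num), show -1 - η = -(1 + η) by ring,
    Real.rpow_neg (by norm_num : (0 : ℝ) ≤ 8), div_inv_eq_mul, mul_comm]
  gcongr
  calc (8 : ℝ) ^ (1 + η) ≤ 8 ^ (2 : ℝ) :=
        Real.rpow_le_rpow_of_exponent_le (by norm_num) (by linarith)
    _ = 64 := by norm_num

/-- The bounds of a return triple of comparable size `l`. -/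
theorem IsDecomposed.bounds_rpow {k : ℕ} {q r η l R : ℝ} {g : SOn1 k}
    {h : Matrix.SpecialLinearGroup (Fin 2) ℝ} {S : Matrix (Fin k) (Fin k) ℝ}
    {B : Matrix (Fin k) (Fin 3) ℝ} (hD : IsDecomposed q r g h S B) (hη : η ∈ Ioo (0 : ℝ) 1)
    (hr : r ≤ 1 / 100) (hR1 : 1 ≤ R) (hR : r * R ^ 2 ≤ 1) (hl : 0 < l)
    (hb : R ≤ l → (|h 0 1| ≤ 16 * (l / 8) ^ (-1 - η) ∧
      |h 0 0 - 1| ≤ 100 * (l * (l / 8) ^ (-1 - η)) ∧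
      |h 1 1 - 1| ≤ 100 * (l * (l / 8) ^ (-1 - η))) ∧
      ∀ j, |weightCoord B j 0| ≤ 4 * r / (l / 8) ^ 2 ∧
        |weightCoord B j 1| ≤ 3 * r * l / (l / 8) ^ 2) :
    (|h 0 0 - 1| ≤ 6400 * l ^ (-η) ∧ |h 0 1| ≤ 6400 * l ^ (-1 - η) ∧
      |h 1 1 - 1| ≤ 6400 * l ^ (-η)) ∧
      ∀ j, |weightCoord B j 0| ≤ 6400 * l ^ (-(1 + η)) ∧
        |weightCoord B j 1| ≤ 6400 * l ^ (-((1 + η) / 2)) := by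
  obtain ⟨hη0, hη1⟩ := hη
  have hr0 : 0 ≤ r := (abs_nonneg _).trans hD.h01
  rcases le_total l R with hlR | hlR
  · have key : ∀ x : ℝ, 0 ≤ x → x ≤ 2 → ∀ z : ℝ, |z| ≤ r → |z| ≤ 6400 * l ^ (-x) := by
      intro x hx0 hx2 z hz
      have h1 := le_rpow_neg_of_mul_sq_le hr0 (by linarith) hl hlR hR hx0 hx2
      have h2 : 0 < l ^ (-x) := Real.rpow_pos_of_pos hl _
      linarith
    refine ⟨⟨key η hη0.le (by linarith) _ hD.h00, ?_, key η hη0.le (by linarith) _ hD.h11⟩,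
      fun j => ⟨key _ (by linarith) (by linarith) _ (abs_weightCoord_le hD.row j 0),
        key _ (by linarith) (by linarith) _ (abs_weightCoord_le hD.row j 1)⟩⟩
    rw [show -1 - η = -(1 + η) by ring]
    exact key _ (by linarith) (by linarith) _ hD.h01
  · obtain ⟨⟨b1, b2, b3⟩, b4⟩ := hb hlR
    have hl1 : 1 ≤ l := hR1.trans hlR
    have e1 := div_eight_rpow_le hl hη1.le
    have e2 : l * l ^ (-1 - η) = l ^ (-η) := by
      rw [show -1 - η = -η - 1 by ring, Real.rpow_sub_one hl.ne']
      field_simp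
    have e3 : l * (l / 8) ^ (-1 - η) ≤ 64 * l ^ (-η) := by
      rw [← e2]
      calc l * (l / 8) ^ (-1 - η) ≤ l * (64 * l ^ (-1 - η)) := by gcongr
        _ = _ := by ring
    have p1 : 0 < l ^ (-1 - η) := Real.rpow_pos_of_pos hl _
    have p2 : 0 < l ^ (-(1 + η)) := Real.rpow_pos_of_pos hl _
    have p3 : 0 < l ^ (-((1 + η) / 2)) := Real.rpow_pos_of_pos hl _
    refine ⟨⟨by linarith, by linarith, by linarith⟩, fun j => ⟨(b4 j).1.trans ?_, (b4 j).2.trans ?_⟩⟩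
    · calc 4 * r / (l / 8) ^ 2 = 256 * r * l ^ (-2 : ℝ) := by
            rw [Real.rpow_neg hl.le, Real.rpow_two]
            field_simp
            ring
        _ ≤ 256 * r * l ^ (-(1 + η)) := by gcongr; linarith
        _ ≤ _ := by nlinarith
    · calc 3 * r * l / (l / 8) ^ 2 = 192 * r * l ^ (-1 : ℝ) := by
            rw [Real.rpow_neg_one]
            field_simp
            ring
        _ ≤ 192 * r * l ^ (-((1 + η) / 2)) := by gcongr; linarith
        _ ≤ _ := by nlinarith

theorem exists_pos_lt_one_forall_mul_le {D ε₁ δ M : ℝ} (hD : 0 < D) (hε₁ : 0 < ε₁) (hδ : 0 < δ)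
    (hM : 0 < M) : ∃ ε₀ ∈ Ioo (0 : ℝ) 1, ε₀ ≤ ε₁ ∧ ∀ ε ≤ ε₀, D * ε ≤ δ ∧ M * (D * ε) ≤ δ := by
  refine ⟨min (min (1 / 2) ε₁) (min (δ / D) (δ / (M * D))), ⟨by positivity, ?_⟩, ?_, ?_⟩
  · exact ((min_le_left _ _).trans (min_le_left _ _)).trans_lt (by norm_num)
  · exact (min_le_left _ _).trans (min_le_right _ _)
  · intro ε hε
    have h1 := hε.trans ((min_le_right _ _).trans (min_le_left _ _))
    have h2 := hε.trans ((min_le_right _ _).trans (min_le_right _ _))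
    rw [le_div_iff₀ (by positivity)] at h1 h2
    exact ⟨by linarith, by linarith⟩

end Main

theorem proposition3 (k : ℕ)
    (Γ : Subgroup (SOn1 k)) [DiscreteTopology Γ]
    [MeasurableSpace (SOn1 k ⧸ Γ)] [BorelSpace (SOn1 k ⧸ Γ)]
    (μ : Measure (SOn1 k ⧸ Γ)) [IsProbabilityMeasure μ] [SMulInvariantMeasure (SOn1 k) (SOn1 k ⧸ Γ) μ]
    (dG : SOn1 k → SOn1 k → ℝ) (hdG : IsRightInvariantMetric k dG)
    (η : ℝ) (hη : η ∈ Ioo (0 : ℝ) 1) :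
    ∃ ρ : ℝ, 0 < ρ ∧ ∃ θ : ℝ, 0 < θ ∧ ∃ C : ℝ, 0 < C ∧ ∃ σρ : ℝ, 0 < σρ ∧ ∀ σ ∈ Ioo (0 : ℝ) σρ,
      ∃ K : Set (SOn1 k ⧸ Γ), IsCompact K ∧ ENNReal.ofReal (1 - σ) < μ K ∧
      ∀ m : ℝ, 1 < m → ∃ ε₀ ∈ Ioo (0 : ℝ) 1, ∀ ε ∈ Ioc (0 : ℝ) ε₀,
      ∀ x ∈ K, ∀ y : SOn1 k ⧸ Γ, dX k dG Γ x y < ε →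
      ∀ A ⊆ Ici (0 : ℝ), ∀ t : ℝ → ℝ, MonotoneOn t (Ici 0) → MapsTo t (Ici 0) (Ici 0) →
      (∀ s ∈ A, uflow k s • x ∈ K ∧ dX k dG Γ (uflow k (t s) • y) (uflow k s • x) < ε) →
      (∀ s ∈ A, ∀ s' ∈ A, s < s' → m ≤ max (s' - s) (t s' - t s) →
        |(t s' - t s) - (s' - s)| ≤ |s' - s| ^ (1 - η)) →
      ∀ l ∈ A, ENNReal.ofReal ((1 - θ) * l) < volume (A ∩ Icc 0 l) →
      ∃ s ∈ A ∩ Icc 0 l, ∃ h : Matrix.SpecialLinearGroup (Fin 2) ℝ, ∃ v ∈ Vperp k,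
        uflow k (t s) • y = (iota k h * expG k v) • (uflow k s • x) ∧
        |h 0 0 - 1| ≤ C * l ^ (-2 * ρ) ∧ |h 0 1| ≤ C * l ^ (-1 - 2 * ρ) ∧
        |h 1 0| ≤ C * ε ∧ |h 1 1 - 1| ≤ C * l ^ (-2 * ρ) ∧
        ∃ (b : Fin k → Fin 3 → ℝ) (S : Matrix (Fin k) (Fin k) ℝ),
          (v : Mat k) = (∑ j, ∑ i, b j i • weightVector k j i) + rotationPart k S ∧
          (∀ j, |b j 0| ≤ C * l ^ (-((1 + 2 * ρ) / 2 * 2)) ∧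
            |b j 1| ≤ C * l ^ (-((1 + 2 * ρ) / 2)) ∧ |b j 2| ≤ C * ε) ∧
          ∀ i j, |S i j| ≤ C * ε := by
  have hη0 := hη.1
  have hη1 := hη.2
  obtain ⟨κ, rfl⟩ : ∃ κ, η = 10 * κ := ⟨η / 10, by ring⟩
  have hκ : 0 < κ := by linarith
  have hκ1 : κ ≤ 1 / 10 := by linarith
  obtain ⟨c, D, hD, ε₁, hε₁, hdec⟩ := hdG.exists_isDecomposed
  refine ⟨5 * κ, by positivity, 1 / 4, by norm_num, 6400 + D, by positivity, 1, one_pos,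
    fun σ hσ => ?_⟩
  obtain ⟨F, hF, K, hK, hμK, hrec⟩ := exists_compact_recurrent Γ μ (iota k (diagSL 1)) hσ.1 hσ.2
    (half_pos hκ)
  obtain ⟨δ, hδ, hclose⟩ := exists_closing_of_recurrent Γ hF hκ hκ1
  refine ⟨K, hK, hμK, fun m hm => ?_⟩
  obtain ⟨M, hM, hmM, hmM', hM2, hMδ, hMlog, hMsum⟩ := exists_scale (m := m) hκ hκ1 hδ
  have hM0 : 0 < M := by linarith
  obtain ⟨ε₀, hε₀, hε₀₁, hsmall⟩ := exists_pos_lt_one_forall_mul_le hD hε₁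
    (lt_min hδ (by norm_num : (0 : ℝ) < 1 / 100))
    (by positivity : 0 < M ^ (1 + 4 * κ) + (8 * M) ^ 2)
  refine ⟨ε₀, hε₀, fun ε hε x hx y _ A hA t ht _ hreturn htame l hl hvol => ?_⟩
  obtain ⟨hr, hrM⟩ := hsmall ε hε.2
  obtain ⟨hrδ, hr100⟩ := le_min_iff.1 hr
  obtain ⟨hrMδ, hrM100⟩ := le_min_iff.1 hrM
  have hr0 : 0 < D * ε := mul_pos hD hε.1
  have hl0 : 0 < l := by
    refine (mem_Ici.1 (hA hl)).lt_of_ne ?_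
    rintro rfl
    have : volume (A ∩ Icc (0 : ℝ) 0) ≤ 0 := (measure_mono inter_subset_right).trans (by simp)
    simp at hvol
    exact absurd hvol (by simpa using this)
  set A' := A ∩ Icc 0 l with hA'
  have hex : ∀ s ∈ A', ∃ (g : SOn1 k) (h : Matrix.SpecialLinearGroup (Fin 2) ℝ)
      (S : Matrix (Fin k) (Fin k) ℝ) (B : Matrix (Fin k) (Fin 3) ℝ),
      uflow k (t s) • y = g • uflow k s • x ∧
      IsDecomposed (c * ε) (D * ε) g h S B := by
    intro s hs
    obtain ⟨g, hg, hg'⟩ := exists_smul_eq_of_dX_lt hdG (hreturn s hs.1).2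
    obtain ⟨h, S, B, hdec'⟩ := hdec ε (hε.2.trans hε₀₁) g hg'
    exact ⟨g, h, S, B, hg, hdec'⟩
  choose! g h S B hgy hdec' using hex
  have htame' : IsTameTimeChange A' t m (10 * κ) :=
    ⟨ht.mono fun s hs => hA hs.1, fun s hs s' hs' => htame s hs.1 s' hs'.1⟩
  have hsame : ∀ ℓ, M ≤ ℓ → ∀ s ∈ A', ∀ s' ∈ A', |s - s'| ≤ ℓ ^ (1 + κ) →
      (∀ R, 0 ≤ R → R ≤ ℓ ^ (1 + 4 * κ) → IsSmallAt δ R (h s) (S s) (B s)) →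
      (∀ R, 0 ≤ R → R ≤ ℓ ^ (1 + 4 * κ) → IsSmallAt δ R (h s') (S s') (B s')) →
      initialDisplacement s (t s) (g s) = initialDisplacement s' (t s') (g s') := by
    intro ℓ hℓ s hs s' hs' hss hsm hsm'
    have hℓ1 : 1 < ℓ := hM.trans_le hℓ
    have hℓκ : M ≤ ℓ ^ (1 + κ) := hℓ.trans (Real.self_le_rpow_of_one_le hℓ1.le (by linarith))
    rw [abs_sub_comm] at hss
    refine initialDisplacement_eq_iff.2 (hclose ℓ (by linarith)
      (hMlog.trans_le (by gcongr)) (le_trans (mul_le_mul_of_nonneg_left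
        (Real.rpow_le_rpow_of_nonpos hM0 hℓ (by linarith)) (by norm_num)) hMδ)
      (uflow k s • x) (hrec _ (hreturn s hs.1).1) _ _ hss
      (htame'.abs_le hη (hM.le.trans hℓκ) (hmM.trans hℓκ) hs hs' hss) _ _ _ _ _ _ _ _
      (hdec' s hs).eq_mul (hdec' s' hs').eq_mul hsm hsm' ?_)
    rw [← hgy s hs, uflow_sub, uflow_sub, smul_smul, inv_mul_cancel_right, hgy s' hs',
      smul_smul (uflow k s' * _), inv_mul_cancel_right]
  obtain ⟨s, p, p', hT⟩ := exists_spread_triple_of_density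
    (fun s => initialDisplacement s (t s) (g s)) hκ hM hMsum hl0 (A := A') inter_subset_right
    (fun s hs s' hs' hss => hsame M le_rfl s hs s' hs'
      (hss.trans (Real.self_le_rpow_of_one_le hM.le (by linarith)))
      (fun R hR hRM => (hdec' s hs).isSmallAt_of_mul_le hrδ hR (by nlinarith))
      (fun R hR hRM => (hdec' s' hs').isSmallAt_of_mul_le hrδ hR (by nlinarith)))
    (fun ℓ hℓ s s' p q p' q' hT hT' hss => by
      have hℓ1 : 1 < ℓ := hM.trans_le hℓ
      have hLM : M ^ (1 - κ) ≤ ℓ ^ (1 - κ) := Real.rpow_le_rpow hM0.le hℓ (by linarith)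
      have hL2 : 2 ≤ (ℓ ^ (1 - κ)) ^ (10 * κ) := hM2.trans
        (Real.rpow_le_rpow (by positivity) hLM (by positivity))
      have hℓδ : 100 * ℓ ^ (-κ) ≤ δ := le_trans (mul_le_mul_of_nonneg_left
        (Real.rpow_le_rpow_of_nonpos hM0 hℓ (by linarith)) (by norm_num)) hMδ
      have hL1 : 1 ≤ ℓ ^ (1 - κ) := Real.one_le_rpow hℓ1.le (by linarith)
      exact hsame ℓ hℓ s hT.1.1 s' hT'.1.1 hss
        (fun R _ hR => (hdec' s hT.1.1).isSmallAt hr100 hrδ hκ hκ1 hℓ1.le hℓδ hR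
          (bounds_of_isSpreadTriple htame' hη (by linarith) hdec' hr100 hL1 hL2
            (hmM'.trans hLM) hT))
        (fun R _ hR => (hdec' s' hT'.1.1).isSmallAt hr100 hrδ hκ hκ1 hℓ1.le hℓδ hR
          (bounds_of_isSpreadTriple htame' hη (by linarith) hdec' hr100 hL1 hL2
            (hmM'.trans hLM) hT')))
    (by convert hvol using 2; norm_num)
  have hs : s ∈ A' := hT.1.1
  have hds := hdec' s hs
  obtain ⟨⟨b1, b2, b3⟩, b4⟩ := hds.bounds_rpow hη hr100 (R := 8 * M) (by linarith)
    (by nlinarith [mul_pos hr0 (Real.rpow_pos_of_pos hM0 (1 + 4 * κ))]) hl0 fun hlM =>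
      bounds_of_isSpreadTriple htame' hη (by linarith) hdec' hr100 (by linarith)
        (hM2.trans (Real.rpow_le_rpow (by positivity)
          ((Real.rpow_le_self_of_one_le hM.le (by linarith)).trans (by linarith))
          (by positivity))) (by linarith) hT
  have hup : ∀ a : ℝ, 6400 * l ^ a ≤ (6400 + D) * l ^ a := fun a => by
    gcongr
    linarith
  have hDε : D * ε ≤ (6400 + D) * ε := by linarith [hε.1]
  have e1 : -2 * (5 * κ) = -(10 * κ) := by ring
  have e2 : -1 - 2 * (5 * κ) = -1 - 10 * κ := by ring
  have e3 : -((1 + 2 * (5 * κ)) / 2 * 2) = -(1 + 10 * κ) := by ring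
  have e4 : -((1 + 2 * (5 * κ)) / 2) = -((1 + 10 * κ) / 2) := by ring
  rw [e1, e2, e3, e4]
  refine ⟨s, hs, h s, ⟨vmat (S s) (B s), vmat_mem_so hds.skew _⟩, vmat_mem_Vperp hds.skew _, ?_,
    b1.trans (hup _), b2.trans (hup _), hds.h10.trans hDε, b3.trans (hup _), weightCoord (B s), S s,
    vmat_eq_sum_weightVector _ _, fun j => ⟨(b4 j).1.trans (hup _), (b4 j).2.trans (hup _),
      (abs_weightCoord_le hds.row j 2).trans hDε⟩, fun i j => (hds.rot i j).trans hDε⟩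
  rw [hgy s hs]
  congr 1
  apply toMat_injective k
  rw [map_mul, toMat_expG]
  exact hds.eq_mul
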